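/- Let $N,d,p,q$ be natural numbers, let $B_1,\dots,B_q$ and $A_1,\dots,A_p$ be real $N\times N$ matrices, and let $\Gamma$ be a real $N\times d$ matrix. Let $X=(X_t)_{t\in\mathbb Z}$ be a (strictly) stationary and ergodic process in $\mathbb R^d$, defined on a probability space $(\Omega_0,P_0)$, with $\mathbb E\log_+|X_0|<\infty$. Let $\nu$ be a probability measure on $\mathbb R^N$ (the distribution of the noise $\varepsilon_0$) whose support is all of $\mathbb R^N$ and whose cumulative distribution function $x\mapsto\nu(\prod_i(-\infty,x_i])$ is Lipschitz. Assume that all complex roots of $$\mathcal P(z)=\det\Bigl(I_N-\sum_{j=1}^q B_jz^j\Bigr)$$ satisfy $|z|>1$. For $I\subset\{1,\dots,N\}$ and $c\in\mathbb R^N$ let $\mathbf 1_I\in\{0,1\}^N$ be the indicator vector of $I$ and $$C_I(c)=\{e\in\mathbb R^N: e_i>-c_i\ (i\in I),\ e_i\le -c_i\ (i\notin I)\}.$$ Given a process $X'=(X'_t)_{t\in\mathbb Z}$ with the law of $X$ on some probability space $(\Omega,P)$, a *stationary solution* is a pair of $\mathbb R^N$-valued processes $(Y_t)_{t\in\mathbb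 Z}$, $(\mu_t)_{t\in\mathbb Z}$ on $(\Omega,P)$ such that $((Y_t,\mu_t))_{t\in\mathbb Z}$ is stationary and, for all $t\in\mathbb Z$, almost surely, $$\mu_t=\sum_{j=1}^qB_j\mu_{t-j}+\sum_{k=1}^pA_kY_{t-k}+\Gamma X'_t,$$ $$P\bigl(Y_t=\mathbf 1_I\mid (Y_s)_{s<t},\,(X'_s)_{s\in\mathbb Z}\bigr)=\nu\bigl(C_I(\mu_t)\bigr)\qquad\text{for all } I\subset\{1,\dots,N\}.$$ Then: 1. (Existence) On some enlargement $(\Omega,P)$ of $(\Omega_0,P_0)$, that is, a probability space with a measure-preserving map $\pi:\Omega\to\Omega_0$, there is a stationary solution $(Y,\mu)$ for the covariate process $X_t\circ\pi$. Moreover $(\Omega,P)$ carries an i.i.d. sequence $(\varepsilon_t)_{t\in\mathbb Z}$ with distribution $\nu$, independent of the process $(X_t\circ\pi)_{t\in\mathbb Z}$, such that for all $t\in\mathbb Z$, almost surely, $Y_t=\bigl(\mathbf 1_{\{\mu_{i,t}+\varepsilon_{i,t}>0\}}\bigr)_{1\le i\le N}$. 2. (Uniqueness) Any two stationary solutions,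 possibly on different probability spaces and for covariate processes with the law of $X$, have the same law: the process $((Y_t,\mu_t,X'_t))_{t\in\mathbb Z}$ has the same law for both. 3. For every stationary solution the process $((Y_t,X'_t))_{t\in\mathbb Z}$ is stationary and ergodic. -/

import Mathlib

open MeasureTheory ProbabilityTheory

universe u v w r

namespace DiscreteChoice

/-- The left shift `(x_t) ↦ (x_{t+1})` on two-sided sequences. -/
def shift {α : Type*} (x : ℤ → α) : ℤ → α := fun t => x (t + 1)

/-- The law of a process indexed by `ℤ`, as a measure on the space of two-sided paths (with the
product sigma-algebra). -/
noncomputable def processLaw {Ω α : Type*} [MeasurableSpace Ω] [MeasurableSpace α]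
    (P : Measure Ω) (Z : ℤ → Ω → α) : Measure (ℤ → α) :=
  P.map (fun ω t => Z t ω)

/-- Strict stationarity: the law of the process is invariant under the shift. -/
def IsStationary {Ω α : Type*} [MeasurableSpace Ω] [MeasurableSpace α]
    (P : Measure Ω) (Z : ℤ → Ω → α) : Prop :=
  MeasurePreserving shift (processLaw P Z) (processLaw P Z)

/-- Ergodicity of a (stationary) process: the shift is ergodic for the law of the process. -/
def IsErgodic {Ω α : Type*} [MeasurableSpace Ω] [MeasurableSpace α]
    (P : Measure Ω) (Z : ℤ → Ω → α) : Prop :=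
  Ergodic shift (processLaw P Z)

/-- The joint cumulative distribution function of a probability measure on `ℝ^N`
(`Set.Iic x` is the orthant of all `e` with `e i ≤ x i` for every `i`). -/
noncomputable def jointCdf {N : ℕ} (ν : Measure (Fin N → ℝ)) (x : Fin N → ℝ) : ℝ :=
  ν.real (Set.Iic x)

/-- The vector `1_I` of `ℝ^N`: coordinate `i` is `1` if `i ∈ I` and `0` otherwise. -/
noncomputable def indicatorVec {N : ℕ} (I : Set (Fin N)) : Fin N → ℝ :=
  I.indicator (fun _ => 1)

/-- The set of noise values `e` with `e i > - c i` for `i ∈ I` and `e i ≤ - c i` for `i ∉ I`. -/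
def cell {N : ℕ} (I : Set (Fin N)) (c : Fin N → ℝ) : Set (Fin N → ℝ) :=
  {e | (∀ i ∈ I, - c i < e i) ∧ (∀ i ∉ I, e i ≤ - c i)}

/-- The sigma-algebra generated by `Y_s`, `s < t`, and by the whole covariate process `X`. -/
abbrev pastAndCovariates {Ω α β : Type*} [mα : MeasurableSpace α] [mβ : MeasurableSpace β]
    (Y : ℤ → Ω → α) (X : ℤ → Ω → β) (t : ℤ) : MeasurableSpace Ω :=
  (⨆ s : Set.Iio t, mα.comap (Y s)) ⊔ (⨆ s : ℤ, mβ.comap (X s))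

/-- The roots in `ℂ` of `z ↦ det (I - ∑ j, B_j z^j)` are outside the closed unit disc.
The index `j : Fin q` stands for the lag `j + 1`. -/
def RootsOutsideUnitDisc {N q : ℕ} (B : Fin q → Matrix (Fin N) (Fin N) ℝ) : Prop :=
  ∀ z : ℂ, (1 - ∑ j : Fin q, z ^ ((j : ℕ) + 1) • (B j).map Complex.ofReal).det = 0 → 1 < ‖z‖

/-- `(Y, μ)` is a stationary solution of the discrete choice model with covariate process `X`,
noise distribution `ν`, autoregressive matrices `B_1, …, B_q`, response matrices `A_1, …, A_p`
and covariate matrix `Γ` (`B j`, `A k` with `j : Fin q`, `k : Fin p` belong to the lags `j + 1`,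
`k + 1`), on the probability space `(Ω, P)`. -/
structure IsStationarySolution {N d p q : ℕ} {Ω : Type*} [MeasurableSpace Ω]
    (ν : Measure (Fin N → ℝ))
    (B : Fin q → Matrix (Fin N) (Fin N) ℝ) (A : Fin p → Matrix (Fin N) (Fin N) ℝ)
    (Γ : Matrix (Fin N) (Fin d) ℝ) (P : Measure Ω)
    (X : ℤ → Ω → (Fin d → ℝ)) (Y μ : ℤ → Ω → (Fin N → ℝ)) : Prop where
  measurable_X : ∀ t, Measurable (X t)
  measurable_Y : ∀ t, Measurable (Y t)
  measurable_μ : ∀ t, Measurable (μ t)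
  /-- The latent recursion. -/
  recursion : ∀ t : ℤ, ∀ᵐ ω ∂P,
    μ t ω = ∑ j : Fin q, (B j).mulVec (μ (t - ((j : ℕ) + 1)) ω)
      + ∑ k : Fin p, (A k).mulVec (Y (t - ((k : ℕ) + 1)) ω)
      + Γ.mulVec (X t ω)
  /-- The conditional law of `Y_t` given the past of `Y` and the whole process `X`. -/
  condLaw : ∀ (t : ℤ) (I : Set (Fin N)),
    P⟦Y t ⁻¹' {indicatorVec I} | pastAndCovariates Y X t⟧
      =ᵐ[P] fun ω => ν.real (cell I (μ t ω))
  /-- The solution process is stationary. -/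
  stationary : IsStationary P (fun t ω => (Y t ω, μ t ω))

/-- `ε` is an i.i.d. noise with distribution `ν`, independent of the process `X`, which generates
the responses: `Y_{i,t} = 1` if `μ_{i,t} + ε_{i,t} > 0` and `Y_{i,t} = 0` otherwise. -/
structure IsGeneratedByNoise {N d : ℕ} {Ω : Type*} [MeasurableSpace Ω]
    (ν : Measure (Fin N → ℝ)) (P : Measure Ω)
    (X : ℤ → Ω → (Fin d → ℝ)) (Y μ ε : ℤ → Ω → (Fin N → ℝ)) : Prop where
  measurable_ε : ∀ t, Measurable (ε t)
  law_ε : ∀ t, P.map (ε t) = ν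
  iIndep_ε : iIndepFun ε P
  indep_X : IndepFun (fun ω t => ε t ω) (fun ω t => X t ω) P
  choice : ∀ t : ℤ, ∀ᵐ ω ∂P, Y t ω = indicatorVec {i | 0 < μ t ω i + ε t ω i}

end DiscreteChoice

/-! The model is a chain with infinite memory in a random environment. Since the roots of $\mathcal
P$ lie outside the unit disc, the latent recursion is solved by a series in the covariates plus a
series in the past responses, with geometrically decaying coefficients. The responses then obey Y_t
= Φ(X, (Y_s)_{s<t}, ε_t) for one map Φ (`choiceResponse`), of which two properties are needed
(`IsContractive`). Pasts that agree on the last l steps give different responses with probability at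
most β_l, with ∑ β_l finite: the latent vectors differ by O(r^l), and the Lipschitz c.d.f. bounds
the mass of the strips between them. Arbitrary pasts give the same response with probability at
least η(X) > 0: the responses contribute a bounded amount to μ, so a noise beyond a threshold
depending on X makes all responses equal to 1, and ν has full support.

Run two chains from different pasts with the same covariates and noise. The time since their last
disagreement grows by one with probability at least η, and at least 1 - β_l at age l, and otherwise
falls to 0. As η has no positive lower bound, there is no uniform rate. But a reset at time j is the
last one with probability at least half a product of k consecutive values of η, and the events "the
last reset was at j" are disjoint, so the resets weighted by these products have total mass at most
1. The ergodic sums of the products diverge by Poincaré recurrence, hence the age is large with high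
probability (`IsAgeLaw.young_age_bound`, `IsContractive.exists_forgets`).

Forgetting the past gives existence: the response at time 0 of the chain started at -m is Cauchy in
probability, and its limit, a functional of the covariates and of the noise up to time 0, solves the
recursion (`IsContractive.exists_isStationaryResponse`). It gives uniqueness as well: a law with the
right conditional laws can be regenerated from its remote past by fresh noise, and the remote past
may be replaced by a default one (`HasResponseLaw.eq_map_orbit`). For a given stationary solution, μ
must be the series, because the homogeneous part of the recursion contracts geometrically a state
whose law does not change with time (`IsStationarySolution.ae_eq_latent`). So every solution is a
factor of the covariates paired with i.i.d. noise, and this pair is ergodic (`ergodic_shiftPair`).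
-/

namespace DiscreteChoice

/-! ### Renewal estimates for the age since the last reset -/

section Renewal

/-- Abstract properties of the law `p n ℓ = P(L_n = ℓ)` of the age `L_n` of a renewal-type process,
which moves from `(n, ℓ)` to `(n + 1, ℓ + 1)` with probability at least `η n` and at least
`1 - β ℓ`, and is reset to `0` otherwise. -/
structure IsAgeLaw (p : ℕ → ℕ → ℝ) (η β : ℕ → ℝ) : Prop where
  nonneg : ∀ n l, 0 ≤ p n l
  sum_eq : ∀ n, ∑ l ∈ Finset.range (n + 1), p n l = 1
  step_le : ∀ n l, p (n + 1) (l + 1) ≤ p n l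
  le_step : ∀ n l, η n * p n l ≤ p (n + 1) (l + 1)
  le_step' : ∀ n l, (1 - β l) * p n l ≤ p (n + 1) (l + 1)

variable {p : ℕ → ℕ → ℝ} {η β : ℕ → ℝ}

namespace IsAgeLaw

lemma iterate_le (h : IsAgeLaw p η β) (n l r : ℕ) : p (n + r) (l + r) ≤ p n l := by
  induction r with
  | zero => simp
  | succ r ih => exact (h.step_le (n + r) (l + r)).trans ih

lemma prod_mul_le (h : IsAgeLaw p η β) (hη : ∀ n, 0 ≤ η n) (n l r : ℕ) :
    (∏ i ∈ Finset.range r, η (n + i)) * p n l ≤ p (n + r) (l + r) := by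
  induction r with
  | zero => simp
  | succ r ih =>
    rw [Finset.prod_range_succ]
    calc _ = η (n + r) * ((∏ i ∈ Finset.range r, η (n + i)) * p n l) := by ring
      _ ≤ η (n + r) * p (n + r) (l + r) := mul_le_mul_of_nonneg_left ih (hη _)
      _ ≤ _ := h.le_step _ _

/-- Along a diagonal the mass decreases, so step i loses at most β (l + i) times the initial mass.
This linear bound replaces the product of the factors 1 - β and needs no β < 1. -/
lemma one_sub_sum_mul_le (h : IsAgeLaw p η β) (hβ : ∀ n, 0 ≤ β n) (n l r : ℕ) :
    (1 - ∑ i ∈ Finset.range r, β (l + i)) * p n l ≤ p (n + r) (l + r) := by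
  induction r with
  | zero => simp
  | succ r ih =>
    rw [Finset.sum_range_succ]
    have h1 := h.le_step' (n + r) (l + r)
    have h2 := mul_le_mul_of_nonneg_left (h.iterate_le n l r) (hβ (l + r))
    have h3 : p (n + (r + 1)) (l + (r + 1)) = p (n + r + 1) (l + r + 1) := rfl
    rw [h3]; nlinarith

lemma sum_tail_le (hβ : ∀ n, 0 ≤ β n) (hs : Summable β) (k l r : ℕ) (hkl : k ≤ l) :
    ∑ i ∈ Finset.range r, β (l + i) ≤ ∑' i, β (i + k) := by
  have hs' : Summable (fun i => β (i + k)) := (summable_nat_add_iff k).2 hs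
  calc ∑ i ∈ Finset.range r, β (l + i)
      = ∑ i ∈ (Finset.range r).map (addLeftEmbedding (l - k)), β (i + k) := by
        rw [Finset.sum_map]
        refine Finset.sum_congr rfl fun i _ => ?_
        congr 1; simp only [addLeftEmbedding_apply]; omega
    _ ≤ _ := hs'.sum_le_tsum _ fun i _ => hβ _

lemma one_sub_tail_mul_le (h : IsAgeLaw p η β) (hβ : ∀ n, 0 ≤ β n) (hs : Summable β)
    (k n l r : ℕ) (hkl : k ≤ l) :
    (1 - ∑' i, β (i + k)) * p n l ≤ p (n + r) (l + r) := by
  refine le_trans ?_ (h.one_sub_sum_mul_le hβ n l r)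
  exact mul_le_mul_of_nonneg_right (by linarith [sum_tail_le hβ hs k l r hkl]) (h.nonneg _ _)

/-- After a reset at j, the factors η carry the age up to k; from there on all further resets
together cost at most the tail of β, hence at most one half. If r < k, the superfluous factors are
at most 1. -/
lemma renewal_mul_le (h : IsAgeLaw p η β) (hβ : ∀ n, 0 ≤ β n) (hs : Summable β)
    (hη : ∀ n, 0 ≤ η n) (hη1 : ∀ n, η n ≤ 1) (k j r : ℕ) (hk : ∑' i, β (i + k) ≤ 1 / 2) :
    (1 / 2 * ∏ i ∈ Finset.range k, η (j + i)) * p j 0 ≤ p (j + r) r := by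
  have hprod : 0 ≤ ∏ i ∈ Finset.range k, η (j + i) := Finset.prod_nonneg fun i _ => hη _
  rcases le_total k r with hr | hr
  · obtain ⟨s, rfl⟩ := Nat.exists_eq_add_of_le hr
    have h1 := h.prod_mul_le hη j 0 k
    have h2 := h.one_sub_tail_mul_le hβ hs k (j + k) (0 + k) s (by omega)
    have h3 := h.nonneg (j + k) (0 + k)
    have h4 : p (j + (k + s)) (k + s) = p (j + k + s) (0 + k + s) := by
      congr 1 <;> omega
    rw [h4]; nlinarith
  · have h1 := h.prod_mul_le hη j 0 r
    rw [zero_add] at h1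
    refine le_trans (mul_le_mul_of_nonneg_right ?_ (h.nonneg _ _)) h1
    obtain ⟨s, rfl⟩ := Nat.exists_eq_add_of_le hr
    rw [Finset.prod_range_add]
    have h5 : 0 ≤ ∏ i ∈ Finset.range r, η (j + i) := Finset.prod_nonneg fun i _ => hη _
    have h6 : ∏ i ∈ Finset.range s, η (j + (r + i)) ≤ 1 :=
      Finset.prod_le_one (fun i _ => hη _) fun i _ => hη1 _
    have h7 : 0 ≤ ∏ i ∈ Finset.range s, η (j + (r + i)) := Finset.prod_nonneg fun i _ => hη _
    nlinarith [mul_le_mul_of_nonneg_left h6 h5]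

/-- Age n - j at time n means that the last reset was at j (the start counts as a reset). These
events are disjoint, and `renewal_mul_le` bounds each from below. -/
lemma sum_renewal_le_one (h : IsAgeLaw p η β) (hβ : ∀ n, 0 ≤ β n) (hs : Summable β)
    (hη : ∀ n, 0 ≤ η n) (hη1 : ∀ n, η n ≤ 1) (k n : ℕ) (hk : ∑' i, β (i + k) ≤ 1 / 2) :
    ∑ j ∈ Finset.range (n + 1), (1 / 2 * ∏ i ∈ Finset.range k, η (j + i)) * p j 0 ≤ 1 := by
  refine le_trans ?_ (h.sum_eq n).le
  rw [← Finset.sum_range_reflect (p n)]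
  refine Finset.sum_le_sum fun j hj => ?_
  have hj' : j ≤ n := by simpa [Nat.lt_succ_iff] using hj
  have := h.renewal_mul_le hβ hs hη hη1 k j (n - j) hk
  rw [Nat.add_sub_cancel' hj'] at this
  simpa using this

/-- Ages of at least k stay so, except for a proportion at most the tail of β; hence the mass of the
young ages is almost nonincreasing in time. -/
lemma sum_small_le (h : IsAgeLaw p η β) (hβ : ∀ n, 0 ≤ β n) (hs : Summable β)
    (k j r : ℕ) (hkj : k ≤ j) :
    ∑ l ∈ Finset.range k, p (j + r) l
      ≤ ∑ l ∈ Finset.range k, p j l + ∑' i, β (i + k) := by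
  obtain ⟨s, rfl⟩ := Nat.exists_eq_add_of_le hkj
  have hτ : 0 ≤ ∑' i, β (i + k) := tsum_nonneg fun i => hβ _
  have h1 := h.sum_eq (k + s + r)
  have h2 := h.sum_eq (k + s)
  rw [show k + s + r + 1 = k + (r + (s + 1)) by ring, Finset.sum_range_add,
    Finset.sum_range_add _ r] at h1
  rw [show k + s + 1 = k + (s + 1) by ring, Finset.sum_range_add] at h2
  have h3 : 0 ≤ ∑ x ∈ Finset.range r, p (k + s + r) (k + x) :=
    Finset.sum_nonneg fun _ _ => h.nonneg _ _
  have h4 : (1 - ∑' i, β (i + k)) * ∑ x ∈ Finset.range (s + 1), p (k + s) (k + x)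
      ≤ ∑ x ∈ Finset.range (s + 1), p (k + s + r) (k + (r + x)) := by
    rw [Finset.mul_sum]
    refine Finset.sum_le_sum fun x _ => ?_
    have := h.one_sub_tail_mul_le hβ hs k (k + s) (k + x) r (by omega)
    rwa [show k + (r + x) = k + x + r by ring]
  have h5 : 0 ≤ ∑ l ∈ Finset.range k, p (k + s) l := Finset.sum_nonneg fun _ _ => h.nonneg _ _
  have h6 : 0 ≤ ∑ x ∈ Finset.range (s + 1), p (k + s) (k + x) :=
    Finset.sum_nonneg fun _ _ => h.nonneg _ _
  nlinarith

/-- An age l < k at time j + k comes from a reset at time j + k - l, which lies in the window j + 1,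
…, j + k. -/
lemma sum_small_le_renewal (h : IsAgeLaw p η β) (k j : ℕ) :
    ∑ l ∈ Finset.range k, p (j + k) l ≤ ∑ l ∈ Finset.range k, p (j + (l + 1)) 0 := by
  rw [← Finset.sum_range_reflect (fun l => p (j + (l + 1)) 0)]
  refine Finset.sum_le_sum fun l hl => ?_
  have hl' : l < k := by simpa using hl
  have := h.iterate_le (j + (k - 1 - l + 1)) 0 l
  rwa [zero_add, show j + (k - 1 - l + 1) + l = j + k by omega] at this

/-- Up to the tail of β, the young mass at time k + M is a lower bound for the young mass at every
time j + k with j < M, and the latter is at most the reset mass in j + 1, …, j + k. Weighting by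
products of η and summing over j, each of the k lags contributes at most 2 by `sum_renewal_le_one`.
-/
theorem young_age_bound (h : IsAgeLaw p η β) (hβ : ∀ n, 0 ≤ β n) (hs : Summable β)
    (hη : ∀ n, 0 ≤ η n) (hη1 : ∀ n, η n ≤ 1) (k M : ℕ) (hk : ∑' i, β (i + k) ≤ 1 / 2) :
    (∑ l ∈ Finset.range k, p (k + M) l - ∑' i, β (i + k)) *
      ∑ j ∈ Finset.range M, ∏ i ∈ Finset.range (2 * k), η (j + i) ≤ 2 * k := by
  set τ := ∑' i, β (i + k)
  set D := fun n => ∑ l ∈ Finset.range k, p n l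
  -- The window of length 2k from j contains the window of length k from j + l + 1 for every l < k,
  -- so one weight serves all lags.
  set H := fun j => ∏ i ∈ Finset.range (2 * k), η (j + i)
  have hH : ∀ j, 0 ≤ H j := fun j => Finset.prod_nonneg fun i _ => hη _
  have hHle : ∀ j l, l < k → H j ≤ ∏ i ∈ Finset.range k, η (j + (l + 1) + i) := by
    intro j l hl
    obtain ⟨s, hs⟩ := Nat.exists_eq_add_of_le (show l + 1 + k ≤ 2 * k by omega)
    change ∏ i ∈ Finset.range (2 * k), η (j + i) ≤ _
    rw [hs, Finset.prod_range_add, Finset.prod_range_add]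
    have a1 : 0 ≤ ∏ i ∈ Finset.range (l + 1), η (j + i) := Finset.prod_nonneg fun i _ => hη _
    have a2 : ∏ i ∈ Finset.range (l + 1), η (j + i) ≤ 1 :=
      Finset.prod_le_one (fun i _ => hη _) fun i _ => hη1 _
    have b1 : 0 ≤ ∏ i ∈ Finset.range s, η (j + (l + 1 + k + i)) :=
      Finset.prod_nonneg fun i _ => hη _
    have b2 : ∏ i ∈ Finset.range s, η (j + (l + 1 + k + i)) ≤ 1 :=
      Finset.prod_le_one (fun i _ => hη _) fun i _ => hη1 _
    have c1 : 0 ≤ ∏ i ∈ Finset.range k, η (j + (l + 1 + i)) := Finset.prod_nonneg fun i _ => hη _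
    simp only [← add_assoc] at *
    exact (mul_le_of_le_one_right (mul_nonneg a1 c1) b2).trans (mul_le_of_le_one_left c1 a2)
  calc (D (k + M) - τ) * ∑ j ∈ Finset.range M, H j
      = ∑ j ∈ Finset.range M, (D (k + M) - τ) * H j := Finset.mul_sum ..
    _ ≤ ∑ j ∈ Finset.range M, ∑ l ∈ Finset.range k,
          2 * ((1 / 2 * ∏ i ∈ Finset.range k, η (j + (l + 1) + i)) * p (j + (l + 1)) 0) := by
        refine Finset.sum_le_sum fun j hj => ?_
        have hj' : j < M := by simpa using hj
        have e1 := h.sum_small_le hβ hs k (j + k) (M - j) (by omega)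
        rw [show j + k + (M - j) = k + M by omega] at e1
        have e2 := h.sum_small_le_renewal k j
        have e3 : D (k + M) - τ ≤ ∑ l ∈ Finset.range k, p (j + (l + 1)) 0 := by
          change ∑ l ∈ Finset.range k, p (k + M) l - τ ≤ _
          linarith
        calc _ ≤ (∑ l ∈ Finset.range k, p (j + (l + 1)) 0) * H j :=
              mul_le_mul_of_nonneg_right e3 (hH j)
          _ ≤ _ := by
              rw [Finset.sum_mul]
              refine Finset.sum_le_sum fun l hl => ?_
              have := mul_le_mul_of_nonneg_left (hHle j l (by simpa using hl))
                (h.nonneg (j + (l + 1)) 0)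
              linarith
    _ = ∑ l ∈ Finset.range k, 2 * ∑ j ∈ Finset.range M,
          (1 / 2 * ∏ i ∈ Finset.range k, η (j + (l + 1) + i)) * p (j + (l + 1)) 0 := by
        rw [Finset.sum_comm]
        simp only [Finset.mul_sum]
    _ ≤ ∑ l ∈ Finset.range k, 2 * 1 := by
        refine Finset.sum_le_sum fun l _ => mul_le_mul_of_nonneg_left ?_ (by norm_num)
        -- The reset dates l + 1, …, l + M are among 0, …, l + M; the other terms are nonnegative.
        refine le_trans ?_ (h.sum_renewal_le_one hβ hs hη hη1 k (l + M) hk)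
        rw [show l + M + 1 = (l + 1) + M by ring, Finset.sum_range_add]
        refine le_add_of_nonneg_of_le (Finset.sum_nonneg fun j _ => mul_nonneg
          (mul_nonneg (by norm_num) (Finset.prod_nonneg fun i _ => hη _)) (h.nonneg _ _)) ?_
        refine le_of_eq (Finset.sum_congr rfl fun j _ => ?_)
        rw [add_comm j (l + 1)]
    _ = 2 * k := by simp; ring

end IsAgeLaw

end Renewal

end DiscreteChoice

namespace DiscreteChoice

/-! ### Shifts of two-sided paths -/

section Shift

variable {α : Type*}

/-- The shift of a two-sided path by `s`. -/
def shiftBy (s : ℤ) (x : ℤ → α) : ℤ → α := fun t => x (t + s)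

@[simp] lemma shiftBy_apply (s : ℤ) (x : ℤ → α) (t : ℤ) : shiftBy s x t = x (t + s) := rfl

lemma shiftBy_shiftBy (r s : ℤ) (x : ℤ → α) : shiftBy r (shiftBy s x) = shiftBy (r + s) x := by
  ext t; simp [add_assoc]

@[simp] lemma shiftBy_zero (x : ℤ → α) : shiftBy 0 x = x := by ext t; simp

lemma shift_iterate (n : ℕ) : (shift : (ℤ → α) → ℤ → α)^[n] = shiftBy (n : ℤ) := by
  induction n with
  | zero => ext x t; simp
  | succ n ih =>
    rw [Function.iterate_succ', ih]
    ext x t; simp [shift, add_assoc, add_comm (1 : ℤ)]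

@[fun_prop]
lemma measurable_shiftBy [MeasurableSpace α] (s : ℤ) :
    Measurable (shiftBy s : (ℤ → α) → ℤ → α) :=
  measurable_pi_lambda _ fun t => measurable_pi_apply (t + s)

lemma measurePreserving_shiftBy [MeasurableSpace α] {μ : Measure (ℤ → α)}
    (h : MeasurePreserving shift μ μ) (s : ℤ) : MeasurePreserving (shiftBy s) μ μ := by
  have hn : ∀ n : ℕ, MeasurePreserving (shiftBy (n : ℤ)) μ μ := fun n => by
    rw [← shift_iterate]; exact h.iterate n
  obtain ⟨n, rfl | rfl⟩ := s.eq_nat_or_neg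
  · exact hn n
  · refine ⟨measurable_shiftBy _, ?_⟩
    conv_lhs => rw [← (hn n).map_eq]
    rw [Measure.map_map (measurable_shiftBy _) (measurable_shiftBy _)]
    have : shiftBy (-(n : ℤ)) ∘ shiftBy (n : ℤ) = (id : (ℤ → α) → ℤ → α) := by
      ext x t; simp
    rw [this, Measure.map_id]

end Shift

/-! ### I.i.d. noise, and ergodicity of its product with an ergodic process -/

section Noise

variable {E : Type*}

/-- The path which is `e` on `S` and `e'` off `S`. -/
def splice (S : Set ℤ) [DecidablePred (· ∈ S)] (e e' : ℤ → E) : ℤ → E :=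
  fun t => if t ∈ S then e t else e' t

variable [MeasurableSpace E]

@[fun_prop]
lemma measurable_splice (S : Set ℤ) [DecidablePred (· ∈ S)] :
    Measurable fun p : (ℤ → E) × (ℤ → E) => splice S p.1 p.2 := by
  refine measurable_pi_lambda _ fun t => ?_
  unfold splice
  split_ifs <;> fun_prop

/-- The law of an i.i.d. sequence indexed by `ℤ`. -/
noncomputable abbrev iidLaw (ν : Measure E) : Measure (ℤ → E) := Measure.infinitePi fun _ => ν

variable (ν : Measure E) [IsProbabilityMeasure ν]

/-- The measure of a box factors into its coordinates on `S` and off `S`. In this form two blocks of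
the noise can be treated as independent copies, without conditioning. -/
lemma measurePreserving_splice (S : Set ℤ) [DecidablePred (· ∈ S)] :
    MeasurePreserving (fun p : (ℤ → E) × (ℤ → E) => splice S p.1 p.2)
      ((iidLaw ν).prod (iidLaw ν)) (iidLaw ν) := by
  refine ⟨measurable_splice S, Measure.eq_infinitePi _ fun s t ht => ?_⟩
  rw [Measure.map_apply (measurable_splice S) (MeasurableSet.pi s.countable_toSet fun i _ => ht i)]
  have : (fun p : (ℤ → E) × (ℤ → E) => splice S p.1 p.2) ⁻¹' (Set.pi s t)
      = (Set.pi (s.filter (· ∈ S) : Finset ℤ) t) ×ˢ (Set.pi (s.filter (· ∉ S) : Finset ℤ) t) := by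
    ext ⟨e, e'⟩
    simp only [Set.mem_preimage, Set.mem_pi, Set.mem_prod, Finset.coe_filter, Set.mem_ofPred_eq,
      splice, SetLike.mem_coe]
    refine ⟨fun h => ⟨fun i hi => by simpa [hi.2] using h i hi.1,
      fun i hi => by simpa [hi.2] using h i hi.1⟩, fun h i hi => ?_⟩
    split_ifs with hS
    · exact h.1 i ⟨hi, hS⟩
    · exact h.2 i ⟨hi, hS⟩
  rw [this, Measure.prod_prod, Measure.infinitePi_pi _ (fun i _ => ht i),
    Measure.infinitePi_pi _ (fun i _ => ht i), Finset.prod_filter_mul_prod_filter_not]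

lemma measurePreserving_update (t : ℤ) :
    MeasurePreserving (fun p : (ℤ → E) × E => Function.update p.1 t p.2)
      ((iidLaw ν).prod ν) (iidLaw ν) := by
  have hm : Measurable fun p : (ℤ → E) × E => Function.update p.1 t p.2 := by
    refine measurable_pi_lambda _ fun s => ?_
    by_cases h : s = t
    · subst h; simpa using measurable_snd
    · simp only [Function.update_of_ne h]; fun_prop
  refine ⟨hm, ?_⟩
  have h1 : MeasurePreserving (fun p : (ℤ → E) × (ℤ → E) => (p.1, p.2 t))
      ((iidLaw ν).prod (iidLaw ν)) ((iidLaw ν).prod ν) :=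
    (MeasurePreserving.id _).prod (measurePreserving_eval_infinitePi (fun _ => ν) t)
  rw [← h1.map_eq, Measure.map_map hm h1.measurable]
  refine Eq.trans ?_ (measurePreserving_splice ν ({t}ᶜ : Set ℤ)).map_eq
  congr 1
  ext p s
  by_cases h : s = t
  · subst h; simp [splice]
  · simp [splice, h]

lemma measurePreserving_shiftBy_iidLaw (r : ℤ) :
    MeasurePreserving (shiftBy r) (iidLaw ν) (iidLaw ν) := by
  refine ⟨measurable_shiftBy r, Measure.eq_infinitePi _ fun s t ht => ?_⟩
  rw [Measure.map_apply (measurable_shiftBy r)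
    (MeasurableSet.pi s.countable_toSet fun i _ => ht i)]
  have : shiftBy r ⁻¹' (Set.pi s t)
      = Set.pi (s.map (addRightEmbedding r) : Finset ℤ) (fun i => t (i - r)) := by
    ext e
    simp only [Set.mem_preimage, Set.mem_pi, SetLike.mem_coe, shiftBy_apply, Finset.mem_map,
      addRightEmbedding_apply, forall_exists_index, and_imp, forall_apply_eq_imp_iff₂,
      add_sub_cancel_right]
  rw [this, Measure.infinitePi_pi _ (fun i _ => ht _), Finset.prod_map]
  simp

variable {α : Type*} [MeasurableSpace α]

/-- The shift on pairs of paths. -/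
def shiftPair (s : ℤ) (ω : (ℤ → α) × (ℤ → E)) : (ℤ → α) × (ℤ → E) :=
  (shiftBy s ω.1, shiftBy s ω.2)

@[fun_prop]
lemma measurable_shiftPair (s : ℤ) :
    Measurable (shiftPair s : (ℤ → α) × (ℤ → E) → (ℤ → α) × (ℤ → E)) := by
  unfold shiftPair; fun_prop

omit [MeasurableSpace E] [MeasurableSpace α] in
lemma shiftPair_shiftPair (r s : ℤ) (ω : (ℤ → α) × (ℤ → E)) :
    shiftPair r (shiftPair s ω) = shiftPair (r + s) ω := by
  simp [shiftPair, shiftBy_shiftBy]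

variable {lam : Measure (ℤ → α)} [IsProbabilityMeasure lam]

lemma measurePreserving_shiftPair (h : MeasurePreserving shift lam lam) (s : ℤ) :
    MeasurePreserving (shiftPair s) (lam.prod (iidLaw ν)) (lam.prod (iidLaw ν)) :=
  (measurePreserving_shiftBy h s).prod (measurePreserving_shiftBy_iidLaw ν s)

/-- The sets of pairs `(x, e)` of paths which depend on finitely many coordinates of `e`. -/
def localSets (α E : Type*) [MeasurableSpace α] [MeasurableSpace E] :
    Set (Set ((ℤ → α) × (ℤ → E))) :=
  {A | MeasurableSet A ∧ ∃ n : ℕ, ∀ x e e', (∀ t : ℤ, |t| ≤ n → e t = e' t) →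
    ((x, e) ∈ A ↔ (x, e') ∈ A)}

omit [IsProbabilityMeasure lam] in
lemma isSetAlgebra_localSets : IsSetAlgebra (localSets α E) where
  empty_mem := ⟨.empty, 0, by simp⟩
  compl_mem := fun A ⟨hA, n, hn⟩ => ⟨hA.compl, n, fun x e e' h => not_congr (hn x e e' h)⟩
  union_mem := fun A A' ⟨hA, n, hn⟩ ⟨hA', n', hn'⟩ =>
    ⟨hA.union hA', max n n', fun x e e' h => or_congr
      (hn x e e' fun t ht => h t (ht.trans (by exact_mod_cast le_max_left n n')))
      (hn' x e e' fun t ht => h t (ht.trans (by exact_mod_cast le_max_right n n')))⟩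

lemma generateFrom_localSets :
    (inferInstance : MeasurableSpace ((ℤ → α) × (ℤ → E)))
      = MeasurableSpace.generateFrom (localSets α E) := by
  refine le_antisymm (sup_le ?_ ?_) (MeasurableSpace.generateFrom_le fun A hA => hA.1)
  · rintro _ ⟨B, hB, rfl⟩
    exact MeasurableSpace.measurableSet_generateFrom
      ⟨measurable_fst hB, 0, fun x e e' _ => Iff.rfl⟩
  · rw [MeasurableSpace.comap_le_iff_le_map]
    refine iSup_le fun t => ?_
    rintro _ ⟨B, hB, rfl⟩
    refine MeasurableSpace.measurableSet_generateFrom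
      ⟨measurable_snd (measurable_pi_apply t hB), t.natAbs, fun x e e' h => ?_⟩
    simp [h t (by simp)]

/-- For m > 2n the noise windows [-n, n] and [m - n, m + n] are disjoint, so for a frozen `x` the
two events are independent; splicing two copies of the noise at the first window exhibits the
product. -/
lemma measure_local_inter_shift {A : Set ((ℤ → α) × (ℤ → E))} (hA : MeasurableSet A) {n : ℕ}
    (hn : ∀ x e e', (∀ t : ℤ, |t| ≤ n → e t = e' t) → ((x, e) ∈ A ↔ (x, e') ∈ A))
    (m : ℤ) (hm : 2 * n < m) (x : ℤ → α) :
    (iidLaw ν) {e | (x, e) ∈ A ∧ shiftPair m (x, e) ∈ A}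
      = (iidLaw ν) {e | (x, e) ∈ A} * (iidLaw ν) {e | (shiftBy m x, e) ∈ A} := by
  classical
  have h1 : MeasurableSet {e : ℤ → E | (x, e) ∈ A} := measurable_prodMk_left hA
  have h2 : MeasurableSet {e : ℤ → E | shiftPair m (x, e) ∈ A} :=
    measurable_prodMk_left (measurable_shiftPair m hA)
  have h3 : (iidLaw ν) {e | (shiftBy m x, e) ∈ A} = (iidLaw ν) {e | shiftPair m (x, e) ∈ A} := by
    rw [← (measurePreserving_shiftBy_iidLaw ν m).measure_preimage
      (s := {e | (shiftBy m x, e) ∈ A}) (measurable_prodMk_left hA).nullMeasurableSet]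
    rfl
  have h4 : MeasurableSet {e : ℤ → E | (x, e) ∈ A ∧ shiftPair m (x, e) ∈ A} := h1.inter h2
  rw [h3, ← Measure.prod_prod, ← (measurePreserving_splice ν (Set.Icc (-(n : ℤ)) n)).measure_preimage
    h4.nullMeasurableSet]
  congr 1
  ext ⟨e, e'⟩
  refine and_congr (hn _ _ _ fun t ht => ?_) (hn _ _ _ fun t ht => ?_)
  · rw [abs_le] at ht
    simp [splice, ht.1, ht.2]
  · rw [abs_le] at ht
    have : ¬ (t + m ≤ n) := by omega
    simp [splice, this]

lemma integral_section_real {β : Type*} [MeasurableSpace β] (ρ : Measure β)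
    [IsProbabilityMeasure ρ] {γ : Type*} [MeasurableSpace γ] (κ : Measure γ)
    [IsProbabilityMeasure κ] {A : Set (γ × β)} (hA : MeasurableSet A) :
    (κ.prod ρ).real A = ∫ x, ρ.real {e | (x, e) ∈ A} ∂κ := by
  simp only [measureReal_def]
  rw [Measure.prod_apply hA]
  exact (integral_toReal (measurable_measure_prodMk_left hA).aemeasurable
    (Filter.Eventually.of_forall fun x => measure_lt_top _ _)).symm

/-- The product of an ergodic process with an i.i.d. sequence is ergodic. -/
theorem ergodic_shiftPair (h : Ergodic shift lam) :
    Ergodic (shiftPair 1) (lam.prod (iidLaw ν)) := by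
  have hmp := measurePreserving_shiftPair ν h.toMeasurePreserving
  refine ⟨hmp 1, ⟨fun A hA hinv => ?_⟩⟩
  set Q := lam.prod (iidLaw ν) with hQ
  set a : (ℤ → α) → ℝ := fun x => (iidLaw ν).real {e | (x, e) ∈ A} with ha
  have sec_meas : ∀ B : Set ((ℤ → α) × (ℤ → E)), MeasurableSet B →
      Measurable fun x => (iidLaw ν).real {e | (x, e) ∈ B} := fun B hB =>
    (measurable_measure_prodMk_left hB).ennreal_toReal
  have hash : a ∘ shift = a := by
    funext x
    simp only [ha, Function.comp, measureReal_def]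
    congr 1
    rw [← (measurePreserving_shiftBy_iidLaw ν 1).measure_preimage
      (s := {e | (shift x, e) ∈ A}) (measurable_prodMk_left hA).nullMeasurableSet]
    congr 1
    ext e
    change shiftPair 1 (x, e) ∈ A ↔ (x, e) ∈ A
    conv_rhs => rw [← hinv]
    rfl
  -- The measure of the section of `A` at x is invariant under the shift of x, hence constant by
  -- ergodicity of the covariates.
  obtain ⟨c, hc⟩ := h.ae_eq_const_of_ae_eq_comp_ae (sec_meas A hA).aestronglyMeasurable
    (Filter.EventuallyEq.of_eq hash)
  have hQc : Q.real A = c := by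
    rw [hQ, integral_section_real _ _ hA, integral_congr_ae hc]; simp
  have hc0 : 0 ≤ c := hQc ▸ measureReal_nonneg
  have hc1 : c ≤ 1 := hQc ▸ measureReal_le_one
  -- Approximate `A` by an event `A'` that is local in the noise. Then the measure of A' ∩ T⁻ᵐA' is
  -- close to c, by invariance of `A`, and close to c², since given x the two events are independent
  -- and their section measures are close to c in L¹. So c = c².
  have key : ∀ δ : ℝ, 0 < δ → |c - c ^ 2| ≤ 4 * δ := by
    intro δ hδ
    obtain ⟨A', ⟨hA', n, hn⟩, hAA'⟩ := (Measure.MeasureDense.of_generateFrom_isSetAlgebra_finite Q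
      isSetAlgebra_localSets generateFrom_localSets).approx A hA (measure_ne_top _ _) δ hδ
    have hsd : Q.real (symmDiff A A') ≤ δ := by
      rw [measureReal_def]
      exact ENNReal.toReal_le_of_le_ofReal hδ.le hAA'.le
    set m : ℤ := 2 * n + 1 with hm
    set a' : (ℤ → α) → ℝ := fun x => (iidLaw ν).real {e | (x, e) ∈ A'} with ha'
    have ha'm : Measurable a' := sec_meas A' hA'
    have ha'0 : ∀ x, 0 ≤ a' x := fun x => measureReal_nonneg
    have ha'1 : ∀ x, a' x ≤ 1 := fun x => measureReal_le_one
    have hint : Integrable a' lam := by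
      refine Integrable.of_bound ha'm.aestronglyMeasurable 1 (.of_forall fun x => ?_)
      rw [Real.norm_of_nonneg (ha'0 x)]; exact ha'1 x
    have hmpm := measurePreserving_shiftBy h.toMeasurePreserving m
    have hL1 : ∫ x, |a' x - c| ∂lam ≤ δ := by
      refine le_trans ?_ hsd
      rw [hQ, integral_section_real _ _ (hA.symmDiff hA')]
      refine integral_mono_ae (hint.sub (integrable_const c)).abs
        (Integrable.of_bound (sec_meas _ (hA.symmDiff hA')).aestronglyMeasurable 1
          (.of_forall fun x => by
            rw [Real.norm_of_nonneg measureReal_nonneg]; exact measureReal_le_one)) ?_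
      filter_upwards [hc] with x hx
      have : a x = c := hx
      rw [← this, abs_sub_comm]
      have s1 : MeasurableSet {e | (x, e) ∈ A} := measurable_prodMk_left hA
      have s2 : MeasurableSet {e | (x, e) ∈ A'} := measurable_prodMk_left hA'
      exact abs_measureReal_sub_le_measureReal_symmDiff s1.nullMeasurableSet s2.nullMeasurableSet
    have hL1' : ∫ x, |a' (shiftBy m x) - c| ∂lam ≤ δ := by
      refine le_trans (le_of_eq ?_) hL1
      conv_rhs => rw [← hmpm.map_eq]
      exact (integral_map hmpm.measurable.aemeasurable
        (ha'm.sub_const c).norm.aestronglyMeasurable).symm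
    have hprod : Q.real (A' ∩ shiftPair m ⁻¹' A') = ∫ x, a' x * a' (shiftBy m x) ∂lam := by
      rw [hQ, integral_section_real _ _ (hA'.inter (measurable_shiftPair m hA'))]
      refine integral_congr_ae (.of_forall fun x => ?_)
      simp only [ha', measureReal_def, ← ENNReal.toReal_mul]
      rw [← measure_local_inter_shift ν hA' hn m (by omega) x]
      rfl
    have hint1 : Integrable (fun x => |a' x - c|) lam := (hint.sub (integrable_const c)).abs
    have hint2 : Integrable (fun x => |a' (shiftBy m x) - c|) lam :=
      hmpm.integrable_comp_of_integrable hint1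
    have hint3 : Integrable (fun x => a' x * a' (shiftBy m x)) lam := by
      refine Integrable.of_bound
        (ha'm.mul (ha'm.comp (measurable_shiftBy m))).aestronglyMeasurable 1 (.of_forall fun x => ?_)
      rw [Real.norm_of_nonneg (mul_nonneg (ha'0 _) (ha'0 _))]
      exact mul_le_one₀ (ha'1 _) (ha'0 _) (ha'1 _)
    have est1 : |Q.real (A' ∩ shiftPair m ⁻¹' A') - c ^ 2| ≤ 2 * δ := by
      have e : Q.real (A' ∩ shiftPair m ⁻¹' A') - c ^ 2
          = ∫ x, (a' x * a' (shiftBy m x) - c ^ 2) ∂lam := by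
        rw [integral_sub hint3 (integrable_const _), hprod]; simp
      rw [e]
      calc |∫ x, (a' x * a' (shiftBy m x) - c ^ 2) ∂lam|
          ≤ ∫ x, |a' x * a' (shiftBy m x) - c ^ 2| ∂lam := abs_integral_le_integral_abs
        _ ≤ ∫ x, (|a' x - c| + |a' (shiftBy m x) - c|) ∂lam := by
            refine integral_mono (hint3.sub (integrable_const _)).abs (hint1.add hint2) fun x => ?_
            have : a' x * a' (shiftBy m x) - c ^ 2
                = (a' x - c) * a' (shiftBy m x) + c * (a' (shiftBy m x) - c) := by ring
            simp only [this]
            refine (abs_add_le _ _).trans (add_le_add ?_ ?_)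
            · rw [abs_mul, abs_of_nonneg (ha'0 _)]
              exact mul_le_of_le_one_right (abs_nonneg _) (ha'1 _)
            · rw [abs_mul, abs_of_nonneg hc0]
              exact mul_le_of_le_one_left (abs_nonneg _) hc1
        _ ≤ 2 * δ := by rw [integral_add hint1 hint2]; linarith
    have hinvm : ∀ k : ℕ, shiftPair (k : ℤ) ⁻¹' A = A := by
      intro k
      induction k with
      | zero => ext ω; simp [shiftPair]
      | succ k ih =>
        conv_rhs => rw [← ih, ← hinv]
        ext ω
        simp only [Set.mem_preimage, shiftPair_shiftPair]
        rw [Nat.cast_succ, add_comm]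
    have est2 : |Q.real A - Q.real (A' ∩ shiftPair m ⁻¹' A')| ≤ 2 * δ := by
      have hAm : shiftPair m ⁻¹' A = A := by exact_mod_cast hinvm (2 * n + 1)
      have hmeas := hA.symmDiff hA'
      have hsub : symmDiff A (A' ∩ shiftPair m ⁻¹' A')
          ⊆ symmDiff A A' ∪ shiftPair m ⁻¹' (symmDiff A A') := by
        intro ω hω
        have h1 : shiftPair m ω ∈ A ↔ ω ∈ A := by
          conv_rhs => rw [← hAm]
          rfl
        simp only [Set.mem_symmDiff, Set.mem_inter_iff, Set.mem_preimage, Set.mem_union] at hω ⊢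
        tauto
      refine (abs_measureReal_sub_le_measureReal_symmDiff hA.nullMeasurableSet
        (hA'.inter (measurable_shiftPair m hA')).nullMeasurableSet).trans ?_
      refine (measureReal_mono hsub).trans ((measureReal_union_le _ _).trans ?_)
      rw [(hmp m).measureReal_preimage hmeas.nullMeasurableSet]
      linarith
    rw [hQc] at est2
    rw [abs_le] at *
    constructor <;> linarith [est1.1, est1.2, est2.1, est2.2]
  have hcc : c - c ^ 2 = 0 := by
    by_contra hne
    have hpos := abs_pos.2 hne
    linarith [key (|c - c ^ 2| / 8) (by positivity)]
  have hc' : c = 0 ∨ c = 1 := by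
    have : c * (1 - c) = 0 := by linarith [hcc, sq c]
    rcases mul_eq_zero.1 this with h0 | h0
    · exact Or.inl h0
    · exact Or.inr (by linarith)
  rw [Filter.eventuallyConst_set]
  rcases hc' with rfl | rfl
  · right
    have : Q A = 0 := by simpa [measureReal_def, ENNReal.toReal_eq_zero_iff] using hQc
    simpa using measure_eq_zero_iff_ae_notMem.1 this
  · left
    have : Q A = 1 := by
      have := hQc
      rw [measureReal_def] at this
      rw [← ENNReal.ofReal_toReal (measure_ne_top Q A), this]; simp
    exact (prob_compl_eq_zero_iff hA).2 this

end Noise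

end DiscreteChoice

namespace DiscreteChoice

/-! ### Independence of one noise coordinate, by resampling -/

section Resampling

variable {E : Type*} [MeasurableSpace E] (ν : Measure E) [IsProbabilityMeasure ν]

/-- Resampling the coordinate `t` preserves the law and does not affect `g`, while the new
coordinate is independent by construction. -/
lemma iidLaw_map_prodMk_eval {S : Type*} [MeasurableSpace S] (t : ℤ) {g : (ℤ → E) → S}
    (hg : Measurable g) (hgt : ∀ e e₀, g (Function.update e t e₀) = g e) :
    (iidLaw ν).map (fun e => (g e, e t)) = ((iidLaw ν).map g).prod ν := by
  have hu := measurePreserving_update ν t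
  have hm : Measurable fun e : ℤ → E => (g e, e t) := hg.prodMk (measurable_pi_apply t)
  conv_lhs => rw [← hu.map_eq]
  rw [Measure.map_map hm hu.measurable]
  have : (fun e : ℤ → E => (g e, e t)) ∘ (fun p : (ℤ → E) × E => Function.update p.1 t p.2)
      = Prod.map g id := by
    ext p <;> simp [hgt]
  rw [this, ← Measure.map_prod_map _ _ hg measurable_id, Measure.map_id]

lemma prod_iidLaw_map_prodMk_eval {Ω S : Type*} [MeasurableSpace Ω] [MeasurableSpace S]
    (P : Measure Ω) [IsProbabilityMeasure P] (t : ℤ) {g : Ω × (ℤ → E) → S}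
    (hg : Measurable g) (hgt : ∀ ω e e₀, g (ω, Function.update e t e₀) = g (ω, e)) :
    (P.prod (iidLaw ν)).map (fun p => (g p, p.2 t))
      = ((P.prod (iidLaw ν)).map g).prod ν := by
  have hu := (MeasurePreserving.id P).prod (measurePreserving_update ν t)
  have hm : Measurable fun p : Ω × (ℤ → E) => (g p, p.2 t) :=
    hg.prodMk ((measurable_pi_apply t).comp measurable_snd)
  conv_lhs => rw [← hu.map_eq]
  rw [Measure.map_map hm hu.measurable]
  have : (fun p : Ω × (ℤ → E) => (g p, p.2 t)) ∘
      (Prod.map id fun p : (ℤ → E) × E => Function.update p.1 t p.2)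
      = (Prod.map g id) ∘ MeasurableEquiv.prodAssoc.symm := by
    funext ⟨ω, e, e₀⟩
    exact Prod.ext (hgt ω e e₀) (by simp [MeasurableEquiv.prodAssoc])
  rw [this, ← Measure.map_map (hg.prodMap measurable_id) (MeasurableEquiv.measurable _)]
  have h2 : (P.prod ((iidLaw ν).prod ν)).map MeasurableEquiv.prodAssoc.symm
      = (P.prod (iidLaw ν)).prod ν := by
    rw [← Measure.prodAssoc_prod, MeasurableEquiv.map_symm_map]
  rw [h2, ← Measure.map_prod_map _ _ hg measurable_id, Measure.map_id]

end Resampling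

/-! ### The chain run forward from a prescribed past -/

section Chain

variable {α E C : Type*} [Inhabited C]

/-- The path `y` before time `a`, continued by the default value. -/
def mask (a : ℤ) (y : ℤ → C) : ℤ → C := fun t => if t < a then y t else default

/-- The chain started at time `a` with the past `y`, after `n` steps of the recursion
`y_t = Φ((x_{t + ·}), (y_{t + ·}), e_t)`. -/
def run (Φ : (ℤ → α) → (ℤ → C) → E → C) (x : ℤ → α) (e : ℤ → E) (y : ℤ → C) (a : ℤ) :
    ℕ → ℤ → C
  | 0 => mask a y
  | n + 1 => Function.update (run Φ x e y a n) (a + n)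
      (Φ (shiftBy (a + n) x) (shiftBy (a + n) (run Φ x e y a n)) (e (a + n)))

variable {Φ : (ℤ → α) → (ℤ → C) → E → C} {x : ℤ → α} {e : ℤ → E} {y : ℤ → C} {a : ℤ}

lemma run_zero : run Φ x e y a 0 = mask a y := rfl

lemma run_succ (n : ℕ) : run Φ x e y a (n + 1) = Function.update (run Φ x e y a n) (a + n)
      (Φ (shiftBy (a + n) x) (shiftBy (a + n) (run Φ x e y a n)) (e (a + n))) := rfl

lemma run_congr_noise {e' : ℤ → E} (n : ℕ) (h : ∀ t, a ≤ t → t < a + n → e t = e' t) :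
    run Φ x e y a n = run Φ x e' y a n := by
  induction n with
  | zero => rfl
  | succ n ih =>
    rw [run_succ, run_succ, ih fun t h1 h2 => h t h1 (by push_cast; omega),
      h (a + n) (by omega) (by push_cast; omega)]

lemma run_update_noise (n : ℕ) {t : ℤ} (ht : a + n ≤ t) (e₀ : E) :
    run Φ x (Function.update e t e₀) y a n = run Φ x e y a n :=
  run_congr_noise n fun s _ h2 => Function.update_of_ne (by omega) _ _

lemma run_of_ge (n : ℕ) {t : ℤ} (ht : a + n ≤ t) : run Φ x e y a n t = default := by
  induction n with
  | zero => simp only [run_zero, mask]; exact if_neg (by push_cast at ht; omega)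
  | succ n ih =>
    push_cast at ht
    rw [run_succ, Function.update_of_ne (by omega), ih (by omega)]

lemma run_stable (n k : ℕ) {t : ℤ} (ht : t < a + n) :
    run Φ x e y a (n + k) t = run Φ x e y a n t := by
  induction k with
  | zero => rfl
  | succ k ih =>
    rw [← add_assoc, run_succ, Function.update_of_ne (by push_cast; omega), ih]

lemma mask_run (n : ℕ) : mask (a + n) (run Φ x e y a n) = run Φ x e y a n := by
  ext t
  simp only [mask]
  split_ifs with h
  · rfl
  · exact (run_of_ge n (by omega)).symm

/-- The restart masks the path from time a + n on, which changes nothing because a run still has the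
default value at the times not yet reached. -/
lemma run_run (n k : ℕ) :
    run Φ x e (run Φ x e y a n) (a + n) k = run Φ x e y a (n + k) := by
  induction k with
  | zero => exact mask_run n
  | succ k ih =>
    rw [run_succ, ih, ← add_assoc n k, run_succ]
    push_cast
    simp only [add_assoc]

lemma shiftBy_mask (r : ℤ) : shiftBy r (mask a y) = mask (a - r) (shiftBy r y) := by
  ext t
  simp only [mask, shiftBy_apply]
  exact if_congr (by omega) rfl rfl

lemma shiftBy_run (r : ℤ) (n : ℕ) :
    shiftBy r (run Φ x e y a n) = run Φ (shiftBy r x) (shiftBy r e) (shiftBy r y) (a - r) n := by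
  induction n with
  | zero => exact shiftBy_mask r
  | succ n ih =>
    have h1 : a - r + n + r = a + n := by ring
    rw [run_succ, run_succ, ← ih, shiftBy_shiftBy, shiftBy_shiftBy, h1]
    simp only [shiftBy_apply, h1]
    ext t
    by_cases ht : t = a - r + n
    · subst ht; simp [h1]
    · rw [Function.update_of_ne ht, shiftBy_apply, Function.update_of_ne (by omega), shiftBy_apply]

end Chain

/-! ### Contractive response maps -/

section Contraction

variable {α E C : Type*} [MeasurableSpace α] [MeasurableSpace E] [MeasurableSpace C]

/-- A response map `Φ` whose value depends on the past responses in a summably continuous way,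
and which forgets the past with positive probability. -/
structure IsContractive (ν : Measure E) (Φ : (ℤ → α) → (ℤ → C) → E → C) (β : ℕ → ℝ)
    (η : (ℤ → α) → ℝ) : Prop where
  measurable : Measurable fun p : (ℤ → α) × (ℤ → C) × E => Φ p.1 p.2.1 p.2.2
  past : ∀ x y y' e, (∀ s < 0, y s = y' s) → Φ x y e = Φ x y' e
  mismatch_le : ∀ x y y' (l : ℕ), (∀ s : ℤ, -l ≤ s → s < 0 → y s = y' s) →
    ν.real {e | Φ x y e ≠ Φ x y' e} ≤ β l
  mismatch_le_one_sub : ∀ x y y', ν.real {e | Φ x y e ≠ Φ x y' e} ≤ 1 - η x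
  summable : Summable β
  measurable_η : Measurable η
  pos : ∀ x, 0 < η x

namespace IsContractive

variable {ν : Measure E} {Φ : (ℤ → α) → (ℤ → C) → E → C} {β : ℕ → ℝ} {η : (ℤ → α) → ℝ}

variable [Inhabited C]

lemma le_one (h : IsContractive ν Φ β η) (x : ℤ → α) : η x ≤ 1 := by
  have := h.mismatch_le_one_sub x (fun _ => default) (fun _ => default)
  have h2 : 0 ≤ ν.real {e | Φ x (fun _ => default) e ≠ Φ x (fun _ => default) e} :=
    measureReal_nonneg
  linarith

lemma nonneg [Nonempty α] (h : IsContractive ν Φ β η) (l : ℕ) : 0 ≤ β l := by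
  let x : ℤ → α := fun _ => Classical.arbitrary α
  exact measureReal_nonneg.trans (h.mismatch_le x (fun _ => default) (fun _ => default) l
    fun _ _ _ => rfl)

lemma run_apply (h : IsContractive ν Φ β η) {x : ℤ → α} {e : ℤ → E} {y : ℤ → C} {a : ℤ} (n : ℕ)
    {t : ℤ} (hat : a ≤ t) (htn : t < a + n) :
    run Φ x e y a n t = Φ (shiftBy t x) (shiftBy t (run Φ x e y a n)) (e t) := by
  obtain ⟨m, rfl⟩ := Int.le.dest hat
  obtain ⟨k, rfl⟩ := Nat.exists_eq_add_of_lt (show m < n by omega)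
  rw [add_assoc m k 1, add_comm k 1, ← add_assoc m 1 k,
    run_stable (m + 1) k (by push_cast; omega), run_succ, Function.update_self]
  refine h.past _ _ _ _ fun s hs => ?_
  rw [shiftBy_apply, shiftBy_apply, add_assoc m 1 k, run_stable m (1 + k) (by omega)]

omit [Inhabited C] in
lemma measurable_update {β : Type*} [MeasurableSpace β] {f : β → ℤ → C} (hf : Measurable f)
    (t : ℤ) {g : β → C} (hg : Measurable g) : Measurable fun b => Function.update (f b) t (g b) := by
  refine measurable_pi_lambda _ fun s => ?_
  by_cases hs : s = t
  · subst hs; simpa using hg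
  · simp only [Function.update_of_ne hs]; exact (measurable_pi_apply s).comp hf

lemma measurable_mask (a : ℤ) : Measurable (mask a : (ℤ → C) → ℤ → C) := by
  refine measurable_pi_lambda _ fun t => ?_
  simp only [mask]
  split_ifs
  · exact measurable_pi_apply t
  · exact measurable_const

lemma measurable_run (h : IsContractive ν Φ β η) (a : ℤ) (n : ℕ) :
    Measurable fun p : (ℤ → α) × (ℤ → E) × (ℤ → C) => run Φ p.1 p.2.1 p.2.2 a n := by
  induction n with
  | zero => exact (measurable_mask a).comp (measurable_snd.comp measurable_snd)
  | succ n ih =>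
    refine measurable_update ih _ ?_
    refine h.measurable.comp (Measurable.prodMk ((measurable_shiftBy _).comp measurable_fst)
      (Measurable.prodMk ((measurable_shiftBy _).comp ih) ?_))
    fun_prop

end IsContractive

end Contraction

/-! ### Coupling two chains through common noise -/

section Coupling

variable {α E C : Type*} [Inhabited C] [DecidableEq C]

/-- The number of steps since the last disagreement of the two chains with the pasts `y`, `y'` and
with the same covariates and noise. -/
def age (Φ : (ℤ → α) → (ℤ → C) → E → C) (x : ℤ → α) (y y' : ℤ → C) (a : ℤ) (e : ℤ → E) : ℕ → ℕ
  | 0 => 0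
  | n + 1 => if run Φ x e y a (n + 1) (a + n) = run Φ x e y' a (n + 1) (a + n)
      then age Φ x y y' a e n + 1 else 0

variable {Φ : (ℤ → α) → (ℤ → C) → E → C} {x : ℤ → α} {e : ℤ → E} {y y' : ℤ → C} {a : ℤ}

lemma age_le (n : ℕ) : age Φ x y y' a e n ≤ n := by
  induction n with
  | zero => exact le_rfl
  | succ n ih => rw [age]; split_ifs <;> omega

lemma run_eq_of_age (n : ℕ) {s : ℤ} (h1 : a + n - age Φ x y y' a e n ≤ s) (h2 : s < a + n) :
    run Φ x e y a n s = run Φ x e y' a n s := by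
  induction n with
  | zero => simp [age] at h1 h2; omega
  | succ n ih =>
    rw [age] at h1
    split_ifs at h1 with h
    · push_cast at h1 h2
      rcases eq_or_ne s (a + n) with rfl | hs
      · exact h
      · rw [run_stable n 1 (by omega), run_stable n 1 (by omega)]
        exact ih (by omega) (by omega)
    · push_cast at h1 h2; omega

lemma age_update_noise (n : ℕ) {t : ℤ} (ht : a + n ≤ t) (e₀ : E) :
    age Φ x y y' a (Function.update e t e₀) n = age Φ x y y' a e n := by
  induction n with
  | zero => rfl
  | succ n ih =>
    rw [age, age, run_update_noise _ ht, run_update_noise _ ht, ih (by push_cast at ht; omega)]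

lemma age_succ_eq_succ_iff (n l : ℕ) : age Φ x y y' a e (n + 1) = l + 1 ↔
    age Φ x y y' a e n = l ∧
      Φ (shiftBy (a + n) x) (shiftBy (a + n) (run Φ x e y a n)) (e (a + n))
        = Φ (shiftBy (a + n) x) (shiftBy (a + n) (run Φ x e y' a n)) (e (a + n)) := by
  rw [age, run_succ, run_succ, Function.update_self, Function.update_self]
  split_ifs with h
  · simp [h]
  · simp [h]

variable [MeasurableSpace α] [MeasurableSpace E] [MeasurableSpace C]
  {ν : Measure E} {β : ℕ → ℝ} {η : (ℤ → α) → ℝ}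

namespace IsContractive

variable [IsProbabilityMeasure ν] [Countable C] [DiscreteMeasurableSpace C]

omit [IsProbabilityMeasure ν] [DecidableEq C] [Countable C] [DiscreteMeasurableSpace C] in
lemma measurable_run_noise (h : IsContractive ν Φ β η) (x : ℤ → α) (y : ℤ → C) (a : ℤ) (n : ℕ) :
    Measurable fun e : ℤ → E => run Φ x e y a n :=
  (h.measurable_run a n).comp (measurable_const.prodMk (measurable_id.prodMk measurable_const))

omit [IsProbabilityMeasure ν] in
lemma measurable_age (h : IsContractive ν Φ β η) (x : ℤ → α) (y y' : ℤ → C) (a : ℤ) (n : ℕ) :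
    Measurable fun e : ℤ → E => age Φ x y y' a e n := by
  induction n with
  | zero => exact measurable_const
  | succ n ih =>
    simp only [age]
    refine Measurable.ite ?_ (ih.add_const 1) measurable_const
    exact measurableSet_eq_fun
      ((measurable_pi_apply _).comp (h.measurable_run_noise x y a (n + 1)))
      ((measurable_pi_apply _).comp (h.measurable_run_noise x y' a (n + 1)))

/-- The noise at time a + n is independent of the age and of both paths so far, so the chance of
agreement at the next step is the ν-measure of a section. On the event that the age is `l` the last
`l` responses agree, and `hb` applies. The free constant `b` covers both η and 1 - β l. -/
lemma le_age_step (h : IsContractive ν Φ β η) (x : ℤ → α) (y y' : ℤ → C) (a : ℤ) (n l : ℕ) {b : ℝ}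
    (hb : ∀ z z' : ℤ → C, (∀ s : ℤ, -l ≤ s → s < 0 → z s = z' s) →
      ν.real {e | Φ (shiftBy (a + n) x) z e ≠ Φ (shiftBy (a + n) x) z' e} ≤ 1 - b) :
    b * (iidLaw ν).real {e | age Φ x y y' a e n = l}
      ≤ (iidLaw ν).real {e | age Φ x y y' a e (n + 1) = l + 1} := by
  set g : (ℤ → E) → ℕ × (ℤ → C) × (ℤ → C) := fun e =>
    (age Φ x y y' a e n, run Φ x e y a n, run Φ x e y' a n) with hg
  have hgm : Measurable g := (h.measurable_age x y y' a n).prodMk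
    ((h.measurable_run_noise x y a n).prodMk (h.measurable_run_noise x y' a n))
  have hlaw := iidLaw_map_prodMk_eval ν (a + n) hgm fun e e₀ => by
    simp only [hg]
    rw [age_update_noise _ le_rfl, run_update_noise _ le_rfl, run_update_noise _ le_rfl]
  set G : Set ((ℕ × (ℤ → C) × (ℤ → C)) × E) := {p | p.1.1 = l ∧
      Φ (shiftBy (a + n) x) (shiftBy (a + n) p.1.2.1) p.2
        = Φ (shiftBy (a + n) x) (shiftBy (a + n) p.1.2.2) p.2} with hG
  have hGm : MeasurableSet G := by
    refine MeasurableSet.inter ((measurable_fst.comp measurable_fst) (measurableSet_singleton l))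
      (measurableSet_eq_fun ?_ ?_)
    · exact h.measurable.comp (measurable_const.prodMk (Measurable.prodMk
        ((measurable_shiftBy _).comp (by fun_prop)) measurable_snd))
    · exact h.measurable.comp (measurable_const.prodMk (Measurable.prodMk
        ((measurable_shiftBy _).comp (by fun_prop)) measurable_snd))
  have hset : {e | age Φ x y y' a e (n + 1) = l + 1}
      = (fun e : ℤ → E => (g e, e (a + n))) ⁻¹' G := by
    ext e
    exact age_succ_eq_succ_iff n l
  have hagem : MeasurableSet {e : ℤ → E | age Φ x y y' a e n = l} :=
    h.measurable_age x y y' a n (measurableSet_singleton l)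
  have hleft : (iidLaw ν).real {e | age Φ x y y' a e n = l}
      = ∫ e, (Set.indicator {e | age Φ x y y' a e n = l} (fun _ => (1 : ℝ))) e ∂(iidLaw ν) := by
    rw [integral_indicator_const _ hagem]
    simp
  have hm1 : Measurable fun e : ℤ → E => (g e, e (a + n)) := hgm.prodMk (measurable_pi_apply _)
  have : IsProbabilityMeasure ((iidLaw ν).map g) :=
    Measure.isProbabilityMeasure_map hgm.aemeasurable
  have hsecm : Measurable fun z => ν.real {e | (z, e) ∈ G} :=
    (measurable_measure_prodMk_left hGm).ennreal_toReal
  rw [hset, ← map_measureReal_apply hm1 hGm, hlaw, integral_section_real _ _ hGm,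
    integral_map hgm.aemeasurable hsecm.aestronglyMeasurable, hleft, ← integral_const_mul]
  refine integral_mono ?_ ?_ fun e => ?_
  · exact ((integrable_const (1 : ℝ)).indicator
      (h.measurable_age x y y' a n (measurableSet_singleton l))).const_mul b
  · refine Integrable.of_bound (hsecm.comp hgm).aestronglyMeasurable 1 (.of_forall fun e => ?_)
    rw [Real.norm_of_nonneg measureReal_nonneg]; exact measureReal_le_one
  · simp only [Set.indicator_apply, Set.mem_ofPred_eq]
    split_ifs with hl
    · have h1 := hb (shiftBy (a + n) (run Φ x e y a n)) (shiftBy (a + n) (run Φ x e y' a n))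
        fun s hs1 hs2 => run_eq_of_age n (by rw [hl]; omega) (by omega)
      have hms : MeasurableSet {e₀ | (g e, e₀) ∈ G} := measurable_prodMk_left hGm
      have h2 : {e₀ | Φ (shiftBy (a + n) x) (shiftBy (a + n) (run Φ x e y a n)) e₀
          ≠ Φ (shiftBy (a + n) x) (shiftBy (a + n) (run Φ x e y' a n)) e₀}
          = {e₀ | (g e, e₀) ∈ G}ᶜ := by
        ext e₀
        simp [hG, hg, hl]
      rw [h2, probReal_compl_eq_one_sub hms] at h1
      linarith
    · simp

lemma isAgeLaw (h : IsContractive ν Φ β η) (x : ℤ → α) (y y' : ℤ → C) (a : ℤ) :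
    IsAgeLaw (fun n l => (iidLaw ν).real {e | age Φ x y y' a e n = l})
      (fun n => η (shiftBy (a + n) x)) β where
  nonneg _ _ := measureReal_nonneg
  sum_eq n := by
    have hm : ∀ l, MeasurableSet {e : ℤ → E | age Φ x y y' a e n = l} := fun l =>
      h.measurable_age x y y' a n (measurableSet_singleton l)
    rw [← measureReal_biUnion_finset (fun i _ j _ hij => Set.disjoint_left.2 fun e he he' =>
      hij (he.symm.trans he')) (fun l _ => hm l)]
    have : (⋃ l ∈ Finset.range (n + 1), {e : ℤ → E | age Φ x y y' a e n = l}) = Set.univ := by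
      ext e
      simpa [Nat.lt_succ_iff] using age_le n
    rw [this]; simp
  step_le n l := measureReal_mono fun e he => ((age_succ_eq_succ_iff n l).1 he).1
  le_step n l := h.le_age_step x y y' a n l fun z z' _ => h.mismatch_le_one_sub _ z z'
  le_step' n l := h.le_age_step x y y' a n l fun z z' hz => by
    simpa using h.mismatch_le _ z z' l hz

/-- The bound for the probability that two chains disagree recently. -/
noncomputable def _root_.DiscreteChoice.couplingBound (β : ℕ → ℝ) (η : (ℤ → α) → ℝ) (k M : ℕ)
    (x : ℤ → α) : ℝ :=
  ∑' i, β (i + k) + 2 * k / ∑ j ∈ Finset.range M, ∏ i ∈ Finset.range (2 * k),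
    η (shiftBy ((j + i : ℕ) : ℤ) x)

/-- A disagreement among the last `k` steps forces an age below `k`, whose probability is bounded by
`young_age_bound` after division by the positive sum of weights. -/
lemma measure_disagree_le [Nonempty α] (h : IsContractive ν Φ β η) (x : ℤ → α) (y y' : ℤ → C)
    (a : ℤ) {k M : ℕ} (hk : ∑' i, β (i + k) ≤ 1 / 2) (hM : 0 < M) :
    (iidLaw ν).real {e | ∃ s : ℤ, a + M ≤ s ∧ s < a + M + k ∧
      run Φ x e y a (k + M) s ≠ run Φ x e y' a (k + M) s}
      ≤ couplingBound β η k M (shiftBy a x) := by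
  have hage := (h.isAgeLaw x y y' a).young_age_bound h.nonneg h.summable (fun n => (h.pos _).le)
    (fun n => h.le_one _) k M hk
  have hsum : 0 < ∑ j ∈ Finset.range M, ∏ i ∈ Finset.range (2 * k),
      η (shiftBy (a + ((j + i : ℕ) : ℤ)) x) :=
    Finset.sum_pos (fun j _ => Finset.prod_pos fun i _ => h.pos _) (by simpa using hM.ne')
  rw [← le_div_iff₀ hsum] at hage
  have h1 : (iidLaw ν).real {e | ∃ s : ℤ, a + M ≤ s ∧ s < a + M + k ∧
      run Φ x e y a (k + M) s ≠ run Φ x e y' a (k + M) s}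
      ≤ ∑ l ∈ Finset.range k, (iidLaw ν).real {e | age Φ x y y' a e (k + M) = l} := by
    refine le_trans (measureReal_mono ?_ (measure_ne_top _ _)) (measureReal_biUnion_finset_le _ _)
    rintro e ⟨s, hs1, hs2, hne⟩
    simp only [Set.mem_iUnion, Finset.mem_range, Set.mem_ofPred_eq, exists_prop, exists_eq_right']
    by_contra hlt
    exact hne (run_eq_of_age (k + M) (by push_cast; omega) (by push_cast; omega))
  refine h1.trans ?_
  simp only [couplingBound, shiftBy_shiftBy]
  simp only [add_comm _ a]
  linarith

end IsContractive

end Coupling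

end DiscreteChoice

namespace DiscreteChoice

open Filter Topology ENNReal

/-! ### Forgetting the past, on average over the covariates -/

section Recurrence

variable {α : Type*} [MeasurableSpace α] {lam : Measure (ℤ → α)} [IsProbabilityMeasure lam]

/-- The ergodic sums of a positive function diverge. -/
lemma ae_tendsto_sum_shift_atTop (hlam : MeasurePreserving shift lam lam) {f : (ℤ → α) → ℝ}
    (hf : Measurable f) (hpos : ∀ x, 0 < f x) :
    ∀ᵐ x ∂lam, Tendsto (fun M : ℕ => ∑ j ∈ Finset.range M, f (shiftBy (j : ℤ) x)) atTop atTop := by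
  -- Poincaré recurrence: a point where f exceeds 1 / (m + 1) comes back there infinitely often, so
  -- the terms of the ergodic sum do not tend to 0.
  have h1 : ∀ m : ℕ, ∀ᵐ x ∂lam, x ∈ {x | 1 / ((m : ℝ) + 1) < f x} →
      ∃ᶠ n in atTop, shift^[n] x ∈ {x | 1 / ((m : ℝ) + 1) < f x} := fun m =>
    hlam.conservative.ae_mem_imp_frequently_image_mem
      (measurableSet_lt measurable_const hf).nullMeasurableSet
  filter_upwards [ae_all_iff.2 h1] with x hx
  rw [← not_summable_iff_tendsto_nat_atTop_of_nonneg fun n => (hpos _).le]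
  intro hs
  obtain ⟨m, hm⟩ := exists_nat_one_div_lt (hpos x)
  have h2 := hx m hm
  have h3 := hs.tendsto_atTop_zero.eventually (gt_mem_nhds (show (0 : ℝ) < 1 / (m + 1) by positivity))
  obtain ⟨n, hn1, hn2⟩ := (h2.and_eventually h3).exists
  rw [shift_iterate] at hn1
  exact lt_asymm hn1 hn2

end Recurrence

section Annealed

variable {α E C : Type*} [Inhabited C] [MeasurableSpace α] [MeasurableSpace E] [MeasurableSpace C]

/-- Chains started from arbitrary pasts agree at the last `K` among `n` steps, up to a probability
at most `ε` (after averaging over the covariates). -/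
def Forgets (ν : Measure E) (Φ : (ℤ → α) → (ℤ → C) → E → C) (lam : Measure (ℤ → α))
    (n K : ℕ) (ε : ℝ≥0∞) : Prop :=
  ∃ r : (ℤ → α) → ℝ≥0∞, Measurable r ∧ ∫⁻ x, r x ∂lam ≤ ε ∧ ∀ x y y' a,
    (iidLaw ν) {e | ∃ s : ℤ, a + n - K ≤ s ∧ s < a + n ∧
      run Φ x e y a n s ≠ run Φ x e y' a n s} ≤ r (shiftBy a x)

variable {ν : Measure E} {Φ : (ℤ → α) → (ℤ → C) → E → C} {β : ℕ → ℝ} {η : (ℤ → α) → ℝ}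
  [IsProbabilityMeasure ν] [Countable C] [DiscreteMeasurableSpace C]
  {lam : Measure (ℤ → α)} [IsProbabilityMeasure lam]

/-- For almost every x the coupling bound tends to the tail of β, because its denominator diverges.
The speed depends on x, which is why the statement is averaged; dominated convergence applies after
truncation at 1. -/
lemma IsContractive.exists_forgets [Nonempty α] (h : IsContractive ν Φ β η)
    (hlam : MeasurePreserving shift lam lam) (K : ℕ) {ε : ℝ≥0∞} (hε : ε ≠ 0) :
    ∃ n₀, ∀ n ≥ n₀, Forgets ν Φ lam n K ε := by
  classical
  have hτ : Tendsto (fun k => ∑' i, β (i + k)) atTop (𝓝 0) := tendsto_sum_nat_add β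
  obtain ⟨δ, hδ, hδε⟩ : ∃ δ : ℝ, 0 < δ ∧ ENNReal.ofReal δ < ε := by
    obtain ⟨q, hq0, hq⟩ := ENNReal.lt_iff_exists_nnreal_btwn.1 (pos_iff_ne_zero.2 hε)
    exact ⟨q, by exact_mod_cast hq0, by simpa using hq⟩
  -- The tail at `k` must be at most 1/2 for the renewal estimate and at most δ for the limit.
  obtain ⟨k, hkK, hk1, hk2⟩ : ∃ k ≥ K, ∑' i, β (i + k) ≤ 1 / 2 ∧ ∑' i, β (i + k) ≤ δ :=
    ((eventually_ge_atTop K).and ((hτ.eventually (ge_mem_nhds (by norm_num))).and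
      (hτ.eventually (ge_mem_nhds hδ)))).exists
  set r : ℕ → (ℤ → α) → ℝ≥0∞ := fun M x => min 1 (ENNReal.ofReal (couplingBound β η k M x)) with hr
  have hη : ∀ s : ℤ, Measurable fun x => η (shiftBy s x) := fun s =>
    h.measurable_η.comp (measurable_shiftBy s)
  have hfm : Measurable fun x => ∏ i ∈ Finset.range (2 * k), η (shiftBy (i : ℤ) x) :=
    Finset.measurable_fun_prod _ fun i _ => hη _
  have hrm : ∀ M, Measurable (r M) := fun M => by
    refine measurable_const.min (ENNReal.measurable_ofReal.comp ?_)
    unfold couplingBound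
    refine measurable_const.add (measurable_const.div ?_)
    exact Finset.measurable_fun_sum _ fun j _ => Finset.measurable_fun_prod _ fun i _ => hη _
  have hlim : Tendsto (fun M => ∫⁻ x, r M x ∂lam) atTop
      (𝓝 (∫⁻ _, min 1 (ENNReal.ofReal (∑' i, β (i + k))) ∂lam)) := by
    refine tendsto_lintegral_of_dominated_convergence (fun _ => 1) hrm
      (fun M => .of_forall fun x => min_le_left _ _) (by simp) ?_
    filter_upwards [ae_tendsto_sum_shift_atTop hlam hfm fun x => Finset.prod_pos fun i _ => h.pos _]
      with x hx
    refine tendsto_const_nhds.min (ENNReal.tendsto_ofReal ?_)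
    have h1 := (tendsto_const_nhds (x := (2 * k : ℝ))).div_atTop hx
    have h2 := (tendsto_const_nhds (x := ∑' i, β (i + k))).add h1
    simp only [add_zero] at h2
    refine h2.congr fun M => ?_
    simp only [couplingBound, shiftBy_shiftBy, Nat.cast_add]
    simp only [add_comm]
  have hlt : ∫⁻ _, min 1 (ENNReal.ofReal (∑' i, β (i + k))) ∂lam < ε := by
    refine lt_of_le_of_lt ?_ hδε
    simpa using Or.inr (ENNReal.ofReal_le_ofReal hk2)
  obtain ⟨M₀, hM₀⟩ := eventually_atTop.1
    ((hlim.eventually (gt_mem_nhds hlt)).and (eventually_gt_atTop 0))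
  refine ⟨k + M₀, fun n hn => ?_⟩
  obtain ⟨M, rfl⟩ := Nat.exists_eq_add_of_le (show k ≤ n by omega)
  obtain ⟨h1, h2⟩ := hM₀ M (by omega)
  refine ⟨r M, hrm M, h1.le, fun x y y' a => ?_⟩
  have h3 := h.measure_disagree_le x y y' a hk1 h2
  refine le_min prob_le_one ?_
  refine le_trans (measure_mono ?_)
    (ENNReal.le_ofReal_iff_toReal_le (measure_ne_top _ _) (measureReal_nonneg.trans h3) |>.2 h3)
  rintro e ⟨s, hs1, hs2, hs3⟩
  push_cast at hs1 hs2
  exact ⟨s, by omega, by omega, hs3⟩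

omit [MeasurableSpace C] [Countable C] [DiscreteMeasurableSpace C] [IsProbabilityMeasure lam] in
-- The bound is uniform in the pasts, so these may be random as long as they are functions of a
-- component independent of the noise. Stationarity absorbs the shift by `a`.
lemma Forgets.measure_le {n K : ℕ} {ε : ℝ≥0∞} (h : Forgets ν Φ lam n K ε)
    (hlam : MeasurePreserving shift lam lam)
    {Ω : Type*} [MeasurableSpace Ω] {P : Measure Ω} [IsProbabilityMeasure P]
    {x : Ω → ℤ → α} (hx : MeasurePreserving x P lam) (y y' : Ω → ℤ → C) (a : ℤ)
    (hm : MeasurableSet {p : Ω × (ℤ → E) | ∃ s : ℤ, a + n - K ≤ s ∧ s < a + n ∧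
      run Φ (x p.1) p.2 (y p.1) a n s ≠ run Φ (x p.1) p.2 (y' p.1) a n s}) :
    (P.prod (iidLaw ν)) {p | ∃ s : ℤ, a + n - K ≤ s ∧ s < a + n ∧
      run Φ (x p.1) p.2 (y p.1) a n s ≠ run Φ (x p.1) p.2 (y' p.1) a n s} ≤ ε := by
  obtain ⟨r, hr, hint, hle⟩ := h
  rw [Measure.prod_apply hm]
  calc _ ≤ ∫⁻ ω, r (shiftBy a (x ω)) ∂P := lintegral_mono fun ω => hle (x ω) (y ω) (y' ω) a
    _ = ∫⁻ z, r z ∂lam :=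
        ((measurePreserving_shiftBy hlam a).comp hx).lintegral_comp hr
    _ ≤ ε := hint

omit [IsProbabilityMeasure ν] [IsProbabilityMeasure lam] in
lemma IsContractive.measurableSet_disagree (h : IsContractive ν Φ β η)
    {Ω : Type*} [MeasurableSpace Ω]
    {x : Ω → ℤ → α} (hx : Measurable x) {y y' : Ω → ℤ → C} (hy : Measurable y)
    (hy' : Measurable y') (a b c : ℤ) (n : ℕ) :
    MeasurableSet {p : Ω × (ℤ → E) | ∃ s : ℤ, b ≤ s ∧ s < c ∧
      run Φ (x p.1) p.2 (y p.1) a n s ≠ run Φ (x p.1) p.2 (y' p.1) a n s} := by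
  have hm : ∀ {z : Ω → ℤ → C}, Measurable z →
      Measurable fun p : Ω × (ℤ → E) => run Φ (x p.1) p.2 (z p.1) a n := fun {z} hz =>
    (h.measurable_run a n).comp ((hx.comp measurable_fst).prodMk
      (measurable_snd.prodMk (hz.comp measurable_fst)))
  have : {p : Ω × (ℤ → E) | ∃ s : ℤ, b ≤ s ∧ s < c ∧
      run Φ (x p.1) p.2 (y p.1) a n s ≠ run Φ (x p.1) p.2 (y' p.1) a n s}
      = ⋃ s : ℤ, ⋃ (_ : b ≤ s ∧ s < c), {p : Ω × (ℤ → E) |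
        run Φ (x p.1) p.2 (y p.1) a n s = run Φ (x p.1) p.2 (y' p.1) a n s}ᶜ := by
    ext p; simp [and_assoc]
  rw [this]
  exact MeasurableSet.iUnion fun s => MeasurableSet.iUnion fun _ =>
    (measurableSet_eq_fun ((measurable_pi_apply s).comp (hm hy))
      ((measurable_pi_apply s).comp (hm hy'))).compl

end Annealed

/-! ### Measurable limits of eventually constant sequences -/

section EventualValue

variable {C : Type*} [Inhabited C] [MeasurableSpace C] [Countable C] [DiscreteMeasurableSpace C]

/-- A fixed measurable functional of the sequence is wanted: the limit then inherits everywhere, and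
not only almost surely, the property of depending on the noise up to time 0 alone. -/
lemma exists_measurable_eventual_value :
    ∃ G : (ℕ → C) → C, Measurable G ∧ ∀ v c, (∀ᶠ k in atTop, v k = c) → G v = c := by
  classical
  refine ⟨fun v => if hv : ∃ c, ∀ᶠ k in atTop, v k = c then hv.choose else default, ?_, ?_⟩
  · have hev : ∀ c : C, MeasurableSet {v : ℕ → C | ∀ᶠ k in atTop, v k = c} := fun c => by
      have : {v : ℕ → C | ∀ᶠ k in atTop, v k = c}
          = ⋃ K : ℕ, ⋂ k : ℕ, ⋂ (_ : K ≤ k), (fun v : ℕ → C => v k) ⁻¹' {c} := by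
        ext v; simp [eventually_atTop]
      rw [this]
      exact MeasurableSet.iUnion fun K => MeasurableSet.iInter fun k => MeasurableSet.iInter fun _ =>
        measurable_pi_apply k (measurableSet_singleton c)
    refine measurable_to_countable' fun c => ?_
    have : (fun v : ℕ → C => if hv : ∃ c, ∀ᶠ k in atTop, v k = c then hv.choose else default) ⁻¹' {c}
        = {v | ∀ᶠ k in atTop, v k = c} ∪
          ((⋃ c', {v : ℕ → C | ∀ᶠ k in atTop, v k = c'})ᶜ ∩ {_v | default = c}) := by
      ext v
      simp only [Set.mem_preimage, Set.mem_singleton_iff, Set.mem_union, Set.mem_inter_iff,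
        Set.mem_compl_iff, Set.mem_iUnion, Set.mem_ofPred_eq]
      split_ifs with hv
      · have h1 := hv.choose_spec
        constructor
        · rintro rfl; exact Or.inl h1
        · rintro (h2 | h2)
          · obtain ⟨k, hk1, hk2⟩ := (h1.and h2).exists
            exact hk1.symm.trans hk2
          · exact absurd hv h2.1
      · constructor
        · intro h2; exact Or.inr ⟨hv, h2⟩
        · rintro (h2 | h2)
          · exact absurd ⟨c, h2⟩ hv
          · exact h2.2
    rw [this]
    exact (hev c).union ((MeasurableSet.iUnion hev).compl.inter (.const _))
  · intro v c hc
    have hv : ∃ c, ∀ᶠ k in atTop, v k = c := ⟨c, hc⟩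
    simp only [hv, dite_true]
    obtain ⟨k, hk1, hk2⟩ := (hv.choose_spec.and hc).exists
    exact hk1.symm.trans hk2

end EventualValue

end DiscreteChoice

namespace DiscreteChoice

open Filter Topology ENNReal

/-! ### Existence of a stationary response driven by the noise -/

section Stationary

variable {α E C : Type*} [Inhabited C]

/-- The value at time `0` of the chain started at time `-m` from the default past. -/
def value (Φ : (ℤ → α) → (ℤ → C) → E → C) (m : ℕ) (ω : (ℤ → α) × (ℤ → E)) : C :=
  run Φ ω.1 ω.2 (fun _ => default) (-m) (m + 1) 0

/-- The path obtained by evaluating a functional along the orbit of the shift. -/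
def orbit (F : (ℤ → α) × (ℤ → E) → C) (ω : (ℤ → α) × (ℤ → E)) : ℤ → C :=
  fun t => F (shiftPair t ω)

omit [Inhabited C] in
lemma orbit_shiftPair (F : (ℤ → α) × (ℤ → E) → C) (r : ℤ) (ω : (ℤ → α) × (ℤ → E)) :
    orbit F (shiftPair r ω) = shiftBy r (orbit F ω) := by
  ext t
  simp [orbit, shiftPair_shiftPair]

variable {Φ : (ℤ → α) → (ℤ → C) → E → C}

lemma run_default_eq_value {x : ℤ → α} {e : ℤ → E} {t : ℤ} {m n : ℕ} (hmn : m < n) :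
    run Φ x e (fun _ => default) (t - m) n t = value Φ m (shiftPair t (x, e)) := by
  obtain ⟨k, rfl⟩ := Nat.exists_eq_add_of_lt hmn
  have h1 := congrFun (shiftBy_run (Φ := Φ) (x := x) (e := e) (y := fun _ => default)
    (a := t - m) t (m + k + 1)) 0
  rw [shiftBy_apply, zero_add] at h1
  have h2 : t - m - t = -(m : ℤ) := by ring
  rw [h1, h2, show m + k + 1 = m + 1 + k by ring, run_stable _ _ (by push_cast; omega)]
  rfl

lemma value_congr_noise {x : ℤ → α} {e e' : ℤ → E} (h : ∀ t ≤ 0, e t = e' t) (m : ℕ) :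
    value Φ m (x, e) = value Φ m (x, e') := by
  simp only [value]
  rw [run_congr_noise (m + 1) fun t _ ht => h t (by push_cast at ht; omega)]

variable [MeasurableSpace α] [MeasurableSpace E] [MeasurableSpace C]

omit [Inhabited C] in
lemma measurable_orbit {F : (ℤ → α) × (ℤ → E) → C} (hF : Measurable F) : Measurable (orbit F) :=
  measurable_pi_lambda _ fun t => hF.comp (measurable_shiftPair t)

variable {ν : Measure E} {β : ℕ → ℝ} {η : (ℤ → α) → ℝ}

lemma IsContractive.measurable_value (h : IsContractive ν Φ β η) (m : ℕ) :
    Measurable (value Φ m : (ℤ → α) × (ℤ → E) → C) :=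
  (measurable_pi_apply 0).comp ((h.measurable_run (-m) (m + 1)).comp
    (measurable_fst.prodMk (measurable_snd.prodMk measurable_const)))

variable [IsProbabilityMeasure ν] [Countable C] [DiscreteMeasurableSpace C]
  {lam : Measure (ℤ → α)} [IsProbabilityMeasure lam]

/-- At time -m the chain started earlier is a random past depending only on the noise before -m.
Splicing two independent copies of the noise at -m makes this past independent of the noise that
drives both chains afterwards, so forgetting applies. -/
lemma IsContractive.measure_value_ne_le (h : IsContractive ν Φ β η)
    (hlam : MeasurePreserving shift lam lam) {m m' : ℕ} (hmm : m ≤ m') {ε : ℝ≥0∞}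
    (hf : Forgets ν Φ lam (m + 1) 1 ε) :
    (lam.prod (iidLaw ν)) {ω | value Φ m ω ≠ value Φ m' ω} ≤ ε := by
  obtain ⟨k, rfl⟩ := Nat.exists_eq_add_of_le hmm
  have hT : MeasurePreserving
      (fun p : ((ℤ → α) × (ℤ → E)) × (ℤ → E) => (p.1.1, splice (Set.Iio (-(m : ℤ))) p.1.2 p.2))
      ((lam.prod (iidLaw ν)).prod (iidLaw ν)) (lam.prod (iidLaw ν)) :=
    ((MeasurePreserving.id lam).prod (measurePreserving_splice ν (Set.Iio (-(m : ℤ))))).comp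
      (measurePreserving_prodAssoc lam (iidLaw ν) (iidLaw ν))
  have hms : MeasurableSet {ω : (ℤ → α) × (ℤ → E) | value Φ m ω ≠ value Φ (m + k) ω} :=
    (measurableSet_eq_fun (h.measurable_value m) (h.measurable_value (m + k))).compl
  rw [← hT.measure_preimage hms.nullMeasurableSet]
  have hy' : Measurable fun p : (ℤ → α) × (ℤ → E) =>
      run Φ p.1 p.2 (fun _ => default) (-((m + k : ℕ) : ℤ)) k :=
    (h.measurable_run _ k).comp (measurable_fst.prodMk (measurable_snd.prodMk measurable_const))
  have := hf.measure_le hlam (P := lam.prod (iidLaw ν)) (x := Prod.fst) measurePreserving_fst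
    (fun _ _ => default) (fun p => run Φ p.1 p.2 (fun _ => default) (-((m + k : ℕ) : ℤ)) k)
    (-(m : ℤ)) (h.measurableSet_disagree measurable_fst measurable_const hy' _ _ _ _)
  refine le_trans (measure_mono ?_) this
  rintro ⟨⟨x, e⟩, e'⟩ hne
  refine ⟨0, by push_cast; omega, by push_cast; omega, ?_⟩
  have hpast : ∀ y : ℤ → C, run Φ x (splice (Set.Iio (-(m : ℤ))) e e') y (-m) (m + 1)
      = run Φ x e' y (-m) (m + 1) := fun y =>
    run_congr_noise (m + 1) fun t ht _ => by simp [splice, not_lt.2 ht]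
  have hstart : -((m + k : ℕ) : ℤ) + k = -(m : ℤ) := by push_cast; ring
  have hfirst : run Φ x (splice (Set.Iio (-(m : ℤ))) e e') (fun _ => default)
      (-((m + k : ℕ) : ℤ)) k = run Φ x e (fun _ => default) (-((m + k : ℕ) : ℤ)) k :=
    run_congr_noise k fun t _ ht => by
      have : t < -(m : ℤ) := by omega
      simp [splice, this]
  simp only [Set.mem_preimage, Set.mem_ofPred_eq, value] at hne
  rw [hpast, show m + k + 1 = k + (m + 1) by ring, ← run_run k (m + 1), hfirst, hstart,
    hpast] at hne
  exact hne

omit [IsProbabilityMeasure lam] in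
-- The paths `z` and `z'` do not react to a change of the noise at `t`, hence are independent of it;
-- `mismatch_le` can therefore be integrated over the event that they agree on the last `l` steps.
lemma IsContractive.measure_response_ne_le [Nonempty α] (h : IsContractive ν Φ β η) {Ω : Type*}
    [MeasurableSpace Ω] (P : Measure Ω) [IsProbabilityMeasure P] (t : ℤ)
    {x : Ω × (ℤ → E) → ℤ → α} {z z' : Ω × (ℤ → E) → ℤ → C}
    (hx : Measurable x) (hz : Measurable z) (hz' : Measurable z')
    (hxt : ∀ ω e e₀, x (ω, Function.update e t e₀) = x (ω, e))
    (hzt : ∀ ω e e₀, z (ω, Function.update e t e₀) = z (ω, e))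
    (hzt' : ∀ ω e e₀, z' (ω, Function.update e t e₀) = z' (ω, e)) (l : ℕ) :
    (P.prod (iidLaw ν)) {p | (∀ s : ℤ, -l ≤ s → s < 0 → z p s = z' p s) ∧
      Φ (x p) (z p) (p.2 t) ≠ Φ (x p) (z' p) (p.2 t)} ≤ ENNReal.ofReal (β l) := by
  have hg : Measurable fun p => (x p, z p, z' p) := hx.prodMk (hz.prodMk hz')
  have hlaw := prod_iidLaw_map_prodMk_eval ν P t hg fun ω e e₀ => by
    rw [hxt, hzt, hzt']
  set G : Set (((ℤ → α) × (ℤ → C) × (ℤ → C)) × E) :=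
    {q | (∀ s : ℤ, -l ≤ s → s < 0 → q.1.2.1 s = q.1.2.2 s) ∧
      Φ q.1.1 q.1.2.1 q.2 ≠ Φ q.1.1 q.1.2.2 q.2} with hG
  have hGm : MeasurableSet G := by
    refine MeasurableSet.inter ?_ (measurableSet_eq_fun ?_ ?_).compl
    · have : {q : ((ℤ → α) × (ℤ → C) × (ℤ → C)) × E |
          ∀ s : ℤ, -l ≤ s → s < 0 → q.1.2.1 s = q.1.2.2 s}
          = ⋂ s : ℤ, ⋂ (_ : -l ≤ s), ⋂ (_ : s < 0), {q | q.1.2.1 s = q.1.2.2 s} := by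
        ext q; simp
      have h2 : MeasurableSet {q : ((ℤ → α) × (ℤ → C) × (ℤ → C)) × E |
          ∀ s : ℤ, -l ≤ s → s < 0 → q.1.2.1 s = q.1.2.2 s} := by
        rw [this]
        exact MeasurableSet.iInter fun s => MeasurableSet.iInter fun _ => MeasurableSet.iInter
          fun _ => measurableSet_eq_fun (by fun_prop) (by fun_prop)
      exact h2
    · exact h.measurable.comp ((by fun_prop : Measurable fun q :
        ((ℤ → α) × (ℤ → C) × (ℤ → C)) × E => (q.1.1, q.1.2.1, q.2)))
    · exact h.measurable.comp ((by fun_prop : Measurable fun q :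
        ((ℤ → α) × (ℤ → C) × (ℤ → C)) × E => (q.1.1, q.1.2.2, q.2)))
  have hm1 : Measurable fun p : Ω × (ℤ → E) => ((x p, z p, z' p), p.2 t) :=
    hg.prodMk ((measurable_pi_apply t).comp measurable_snd)
  have heq : (P.prod (iidLaw ν)) {p | (∀ s : ℤ, -l ≤ s → s < 0 → z p s = z' p s) ∧
      Φ (x p) (z p) (p.2 t) ≠ Φ (x p) (z' p) (p.2 t)}
      = ((P.prod (iidLaw ν)).map (fun p => ((x p, z p, z' p), p.2 t))) G := by
    rw [Measure.map_apply hm1 hGm]; rfl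
  rw [heq, hlaw, Measure.prod_apply hGm]
  have : IsProbabilityMeasure ((P.prod (iidLaw ν)).map fun p => (x p, z p, z' p)) :=
    Measure.isProbabilityMeasure_map hg.aemeasurable
  calc _ ≤ ∫⁻ _, ENNReal.ofReal (β l) ∂((P.prod (iidLaw ν)).map fun p => (x p, z p, z' p)) := by
        refine lintegral_mono fun q => ?_
        by_cases hq : ∀ s : ℤ, -l ≤ s → s < 0 → q.2.1 s = q.2.2 s
        · refine le_trans (measure_mono fun e he => ?_)
            (ENNReal.le_ofReal_iff_toReal_le (measure_ne_top _ _) (h.nonneg l) |>.2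
              (h.mismatch_le q.1 q.2.1 q.2.2 l hq))
          exact he.2
        · refine le_trans (le_of_eq ?_) zero_le
          convert measure_empty (μ := ν)
          ext e
          simp only [hG, Set.mem_preimage, Set.mem_ofPred_eq, Set.mem_empty_iff_false, iff_false]
          exact fun hh => hq hh.1
    _ = ENNReal.ofReal (β l) := by simp

/-- A stationary solution of the recursion `y_t = Φ((x_{t + ·}), (y_{t + ·}), e_t)`, as a
functional of the paths of the covariates and of the noise up to the present. -/
structure IsStationaryResponse (ν : Measure E) (Φ : (ℤ → α) → (ℤ → C) → E → C)
    (lam : Measure (ℤ → α)) (F : (ℤ → α) × (ℤ → E) → C) : Prop where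
  measurable : Measurable F
  congr_noise : ∀ x e e', (∀ t ≤ 0, e t = e' t) → F (x, e) = F (x, e')
  approx : ∀ ε : ℝ≥0∞, ε ≠ 0 → ∃ m₀, ∀ m ≥ m₀, (lam.prod (iidLaw ν)) {ω | value Φ m ω ≠ F ω} ≤ ε
  recursion : ∀ᵐ ω ∂(lam.prod (iidLaw ν)), F ω = Φ ω.1 (orbit F ω) (ω.2 0)

/-- Along a subsequence with Cauchy errors 2⁻ᵏ, the Borel–Cantelli lemma makes the values eventually
constant, and the eventual value is the limit. -/
lemma IsContractive.exists_limit [Nonempty α] (h : IsContractive ν Φ β η)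
    (hlam : MeasurePreserving shift lam lam) :
    ∃ F : (ℤ → α) × (ℤ → E) → C, Measurable F ∧
      (∀ x e e', (∀ t ≤ 0, e t = e' t) → F (x, e) = F (x, e')) ∧
      ∀ ε : ℝ≥0∞, ε ≠ 0 →
        ∃ m₀, ∀ m ≥ m₀, (lam.prod (iidLaw ν)) {ω | value Φ m ω ≠ F ω} ≤ ε := by
  set Q := lam.prod (iidLaw ν)
  have hc : ∀ ε : ℝ≥0∞, ε ≠ 0 → ∃ m₀, ∀ m ≥ m₀, ∀ m' ≥ m,
      Q {ω | value Φ m ω ≠ value Φ m' ω} ≤ ε := fun ε hε => by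
    obtain ⟨n₀, hn⟩ := h.exists_forgets hlam 1 hε
    exact ⟨n₀, fun m hm m' hm' => h.measure_value_ne_le hlam hm' (hn (m + 1) (by omega))⟩
  choose! N hN using hc
  set ε : ℕ → ℝ≥0∞ := fun k => 2⁻¹ ^ k with hε
  have hε0 : ∀ k, ε k ≠ 0 := fun k => pow_ne_zero k (by simp)
  -- Adding `k` and summing the thresholds makes `mk` monotone, with mk k at least k and at least
  -- the threshold of ε k.
  set mk : ℕ → ℕ := fun k => k + ∑ i ∈ Finset.range (k + 1), N (ε i) with hmk
  have hmkN : ∀ k, N (ε k) ≤ mk k := fun k =>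
    (Finset.single_le_sum (f := fun i => N (ε i)) (fun _ _ => Nat.zero_le _) (by simp)).trans
      (Nat.le_add_left _ k)
  have hmono : Monotone mk := monotone_nat_of_le_succ fun k => by
    simp only [hmk]; rw [Finset.sum_range_succ _ (k + 1)]; omega
  obtain ⟨G, hGm, hG⟩ := exists_measurable_eventual_value (C := C)
  have hVm : Measurable fun (ω : (ℤ → α) × (ℤ → E)) (k : ℕ) => value Φ (mk k) ω :=
    measurable_pi_lambda _ fun k => h.measurable_value (mk k)
  refine ⟨fun ω => G fun k => value Φ (mk k) ω, hGm.comp hVm, fun x e e' hee => ?_, ?_⟩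
  · simp only [value_congr_noise hee]
  have hsum : ∑' k, Q {ω | value Φ (mk k) ω ≠ value Φ (mk (k + 1)) ω} ≠ ∞ := by
    refine ne_top_of_le_ne_top ?_ (ENNReal.tsum_le_tsum fun k =>
      hN (ε k) (hε0 k) (mk k) (hmkN k) (mk (k + 1)) (hmono (Nat.le_succ k)))
    simp [hε, ENNReal.tsum_geometric]
  have hev : ∀ᵐ ω ∂Q, ∀ᶠ k in atTop, value Φ (mk k) ω = G fun k => value Φ (mk k) ω := by
    filter_upwards [ae_eventually_notMem hsum] with ω hω
    obtain ⟨K, hK⟩ := eventually_atTop.1 hω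
    have hconst : ∀ k ≥ K, value Φ (mk k) ω = value Φ (mk K) ω := fun k hk => by
      induction k, hk using Nat.le_induction with
      | base => rfl
      | succ k hk ih => rw [← ih]; exact (not_not.1 (hK k hk)).symm
    have h1 : ∀ᶠ k in atTop, value Φ (mk k) ω = value Φ (mk K) ω :=
      eventually_atTop.2 ⟨K, hconst⟩
    rw [hG _ _ h1]
    exact h1
  intro δ hδ
  refine ⟨N δ, fun m hm => ?_⟩
  -- If value m is not the limit, it differs from all late members of the subsequence. The limit
  -- inferior of these events has measure at most δ, since mk (k + m) ≥ m.
  have hsub : {ω | value Φ m ω ≠ G fun k => value Φ (mk k) ω}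
      ≤ᵐ[Q] ⋃ K : ℕ, ⋂ k : ℕ, ⋂ (_ : K ≤ k), {ω | value Φ m ω ≠ value Φ (mk (k + m)) ω} := by
    filter_upwards [hev] with ω hω hne
    obtain ⟨K, hK⟩ := eventually_atTop.1 hω
    refine Set.mem_iUnion.2 ⟨K, Set.mem_iInter₂.2 fun k hk => ?_⟩
    have := hK (k + m) (by omega)
    change value Φ m ω ≠ value Φ (mk (k + m)) ω
    rw [this]; exact hne
  refine (measure_mono_ae hsub).trans ?_
  have hmonoU : Monotone fun K : ℕ =>
      ⋂ k : ℕ, ⋂ (_ : K ≤ k), {ω | value Φ m ω ≠ value Φ (mk (k + m)) ω} := fun K K' hKK =>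
    Set.iInter_mono fun k => Set.iInter_mono' fun hk => ⟨hKK.trans hk, le_rfl⟩
  rw [hmonoU.measure_iUnion]
  refine iSup_le fun K => ?_
  refine (measure_mono (Set.iInter₂_subset K le_rfl)).trans (hN δ hδ m hm _ ?_)
  have : K + m ≤ mk (K + m) := Nat.le_add_right _ _
  omega

/-- Each `value` satisfies the recursion along its own run. In the limit three errors occur: value m
against F, the last l steps of the run against the orbit, and the effect β l of the older past. The
first two vanish as m grows with l fixed, the third as l grows. -/
theorem IsContractive.exists_isStationaryResponse [Nonempty α] (h : IsContractive ν Φ β η)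
    (hlam : MeasurePreserving shift lam lam) : ∃ F, IsStationaryResponse ν Φ lam F := by
  obtain ⟨F, hFm, hFe, hFa⟩ := h.exists_limit hlam
  refine ⟨F, hFm, hFe, hFa, ?_⟩
  set Q := lam.prod (iidLaw ν) with hQ
  have horb : Measurable (orbit F) := measurable_orbit hFm
  have hrunm : ∀ m : ℕ, Measurable fun ω : (ℤ → α) × (ℤ → E) =>
      run Φ ω.1 ω.2 (fun _ => default) (-(m : ℤ)) m := fun m =>
    (h.measurable_run _ m).comp (measurable_fst.prodMk (measurable_snd.prodMk measurable_const))
  have hval : ∀ (m : ℕ) (ω : (ℤ → α) × (ℤ → E)),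
      value Φ m ω = Φ ω.1 (run Φ ω.1 ω.2 (fun _ => default) (-(m : ℤ)) m) (ω.2 0) := fun m ω => by
    have := h.run_apply (x := ω.1) (e := ω.2) (y := fun _ => default) (a := -(m : ℤ)) (m + 1)
      (t := 0) (by omega) (by push_cast; omega)
    rw [value, this, shiftBy_zero, shiftBy_zero]
    exact h.past _ _ _ _ fun s hs => run_stable m 1 (by omega)
  have hbound : ∀ (l : ℕ) (δ : ℝ≥0∞), δ ≠ 0 →
      Q {ω | F ω ≠ Φ ω.1 (orbit F ω) (ω.2 0)} ≤ (l + 1) * δ + ENNReal.ofReal (β l) := by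
    intro l δ hδ
    obtain ⟨m₀, hm₀⟩ := hFa δ hδ
    set m := m₀ + l with hm
    -- The orbit is masked from time 0 on to remove its dependence on the noise at time 0; Φ does
    -- not see the change.
    set B := {ω : (ℤ → α) × (ℤ → E) |
      (∀ s : ℤ, -l ≤ s → s < 0 →
        run Φ ω.1 ω.2 (fun _ => default) (-(m : ℤ)) m s = mask 0 (orbit F ω) s) ∧
      Φ ω.1 (run Φ ω.1 ω.2 (fun _ => default) (-(m : ℤ)) m) (ω.2 0)
        ≠ Φ ω.1 (mask 0 (orbit F ω)) (ω.2 0)} with hB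
    have hBle : Q B ≤ ENNReal.ofReal (β l) := by
      refine h.measure_response_ne_le lam 0 (x := Prod.fst) measurable_fst (hrunm m)
        ((measurable_mask 0).comp horb) (fun _ _ _ => rfl)
        (fun x e e₀ => run_update_noise m (by omega) e₀) (fun x e e₀ => ?_) l
      ext s
      simp only [Function.comp, mask]
      split_ifs with hs
      · exact hFe _ _ _ fun t ht => by
          simp only [shiftBy]
          exact Function.update_of_ne (by omega) _ _
      · rfl
    have hsub : {ω | F ω ≠ Φ ω.1 (orbit F ω) (ω.2 0)} ⊆
        ({ω | value Φ m ω ≠ F ω} ∪ ⋃ i ∈ Finset.range l,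
          shiftPair (-((i : ℤ) + 1)) ⁻¹' {ω | value Φ (m - (i + 1)) ω ≠ F ω}) ∪ B := by
      intro ω hω
      by_contra hcon
      simp only [Set.mem_union, not_or, Set.mem_iUnion, Finset.mem_range, not_exists,
        Set.mem_preimage, Set.mem_ofPred_eq, not_not] at hcon
      obtain ⟨⟨h1, h2⟩, h3⟩ := hcon
      apply hω
      rw [← h1, hval]
      have h4 : Φ ω.1 (orbit F ω) (ω.2 0) = Φ ω.1 (mask 0 (orbit F ω)) (ω.2 0) :=
        h.past _ _ _ _ fun s hs => by simp [mask, hs]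
      rw [h4]
      by_contra hne
      refine h3 ⟨fun s hs1 hs2 => ?_, hne⟩
      obtain ⟨i, hi⟩ := Int.eq_ofNat_of_zero_le (show 0 ≤ -s - 1 by omega)
      have h5 := h2 i (by omega)
      have h6 : s = -((i : ℤ) + 1) := by omega
      have h7 : -(m : ℤ) = s - ((m - (i + 1) : ℕ) : ℤ) := by omega
      rw [h7, run_default_eq_value (by omega), h6]
      simp only [mask]
      rw [if_pos (by omega)]
      exact h5
    refine (measure_mono hsub).trans ((measure_union_le _ _).trans (add_le_add ?_ hBle))
    refine (measure_union_le _ _).trans ?_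
    rw [add_comm (l : ℝ≥0∞), add_mul, one_mul]
    refine add_le_add (hm₀ m (by omega)) ((measure_biUnion_finset_le _ _).trans ?_)
    calc _ ≤ ∑ _i ∈ Finset.range l, δ := by
          refine Finset.sum_le_sum fun i hi => ?_
          have hi' : i < l := by simpa using hi
          have hms : MeasurableSet {ω : (ℤ → α) × (ℤ → E) | value Φ (m - (i + 1)) ω ≠ F ω} :=
            (measurableSet_eq_fun (h.measurable_value _) hFm).compl
          rw [(measurePreserving_shiftPair ν hlam _).measure_preimage hms.nullMeasurableSet]
          exact hm₀ _ (by omega)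
      _ = l * δ := by simp
  have hz : Q {ω | F ω ≠ Φ ω.1 (orbit F ω) (ω.2 0)} = 0 := by
    refine le_antisymm (ENNReal.le_of_forall_pos_le_add fun ε hε _ => ?_) zero_le
    have hβ := (ENNReal.tendsto_ofReal h.summable.tendsto_atTop_zero).eventually
      (ge_mem_nhds (show ENNReal.ofReal 0 < (ε / 2 : ℝ≥0∞) by
        simpa using hε.ne'))
    obtain ⟨l, hl⟩ := hβ.exists
    have hne : (ε / 2 / (l + 1) : ℝ≥0∞) ≠ 0 := by
      simp [ENNReal.div_eq_zero_iff, hε.ne']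
    refine (hbound l _ hne).trans ?_
    rw [zero_add, ENNReal.mul_div_cancel (by simp) (by finiteness)]
    calc (ε / 2 : ℝ≥0∞) + ENNReal.ofReal (β l) ≤ ε / 2 + ε / 2 := by gcongr
      _ = ε := ENNReal.add_halves _
  exact ae_iff.2 hz

end Stationary

end DiscreteChoice

namespace DiscreteChoice

open Filter Topology ENNReal

/-! ### Uniqueness of the law with given conditional response laws -/

section Uniqueness

variable {α E C : Type*} [Inhabited C]
  [MeasurableSpace α] [MeasurableSpace E] [MeasurableSpace C]

/-- Given the covariates and the past responses, the response at time `t` under the law `R` is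
distributed as `Φ((x_{t + ·}), (y_{t + ·}), e)` with `e` of law `ν`. -/
def HasResponseLaw (ν : Measure E) (Φ : (ℤ → α) → (ℤ → C) → E → C)
    (R : Measure ((ℤ → α) × (ℤ → C))) : Prop :=
  ∀ t : ℤ, R.map (fun p => (p.1, mask (t + 1) p.2))
    = (R.prod ν).map (fun q => (q.1.1, Function.update (mask t q.1.2) t
        (Φ (shiftBy t q.1.1) (shiftBy t (mask t q.1.2)) q.2)))

variable {Φ : (ℤ → α) → (ℤ → C) → E → C} {ν : Measure E} {β : ℕ → ℝ} {η : (ℤ → α) → ℝ}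
  [IsProbabilityMeasure ν] {R : Measure ((ℤ → α) × (ℤ → C))} [IsProbabilityMeasure R]

/-- Induction on n: the noise at time a + n is independent of the run so far, so one more step of
the run is exactly the transition prescribed by `HasResponseLaw`. -/
lemma HasResponseLaw.map_run (hR : HasResponseLaw ν Φ R) (h : IsContractive ν Φ β η)
    (a : ℤ) (n : ℕ) :
    (R.prod (iidLaw ν)).map (fun p => (p.1.1, run Φ p.1.1 p.2 p.1.2 a n))
      = R.map (fun p => (p.1, mask (a + n) p.2)) := by
  have hmask : ∀ t : ℤ, Measurable fun p : (ℤ → α) × (ℤ → C) => (p.1, mask t p.2) := fun t =>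
    measurable_fst.prodMk ((IsContractive.measurable_mask t).comp measurable_snd)
  have hrun : ∀ n : ℕ, Measurable fun p : ((ℤ → α) × (ℤ → C)) × (ℤ → E) =>
      (p.1.1, run Φ p.1.1 p.2 p.1.2 a n) := fun n =>
    (measurable_fst.comp measurable_fst).prodMk ((h.measurable_run a n).comp
      (by fun_prop : Measurable fun p : ((ℤ → α) × (ℤ → C)) × (ℤ → E) => (p.1.1, p.2, p.1.2)))
  induction n with
  | zero =>
    have : (fun p : ((ℤ → α) × (ℤ → C)) × (ℤ → E) => (p.1.1, run Φ p.1.1 p.2 p.1.2 a 0))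
        = (fun p : (ℤ → α) × (ℤ → C) => (p.1, mask (a + (0 : ℕ)) p.2)) ∘ Prod.fst := by
      ext p : 1; simp [run_zero]
    rw [this, ← Measure.map_map (hmask _) measurable_fst, Measure.map_fst_prod]
    simp
  | succ n ih =>
    have hlaw := prod_iidLaw_map_prodMk_eval ν R (a + n) (hrun n) fun ω e e₀ => by
      rw [run_update_noise n le_rfl]
    set S : ((ℤ → α) × (ℤ → C)) × E → (ℤ → α) × (ℤ → C) := fun q =>
      (q.1.1, Function.update q.1.2 (a + n)
        (Φ (shiftBy (a + n) q.1.1) (shiftBy (a + n) q.1.2) q.2)) with hS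
    have hSm : Measurable S := by
      refine (measurable_fst.comp measurable_fst).prodMk
        (IsContractive.measurable_update (measurable_snd.comp measurable_fst) _ ?_)
      exact h.measurable.comp (((measurable_shiftBy _).comp (measurable_fst.comp measurable_fst)).prodMk
        (((measurable_shiftBy _).comp (measurable_snd.comp measurable_fst)).prodMk measurable_snd))
    have h1 : (fun p : ((ℤ → α) × (ℤ → C)) × (ℤ → E) => (p.1.1, run Φ p.1.1 p.2 p.1.2 a (n + 1)))
        = S ∘ fun p => ((p.1.1, run Φ p.1.1 p.2 p.1.2 a n), p.2 (a + n)) := rfl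
    have h2 := hR (a + n)
    have h3 : Measurable fun p : ((ℤ → α) × (ℤ → C)) × (ℤ → E) =>
        ((p.1.1, run Φ p.1.1 p.2 p.1.2 a n), p.2 (a + n)) :=
      (hrun n).prodMk ((measurable_pi_apply _).comp measurable_snd)
    rw [h1, ← Measure.map_map hSm h3, hlaw, ih,
      show a + ((n + 1 : ℕ) : ℤ) = a + n + 1 by push_cast; ring, h2]
    conv_lhs => rw [← Measure.map_id (μ := ν)]
    rw [Measure.map_prod_map _ _ (hmask _) measurable_id,
      Measure.map_map hSm ((hmask _).prodMap measurable_id)]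
    rfl

variable [Countable C] [DiscreteMeasurableSpace C]
  {lam : Measure (ℤ → α)} [IsProbabilityMeasure lam] {F : (ℤ → α) × (ℤ → E) → C}

omit [IsProbabilityMeasure R] in
lemma IsStationaryResponse.measure_run_ne_le (hF : IsStationaryResponse ν Φ lam F)
    (h : IsContractive ν Φ β η)
    (hlam : MeasurePreserving shift lam lam) (T : ℤ) (K : ℕ) {ε : ℝ≥0∞} (hε : ε ≠ 0) :
    ∃ n₀ : ℕ, ∀ n : ℕ, n₀ ≤ n → (lam.prod (iidLaw ν)) {ω | ∃ s : ℤ, T - K ≤ s ∧ s < T ∧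
      run Φ ω.1 ω.2 (fun _ => default) (T - n) n s ≠ orbit F ω s} ≤ K * ε := by
  obtain ⟨m₀, hm₀⟩ := hF.approx ε hε
  refine ⟨m₀ + K, fun n hn => ?_⟩
  have hsub : {ω : (ℤ → α) × (ℤ → E) | ∃ s : ℤ, T - K ≤ s ∧ s < T ∧
      run Φ ω.1 ω.2 (fun _ => default) (T - n) n s ≠ orbit F ω s}
      ⊆ ⋃ i ∈ Finset.range K, shiftPair (T - (i + 1)) ⁻¹'
        {ω | value Φ (n - (i + 1)) ω ≠ F ω} := by
    rintro ω ⟨s, hs1, hs2, hne⟩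
    obtain ⟨i, hi⟩ := Int.eq_ofNat_of_zero_le (show 0 ≤ T - s - 1 by omega)
    refine Set.mem_iUnion₂.2 ⟨i, by simp only [Finset.mem_range]; omega, ?_⟩
    rw [show T - (n : ℤ) = s - ((n - (i + 1) : ℕ) : ℤ) by omega,
      run_default_eq_value (by omega)] at hne
    rw [show T - ((i : ℤ) + 1) = s by omega]
    exact hne
  refine (measure_mono hsub).trans ((measure_biUnion_finset_le _ _).trans ?_)
  calc _ ≤ ∑ _i ∈ Finset.range K, ε := by
        refine Finset.sum_le_sum fun i hi => ?_
        have hi' : i < K := by simpa using hi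
        have hms : MeasurableSet {ω : (ℤ → α) × (ℤ → E) | value Φ (n - (i + 1)) ω ≠ F ω} :=
          (measurableSet_eq_fun (h.measurable_value _) hF.measurable).compl
        rw [(measurePreserving_shiftPair ν hlam _).measure_preimage hms.nullMeasurableSet]
        exact hm₀ _ (by omega)
    _ = K * ε := by simp

/-- A law with the given conditional laws of the responses is the law of the stationary solution
driven by the noise. -/
theorem HasResponseLaw.eq_map_orbit [Nonempty α] (hR : HasResponseLaw ν Φ R)
    (h : IsContractive ν Φ β η) (hlam : MeasurePreserving shift lam lam)
    (hF : IsStationaryResponse ν Φ lam F) (hRlam : R.map Prod.fst = lam) :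
    R = (lam.prod (iidLaw ν)).map (fun ω => (ω.1, orbit F ω)) := by
  set Q := lam.prod (iidLaw ν) with hQ
  have hom : Measurable fun ω : (ℤ → α) × (ℤ → E) => (ω.1, orbit F ω) :=
    measurable_fst.prodMk (measurable_orbit hF.measurable)
  have : IsProbabilityMeasure (Q.map fun ω => (ω.1, orbit F ω)) :=
    Measure.isProbabilityMeasure_map hom.aemeasurable
  have hRQ : MeasurePreserving (fun p : ((ℤ → α) × (ℤ → C)) × (ℤ → E) => (p.1.1, p.2))
      (R.prod (iidLaw ν)) Q :=
    (⟨measurable_fst, hRlam⟩ : MeasurePreserving Prod.fst R lam).prod (MeasurePreserving.id _)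
  -- For a cylinder based on [T - K, T): regenerate the responses from their `R`-past before T - n
  -- by fresh noise. Off `D₂` this run agrees on the window with the run from the default past, and
  -- off `D₁` the latter agrees with the orbit of `F`.
  have key : ∀ A : Set (ℤ → α), MeasurableSet A → ∀ B ∈ measurableCylinders (fun _ : ℤ => C),
      R (A ×ˢ B) = (Q.map fun ω => (ω.1, orbit F ω)) (A ×ˢ B) := by
    intro A hA B hB
    have hBm : MeasurableSet B := MeasurableSet.of_mem_measurableCylinders hB
    obtain ⟨I, S, hS, rfl⟩ := (mem_measurableCylinders _).1 hB
    obtain ⟨T, K, hTK⟩ : ∃ (T : ℤ) (K : ℕ), ∀ s ∈ I, T - K ≤ s ∧ s < T := by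
      obtain ⟨b, hb⟩ := I.bddAbove
      obtain ⟨c, hc⟩ := I.bddBelow
      refine ⟨b + 1, (b + 1 - c).toNat, fun s hs => ?_⟩
      have h1 : s ≤ b := hb hs
      have h2 : c ≤ s := hc hs
      omega
    have hcyl : ∀ y y' : ℤ → C, (∀ s : ℤ, T - K ≤ s → s < T → y s = y' s) →
        (y ∈ cylinder I S ↔ y' ∈ cylinder I S) := fun y y' hy => by
      simp only [mem_cylinder]
      have : I.restrict y = I.restrict y' := funext fun i => hy i (hTK i i.2).1 (hTK i i.2).2
      rw [this]
    have hclose : ∀ ε : ℝ≥0∞, ε ≠ 0 →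
        R (A ×ˢ cylinder I S) ≤ (Q.map fun ω => (ω.1, orbit F ω)) (A ×ˢ cylinder I S)
          + (1 + K) * ε ∧
        (Q.map fun ω => (ω.1, orbit F ω)) (A ×ˢ cylinder I S) ≤ R (A ×ˢ cylinder I S)
          + (1 + K) * ε := by
      intro ε hε
      obtain ⟨n₁, hn₁⟩ := hF.measure_run_ne_le h hlam T K hε
      obtain ⟨n₂, hn₂⟩ := h.exists_forgets hlam K hε
      set n := max n₁ n₂
      set D₁ := (fun p : ((ℤ → α) × (ℤ → C)) × (ℤ → E) => (p.1.1, p.2)) ⁻¹'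
        {ω | ∃ s : ℤ, T - K ≤ s ∧ s < T ∧
          run Φ ω.1 ω.2 (fun _ => default) (T - n) n s ≠ orbit F ω s} with hD₁
      set D₂ := {p : ((ℤ → α) × (ℤ → C)) × (ℤ → E) | ∃ s : ℤ, T - n + n - K ≤ s ∧ s < T - n + n ∧
        run Φ p.1.1 p.2 p.1.2 (T - n) n s ≠ run Φ p.1.1 p.2 (fun _ => default) (T - n) n s} with hD₂
      have h1 : (R.prod (iidLaw ν)) D₁ ≤ K * ε := by
        refine (hRQ.measure_preimage_le _).trans (hn₁ n (le_max_left _ _))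
      have h2 : (R.prod (iidLaw ν)) D₂ ≤ ε :=
        (hn₂ n (le_max_right _ _)).measure_le hlam ⟨measurable_fst, hRlam⟩ Prod.snd
          (fun _ _ => default) (T - n)
          (h.measurableSet_disagree measurable_fst measurable_snd measurable_const _ _ _ _)
      have h12 : (R.prod (iidLaw ν)) (D₂ ∪ D₁) ≤ (1 + K) * ε := by
        rw [add_mul, one_mul]
        exact (measure_union_le _ _).trans (add_le_add h2 h1)
      have e1 : R (A ×ˢ cylinder I S) = (R.prod (iidLaw ν))
          {p | p.1.1 ∈ A ∧ run Φ p.1.1 p.2 p.1.2 (T - n) n ∈ cylinder I S} := by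
        have hmask : Measurable fun p : (ℤ → α) × (ℤ → C) => (p.1, mask (T - n + n) p.2) :=
          measurable_fst.prodMk ((IsContractive.measurable_mask _).comp measurable_snd)
        have hrun : Measurable fun p : ((ℤ → α) × (ℤ → C)) × (ℤ → E) =>
            (p.1.1, run Φ p.1.1 p.2 p.1.2 (T - n) n) :=
          (measurable_fst.comp measurable_fst).prodMk ((h.measurable_run _ n).comp (by fun_prop :
            Measurable fun p : ((ℤ → α) × (ℤ → C)) × (ℤ → E) => (p.1.1, p.2, p.1.2)))
        have hmap := congrArg (fun ρ => ρ (A ×ˢ cylinder I S)) (hR.map_run h (T - n) n)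
        rw [Measure.map_apply hmask (hA.prod hBm), Measure.map_apply hrun (hA.prod hBm)] at hmap
        refine Eq.trans ?_ hmap.symm
        congr 1
        ext p
        simp only [Set.mem_preimage, Set.mem_prod]
        refine and_congr_right fun _ => hcyl _ _ fun s _ hs => ?_
        simp only [mask]
        rw [if_pos (by omega)]
      have e2 : (Q.map fun ω => (ω.1, orbit F ω)) (A ×ˢ cylinder I S) = (R.prod (iidLaw ν))
          {p | p.1.1 ∈ A ∧ orbit F (p.1.1, p.2) ∈ cylinder I S} := by
        rw [Measure.map_apply hom (hA.prod hBm),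
          ← hRQ.measure_preimage (hom (hA.prod hBm)).nullMeasurableSet]
        rfl
      have hiff : ∀ p ∉ D₂ ∪ D₁, (run Φ p.1.1 p.2 p.1.2 (T - n) n ∈ cylinder I S ↔
          orbit F (p.1.1, p.2) ∈ cylinder I S) := fun p hp => by
        simp only [Set.mem_union, not_or] at hp
        refine hcyl _ _ fun s hs1 hs2 => ?_
        by_contra hne
        by_cases hs : run Φ p.1.1 p.2 p.1.2 (T - n) n s
          = run Φ p.1.1 p.2 (fun _ => default) (T - n) n s
        · exact hp.2 ⟨s, hs1, hs2, fun hh => hne (hs.trans hh)⟩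
        · exact hp.1 ⟨s, by omega, by omega, hs⟩
      rw [e1, e2]
      constructor
      · refine (measure_mono (t := {p | p.1.1 ∈ A ∧ orbit F (p.1.1, p.2) ∈ cylinder I S} ∪
          (D₂ ∪ D₁)) fun p hp => ?_).trans ((measure_union_le _ _).trans (by gcongr))
        by_cases hpD : p ∈ D₂ ∪ D₁
        · exact Or.inr hpD
        · exact Or.inl ⟨hp.1, (hiff p hpD).1 hp.2⟩
      · refine (measure_mono (t := {p | p.1.1 ∈ A ∧
          run Φ p.1.1 p.2 p.1.2 (T - n) n ∈ cylinder I S} ∪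
          (D₂ ∪ D₁)) fun p hp => ?_).trans ((measure_union_le _ _).trans (by gcongr))
        by_cases hpD : p ∈ D₂ ∪ D₁
        · exact Or.inr hpD
        · exact Or.inl ⟨hp.1, (hiff p hpD).2 hp.2⟩
    have hfin : ∀ u v : ℝ≥0∞, (∀ ε : ℝ≥0∞, ε ≠ 0 → u ≤ v + (1 + K) * ε) → u ≤ v := fun u v huv => by
      refine ENNReal.le_of_forall_pos_le_add fun ε hε _ => ?_
      have hne : (ε / (1 + K) : ℝ≥0∞) ≠ 0 := by
        simp [ENNReal.div_eq_zero_iff, hε.ne']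
      have := huv _ hne
      rwa [ENNReal.mul_div_cancel (by simp) (by finiteness)] at this
    exact le_antisymm (hfin _ _ fun ε hε => (hclose ε hε).1) (hfin _ _ fun ε hε => (hclose ε hε).2)
  refine Measure.ext_prod fun {A B} hA hB => ?_
  have hmeasure : ∀ ρ : Measure ((ℤ → α) × (ℤ → C)), ∀ B : Set (ℤ → C), MeasurableSet B →
      ((ρ.restrict (A ×ˢ Set.univ)).map Prod.snd) B = ρ (A ×ˢ B) := fun ρ B hB => by
    rw [Measure.map_apply measurable_snd hB, Measure.restrict_apply (measurable_snd hB)]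
    congr 1
    ext p; simp [and_comm]
  rw [← hmeasure _ B hB, ← hmeasure _ B hB]
  have hext : (R.restrict (A ×ˢ Set.univ)).map Prod.snd
      = ((Q.map fun ω => (ω.1, orbit F ω)).restrict (A ×ˢ Set.univ)).map Prod.snd := by
    refine ext_of_generate_finite (measurableCylinders fun _ : ℤ => C)
      generateFrom_measurableCylinders.symm isPiSystem_measurableCylinders ?_ ?_
    · intro B hB
      have hBm : MeasurableSet B := MeasurableSet.of_mem_measurableCylinders hB
      rw [hmeasure _ B hBm, hmeasure _ B hBm]
      exact key A hA B hB
    · rw [hmeasure _ _ .univ, hmeasure _ _ .univ]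
      exact key A hA _ (univ_mem_measurableCylinders _)
  rw [hext]

end Uniqueness

end DiscreteChoice

namespace DiscreteChoice

open Filter Topology ENNReal

/-! ### Geometric decay of the powers of the companion map -/

section Companion

variable {𝕜 : Type*} [RCLike 𝕜] {N q : ℕ}

/-- The companion map of the recursion `v_t = ∑ j, B_j v_{t-j-1}`, acting on the states
`(v_t, …, v_{t-q})`. -/
noncomputable def companion (B : Fin q → Matrix (Fin N) (Fin N) 𝕜) :
    (Fin (q + 1) → Fin N → 𝕜) →ₗ[𝕜] (Fin (q + 1) → Fin N → 𝕜) where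
  toFun s := Fin.cons (∑ j, (B j).mulVec (s j.castSucc)) fun i => s i.castSucc
  map_add' s s' := by
    ext i : 1
    refine Fin.cases ?_ (fun i => ?_) i
    · simp [Matrix.mulVec_add, Finset.sum_add_distrib]
    · simp
  map_smul' c s := by
    ext i : 1
    refine Fin.cases ?_ (fun i => ?_) i
    · simp [Matrix.mulVec_smul, Finset.smul_sum]
    · simp

@[simp] lemma companion_zero (B : Fin q → Matrix (Fin N) (Fin N) 𝕜) (s : Fin (q + 1) → Fin N → 𝕜) :
    companion B s 0 = ∑ j, (B j).mulVec (s j.castSucc) := rfl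

@[simp] lemma companion_succ (B : Fin q → Matrix (Fin N) (Fin N) 𝕜) (s : Fin (q + 1) → Fin N → 𝕜)
    (i : Fin q) : companion B s i.succ = s i.castSucc := rfl

/-- An eigenvector for c ≠ 0 has the form s_i = c⁻ⁱ s_0, and its top row says that s_0 ≠ 0 is in the
kernel of I - ∑ B_j c⁻ʲ. So c⁻¹ is a root of the determinant. -/
lemma norm_lt_one_of_hasEigenvalue {B : Fin q → Matrix (Fin N) (Fin N) ℝ}
    (hB : RootsOutsideUnitDisc B) {c : ℂ}
    (hc : Module.End.HasEigenvalue (companion fun j => (B j).map Complex.ofReal) c) : ‖c‖ < 1 := by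
  rcases eq_or_ne c 0 with rfl | hc0
  · simp
  obtain ⟨s, hs⟩ := hc.exists_hasEigenvector
  have hs1 := hs.apply_eq_smul
  have hs2 := hs.2
  have hpow : ∀ i : Fin (q + 1), s i = c⁻¹ ^ (i : ℕ) • s 0 := by
    intro i
    induction i using Fin.induction with
    | zero => simp
    | succ i ih =>
      have h1 := congrFun hs1 i.succ
      rw [companion_succ, ih, Pi.smul_apply] at h1
      rw [Fin.val_succ, pow_succ', mul_smul, ← Fin.val_castSucc i, h1, smul_smul,
        inv_mul_cancel₀ hc0, one_smul]
  have hs0 : s 0 ≠ 0 := fun h0 => hs2 (funext fun i => by rw [hpow, h0, smul_zero]; rfl)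
  have hker : (1 - ∑ j : Fin q, c⁻¹ ^ ((j : ℕ) + 1) • (B j).map Complex.ofReal).mulVec (s 0) = 0 := by
    have h1 := congrFun hs1 0
    rw [companion_zero, Pi.smul_apply] at h1
    rw [Matrix.sub_mulVec, Matrix.one_mulVec, Matrix.sum_mulVec, sub_eq_zero]
    have h2 : s 0 = c⁻¹ • (c • s 0) := by rw [smul_smul, inv_mul_cancel₀ hc0, one_smul]
    conv_lhs => rw [h2, ← h1, Finset.smul_sum]
    refine Finset.sum_congr rfl fun j _ => ?_
    rw [hpow, Matrix.mulVec_smul, Matrix.smul_mulVec, smul_smul, pow_succ']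
    rfl
  have h3 := hB c⁻¹ (Matrix.exists_mulVec_eq_zero_iff.1 ⟨s 0, hs0, hker⟩)
  rw [norm_inv] at h3
  exact (one_lt_inv₀ (norm_pos_iff.2 hc0)).1 h3

/-- Gelfand's formula gives the bound rⁿ for large n, and the constant absorbs the finitely many
remaining powers. -/
lemma exists_norm_pow_le_of_spectralRadius_lt_one {A : Type*} [NormedRing A] [NormedAlgebra ℂ A]
    [CompleteSpace A] (a : A) (ha : spectralRadius ℂ a < 1) :
    ∃ K r : ℝ, 0 < K ∧ 0 < r ∧ r < 1 ∧ ∀ n, ‖a ^ n‖ ≤ K * r ^ n := by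
  obtain ⟨r, hr1, hr2⟩ := ENNReal.lt_iff_exists_nnreal_btwn.1 ha
  have hr0 : 0 < r := by exact_mod_cast (zero_le.trans_lt hr1)
  have hev := (spectrum.pow_nnnorm_pow_one_div_tendsto_nhds_spectralRadius a).eventually
    (gt_mem_nhds hr1)
  obtain ⟨n₀, hn₀⟩ := eventually_atTop.1 (hev.and (eventually_gt_atTop 0))
  have hr0' : (0 : ℝ) < r := by exact_mod_cast hr0
  refine ⟨1 + ∑ n ∈ Finset.range n₀, ‖a ^ n‖ / r ^ n, r, ?_, hr0', by exact_mod_cast hr2, ?_⟩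
  · have : 0 ≤ ∑ n ∈ Finset.range n₀, ‖a ^ n‖ / (r : ℝ) ^ n :=
      Finset.sum_nonneg fun _ _ => by positivity
    linarith
  intro n
  rw [add_mul, one_mul]
  rcases lt_or_ge n n₀ with hn | hn
  · have h1 : ‖a ^ n‖ / (r : ℝ) ^ n ≤ ∑ n ∈ Finset.range n₀, ‖a ^ n‖ / (r : ℝ) ^ n :=
      Finset.single_le_sum (f := fun n => ‖a ^ n‖ / (r : ℝ) ^ n)
        (fun _ _ => by positivity) (Finset.mem_range.2 hn)
    rw [div_le_iff₀ (by positivity)] at h1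
    have : (0 : ℝ) < (r : ℝ) ^ n := by positivity
    linarith
  · obtain ⟨h1, h2⟩ := hn₀ n hn
    have h3 : (‖a ^ n‖₊ : ℝ≥0∞) ≤ (r : ℝ≥0∞) ^ n := by
      have := ENNReal.rpow_le_rpow h1.le (show (0 : ℝ) ≤ n by positivity)
      rwa [← ENNReal.rpow_mul, one_div, inv_mul_cancel₀ (by positivity), ENNReal.rpow_one,
        ENNReal.rpow_natCast] at this
    have h4 : ‖a ^ n‖ ≤ (r : ℝ) ^ n := by exact_mod_cast h3
    have : 0 ≤ (∑ n ∈ Finset.range n₀, ‖a ^ n‖ / (r : ℝ) ^ n) * (r : ℝ) ^ n :=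
      mul_nonneg (Finset.sum_nonneg fun _ _ => by positivity) (by positivity)
    linarith

/-- The spectral bound lives over ℂ. It descends to the real map because the entrywise embedding is
isometric for the sup norms and intertwines the two companion maps. -/
theorem exists_norm_companion_pow_le {B : Fin q → Matrix (Fin N) (Fin N) ℝ}
    (hB : RootsOutsideUnitDisc B) :
    ∃ K r : ℝ, 0 < K ∧ 0 < r ∧ r < 1 ∧
      ∀ n s, ‖(companion B ^ n) s‖ ≤ K * r ^ n * ‖s‖ := by
  set T := companion fun j => (B j).map Complex.ofReal with hT
  set a := Module.End.toContinuousLinearMap (Fin (q + 1) → Fin N → ℂ) T with ha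
  have hrad : spectralRadius ℂ a < 1 := by
    -- For N = 0 the state space is trivial and the spectral radius is 0.
    rcases subsingleton_or_nontrivial (Fin (q + 1) → Fin N → ℂ) with hss | hnt
    · have : Subsingleton ((Fin (q + 1) → Fin N → ℂ) →L[ℂ] (Fin (q + 1) → Fin N → ℂ)) :=
        ⟨fun f g => by ext1 x; exact Subsingleton.elim _ _⟩
      rw [spectrum.SpectralRadius.of_subsingleton]; simp
    · refine (spectrum.spectralRadius_lt_of_forall_lt a (r := 1) fun c hc => ?_).trans_le (by simp)
      rw [ha, AlgEquiv.spectrum_eq] at hc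
      have := norm_lt_one_of_hasEigenvalue hB (Module.End.hasEigenvalue_iff_mem_spectrum.2 hc)
      exact_mod_cast this
  obtain ⟨K, r, hK, hr0, hr1, hKr⟩ := exists_norm_pow_le_of_spectralRadius_lt_one a hrad
  refine ⟨K, r, hK, hr0, hr1, fun n s => ?_⟩
  set emb : (Fin (q + 1) → Fin N → ℝ) → (Fin (q + 1) → Fin N → ℂ) := fun s i j => (s i j : ℂ)
    with hemb
  have hnorm : ∀ s, ‖emb s‖ = ‖s‖ := fun s => by
    have h1 : ∀ v : Fin N → ℝ, ‖fun j => (v j : ℂ)‖₊ = ‖v‖₊ := fun v => by simp [Pi.nnnorm_def]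
    have h2 : ‖emb s‖₊ = ‖s‖₊ := by
      rw [Pi.nnnorm_def, Pi.nnnorm_def]
      exact congrArg _ (funext fun i => h1 (s i))
    exact congrArg NNReal.toReal h2
  have hcomm : ∀ s, emb (companion B s) = T (emb s) := fun s => by
    ext i : 1
    refine Fin.cases ?_ (fun i => ?_) i
    · ext k
      simp only [hemb, hT, companion_zero, Finset.sum_apply, Complex.ofReal_sum]
      refine Finset.sum_congr rfl fun j _ => ?_
      simp [Matrix.mulVec, dotProduct]
    · rfl
  have hpow : ∀ n s, emb ((companion B ^ n) s) = (T ^ n) (emb s) := fun n => by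
    induction n with
    | zero => intro s; rfl
    | succ n ih => intro s; rw [pow_succ', pow_succ', Module.End.mul_apply, hcomm, ih,
        Module.End.mul_apply]
  have h1 : (T ^ n) (emb s) = (a ^ n) (emb s) := by
    rw [ha, ← map_pow]; rfl
  rw [← hnorm, hpow, h1, ← hnorm s]
  exact ((a ^ n).le_opNorm _).trans (mul_le_mul_of_nonneg_right (hKr n) (norm_nonneg _))

end Companion

end DiscreteChoice

namespace DiscreteChoice

open Filter Topology ENNReal

/-! ### The linear filter and its dependence on covariates and responses -/

section Filtering

variable {N d p q : ℕ} (B : Fin q → Matrix (Fin N) (Fin N) ℝ)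

/-- The effect on the state, after `n` steps, of an impulse. -/
noncomputable def impulse (n : ℕ) : (Fin N → ℝ) →ₗ[ℝ] (Fin (q + 1) → Fin N → ℝ) :=
  (companion B ^ n) ∘ₗ LinearMap.single ℝ (fun _ => Fin N → ℝ) 0

lemma impulse_zero (v : Fin N → ℝ) : impulse B 0 v = Pi.single 0 v := rfl

lemma impulse_succ (n : ℕ) (v : Fin N → ℝ) : impulse B (n + 1) v = companion B (impulse B n v) := by
  simp [impulse, pow_succ']

lemma norm_impulse_le {K r : ℝ} (h : ∀ n s, ‖(companion B ^ n) s‖ ≤ K * r ^ n * ‖s‖)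
    (n : ℕ) (v : Fin N → ℝ) : ‖impulse B n v‖ ≤ K * r ^ n * ‖v‖ := by
  refine (h n _).trans (le_of_eq ?_)
  rw [LinearMap.single_apply, Pi.norm_single]

/-- The state at time `t` of the linear system with input `w`. -/
noncomputable def filterState (w : ℤ → Fin N → ℝ) (t : ℤ) : Fin (q + 1) → Fin N → ℝ :=
  ∑' n : ℕ, impulse B n (w (t - n))

variable {B}

lemma filterState_eq {w : ℤ → Fin N → ℝ}
    (hw : ∀ t, Summable fun n : ℕ => impulse B n (w (t - n))) (t : ℤ) :
    filterState B w t = companion B (filterState B w (t - 1)) + Pi.single 0 (w t) := by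
  rw [filterState, (hw t).tsum_eq_zero_add, add_comm (impulse B 0 _)]
  congr 1
  · have := ((companion B).toContinuousLinearMap).map_tsum (hw (t - 1))
    simp only [LinearMap.coe_toContinuousLinearMap'] at this
    rw [filterState, this]
    refine tsum_congr fun n => ?_
    rw [impulse_succ]
    congr 3
    push_cast; ring
  · simp [impulse_zero]

lemma filterState_apply {w : ℤ → Fin N → ℝ}
    (hw : ∀ t, Summable fun n : ℕ => impulse B n (w (t - n))) (t : ℤ) (j : Fin (q + 1)) :
    filterState B w t j = filterState B w (t - (j : ℕ)) 0 := by
  induction j using Fin.induction generalizing t with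
  | zero => simp
  | succ j ih =>
    have h1 := congrFun (filterState_eq hw t) j.succ
    rw [Pi.add_apply, companion_succ, ih, Pi.single_eq_of_ne (Fin.succ_ne_zero j), add_zero] at h1
    have e : t - 1 - ((j.castSucc : ℕ) : ℤ) = t - ((j.succ : ℕ) : ℤ) := by
      simp only [Fin.val_castSucc, Fin.val_succ]; push_cast; ring
    rw [h1, e]

lemma filterState_recursion {w : ℤ → Fin N → ℝ}
    (hw : ∀ t, Summable fun n : ℕ => impulse B n (w (t - n))) (t : ℤ) :
    filterState B w t 0
      = ∑ j : Fin q, (B j).mulVec (filterState B w (t - ((j : ℕ) + 1)) 0) + w t := by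
  conv_lhs => rw [filterState_eq hw]
  simp only [Pi.add_apply, companion_zero, Pi.single_eq_same]
  congr 1
  refine Finset.sum_congr rfl fun j _ => ?_
  have e : t - 1 - ((j.castSucc : ℕ) : ℤ) = t - ((j : ℕ) + 1) := by
    simp only [Fin.val_castSucc]; ring
  rw [filterState_apply hw, e]

lemma state_unroll {w : ℤ → Fin N → ℝ} {s : ℤ → Fin (q + 1) → Fin N → ℝ}
    (hs : ∀ t, s t = companion B (s (t - 1)) + Pi.single 0 (w t)) (t : ℤ) (n : ℕ) :
    s t = (companion B ^ n) (s (t - n)) + ∑ k ∈ Finset.range n, impulse B k (w (t - k)) := by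
  induction n with
  | zero => simp
  | succ n ih =>
    rw [Finset.sum_range_succ, ih, hs (t - n), map_add, pow_succ, Module.End.mul_apply,
      show t - (n : ℤ) - 1 = t - ((n + 1 : ℕ) : ℤ) by push_cast; ring]
    simp only [impulse, LinearMap.comp_apply, LinearMap.single_apply]
    abel

lemma state_of_recursion {w m : ℤ → Fin N → ℝ}
    (hm : ∀ t, m t = ∑ j : Fin q, (B j).mulVec (m (t - ((j : ℕ) + 1))) + w t) (t : ℤ) :
    (fun j : Fin (q + 1) => m (t - (j : ℕ)))
      = companion B (fun j : Fin (q + 1) => m (t - 1 - (j : ℕ))) + Pi.single 0 (w t) := by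
  ext j : 1
  refine Fin.cases ?_ (fun j => ?_) j
  · simp only [Fin.val_zero, Nat.cast_zero, sub_zero, Pi.add_apply, companion_zero,
      Pi.single_eq_same]
    rw [hm t]
    congr 1
    refine Finset.sum_congr rfl fun j _ => ?_
    have e : t - 1 - ((j.castSucc : ℕ) : ℤ) = t - ((j : ℕ) + 1) := by
      simp only [Fin.val_castSucc]; ring
    rw [e]
  · simp only [Pi.add_apply, companion_succ, Pi.single_eq_of_ne (Fin.succ_ne_zero j), add_zero]
    congr 1
    simp only [Fin.val_castSucc, Fin.val_succ]; push_cast; ring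

variable (B) (A : Fin p → Matrix (Fin N) (Fin N) ℝ) (Γ : Matrix (Fin N) (Fin d) ℝ)

/-- The contribution of the covariates to the latent process at time `0`. -/
noncomputable def covariatePart (x : ℤ → Fin d → ℝ) : Fin N → ℝ := fun i =>
  limsup (fun n : ℕ => (∑ k ∈ Finset.range n, impulse B k (Γ.mulVec (x (-k)))) 0 i) atTop

/-- The binary vector with the given coordinates. -/
def boolVec (c : Fin N → Bool) : Fin N → ℝ := fun i => if c i then 1 else 0

/-- The input from the responses at time `t`. -/
noncomputable def feedback (y : ℤ → Fin N → Bool) (t : ℤ) : Fin N → ℝ :=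
  ∑ k : Fin p, (A k).mulVec (boolVec (y (t - ((k : ℕ) + 1))))

/-- The contribution of the responses to the latent process at time `0`. -/
noncomputable def responsePart (y : ℤ → Fin N → Bool) : Fin N → ℝ :=
  filterState B (feedback A y) 0 0

lemma measurable_impulse (n : ℕ) : Measurable (impulse B n) :=
  (impulse B n).toContinuousLinearMap.continuous.measurable

lemma measurable_mulVec {m n : ℕ} (M : Matrix (Fin m) (Fin n) ℝ) :
    Measurable fun v : Fin n → ℝ => M.mulVec v :=
  (Matrix.toLin' M).toContinuousLinearMap.continuous.measurable

lemma measurable_covariatePart : Measurable (covariatePart B Γ) := by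
  refine measurable_pi_lambda _ fun i => Measurable.limsup fun n => ?_
  have h : ∀ k : ℕ, Measurable fun x : ℤ → Fin d → ℝ => impulse B k (Γ.mulVec (x (-k))) := fun k =>
    (measurable_impulse B k).comp ((measurable_mulVec Γ).comp (measurable_pi_apply _))
  have h2 : Measurable fun x : ℤ → Fin d → ℝ =>
      ∑ k ∈ Finset.range n, impulse B k (Γ.mulVec (x (-k))) :=
    Finset.measurable_fun_sum _ fun k _ => h k
  exact (measurable_pi_apply i).comp ((measurable_pi_apply 0).comp h2)

variable {B Γ} in
-- Where the series converges, the limsup in `covariatePart` is its sum. Elsewhere it is only a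
-- measurable default, harmless because convergence is almost sure.
lemma covariatePart_shiftBy {x : ℤ → Fin d → ℝ} {t : ℤ}
    (hx : Summable fun n : ℕ => impulse B n (Γ.mulVec (x (t - n)))) :
    covariatePart B Γ (shiftBy t x) = filterState B (fun s => Γ.mulVec (x s)) t 0 := by
  ext i
  refine Tendsto.limsup_eq ?_
  have h1 := hx.hasSum.tendsto_sum_nat
  have h2 := ((continuous_apply i).tendsto _).comp
    (((continuous_apply (0 : Fin (q + 1))).tendsto _).comp h1)
  refine h2.congr fun n => ?_
  simp only [Function.comp, shiftBy_apply]
  simp only [neg_add_eq_sub]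

lemma measurable_boolVec : Measurable (boolVec : (Fin N → Bool) → Fin N → ℝ) :=
  measurable_of_countable _

lemma boolVec_eq_indicatorVec (c : Fin N → Bool) : boolVec c = indicatorVec {i | c i = true} := by
  classical
  ext i
  simp [boolVec, indicatorVec, Set.indicator_apply]

lemma norm_boolVec_le (c : Fin N → Bool) : ‖boolVec c‖ ≤ 1 := by
  refine (pi_norm_le_iff_of_nonneg zero_le_one).2 fun i => ?_
  simp only [boolVec]
  split_ifs <;> simp

lemma exists_norm_feedback_le : ∃ a : ℝ, 0 ≤ a ∧ ∀ y t, ‖feedback A y t‖ ≤ a := by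
  refine ⟨∑ k, ‖(Matrix.toLin' (A k)).toContinuousLinearMap‖,
    Finset.sum_nonneg fun _ _ => norm_nonneg _, fun y t => ?_⟩
  refine (norm_sum_le _ _).trans (Finset.sum_le_sum fun k _ => ?_)
  refine ((Matrix.toLin' (A k)).toContinuousLinearMap.le_opNorm _).trans ?_
  exact mul_le_of_le_one_right (norm_nonneg _) (norm_boolVec_le _)

lemma feedback_shiftBy (y : ℤ → Fin N → Bool) (s t : ℤ) :
    feedback A (shiftBy s y) t = feedback A y (t + s) := by
  simp only [feedback, shiftBy_apply]
  refine Finset.sum_congr rfl fun k _ => ?_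
  rw [show t - ((k : ℕ) + 1) + s = t + s - ((k : ℕ) + 1) by ring]

lemma responsePart_shiftBy (y : ℤ → Fin N → Bool) (t : ℤ) :
    responsePart B A (shiftBy t y) = filterState B (feedback A y) t 0 := by
  have h : ∀ n : ℕ, 0 - (n : ℤ) + t = t - n := fun n => by ring
  simp only [responsePart, filterState, feedback_shiftBy, h]

variable {B}

lemma summable_impulse_feedback (hB : RootsOutsideUnitDisc B) (y : ℤ → Fin N → Bool) (t : ℤ) :
    Summable fun n : ℕ => impulse B n (feedback A y (t - n)) := by
  obtain ⟨K, r, hK, hr0, hr1, hKr⟩ := exists_norm_companion_pow_le hB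
  obtain ⟨a, ha, hay⟩ := exists_norm_feedback_le A
  refine Summable.of_norm_bounded (g := fun n => K * r ^ n * a)
    (((summable_geometric_of_lt_one hr0.le hr1).mul_left K).mul_right a) fun n => ?_
  refine (norm_impulse_le B hKr n _).trans (mul_le_mul_of_nonneg_left (hay _ _) (by positivity))

lemma measurable_feedback (t : ℤ) : Measurable fun y : ℤ → Fin N → Bool => feedback A y t :=
  Finset.measurable_fun_sum _ fun k _ => (measurable_mulVec (A k)).comp
    (measurable_boolVec.comp (measurable_pi_apply _))

lemma measurable_responsePart (hB : RootsOutsideUnitDisc B) : Measurable (responsePart B A) := by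
  have h1 : Measurable fun y : ℤ → Fin N → Bool => filterState B (feedback A y) 0 := by
    refine measurable_of_tendsto_metrizable (f := fun (n : ℕ) (y : ℤ → Fin N → Bool) =>
      ∑ k ∈ Finset.range n, impulse B k (feedback A y (0 - k))) (fun n => ?_) ?_
    · exact Finset.measurable_fun_sum _ fun k _ =>
        (measurable_impulse B k).comp (measurable_feedback A _)
    · rw [tendsto_pi_nhds]
      exact fun y => (summable_impulse_feedback A hB y 0).hasSum.tendsto_sum_nat
  exact (measurable_pi_apply 0).comp h1

lemma exists_norm_responsePart_le (hB : RootsOutsideUnitDisc B) :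
    ∃ R : ℝ, ∀ y, ‖responsePart B A y‖ ≤ R := by
  obtain ⟨K, r, hK, hr0, hr1, hKr⟩ := exists_norm_companion_pow_le hB
  obtain ⟨a, ha, hay⟩ := exists_norm_feedback_le A
  have hs : Summable fun n : ℕ => K * r ^ n * a :=
    ((summable_geometric_of_lt_one hr0.le hr1).mul_left K).mul_right a
  refine ⟨∑' n : ℕ, K * r ^ n * a, fun y => ?_⟩
  refine (norm_le_pi_norm _ 0).trans (tsum_of_norm_bounded hs.hasSum fun n => ?_)
  exact (norm_impulse_le B hKr n _).trans (mul_le_mul_of_nonneg_left (hay _ _) (by positivity))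

lemma responsePart_congr {y y' : ℤ → Fin N → Bool} (h : ∀ s < 0, y s = y' s) :
    responsePart B A y = responsePart B A y' := by
  have hf : ∀ n : ℕ, feedback A y (0 - n) = feedback A y' (0 - n) := fun n => by
    simp only [feedback]
    refine Finset.sum_congr rfl fun k _ => ?_
    rw [h _ (by omega)]
  simp only [responsePart, filterState, hf]

/-- The input at lag n looks back at most n + p steps, so it is the same for both paths if n + p ≤
l; what remains is a geometric tail. -/
lemma exists_norm_responsePart_sub_le (hB : RootsOutsideUnitDisc B) :
    ∃ D r : ℝ, 0 ≤ D ∧ 0 < r ∧ r < 1 ∧ ∀ y y' (l : ℕ), (∀ s : ℤ, -l ≤ s → s < 0 → y s = y' s) →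
      ‖responsePart B A y - responsePart B A y'‖ ≤ D * r ^ l := by
  obtain ⟨K, r, hK, hr0, hr1, hKr⟩ := exists_norm_companion_pow_le hB
  obtain ⟨a, ha, hay⟩ := exists_norm_feedback_le A
  -- With r = s², one factor sⁿ of rⁿ keeps the series summable; the other is at most s⁻ᵖ sˡ when n
  -- + p > l.
  set s := Real.sqrt r with hs
  have hs0 : 0 < s := Real.sqrt_pos.2 hr0
  have hs1 : s < 1 := by rw [hs, Real.sqrt_lt' one_pos]; simpa using hr1
  have hss : s * s = r := Real.mul_self_sqrt hr0.le
  have hgeo := summable_geometric_of_lt_one hs0.le hs1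
  refine ⟨∑' n : ℕ, K * s ^ n * (2 * a) * (s ^ p)⁻¹, s, tsum_nonneg fun n => by positivity, hs0, hs1,
    fun y y' l hl => ?_⟩
  have hsum : Summable fun n : ℕ => K * s ^ n * (2 * a) * (s ^ p)⁻¹ :=
    ((hgeo.mul_left K).mul_right _).mul_right _
  rw [← tsum_mul_right]
  simp only [responsePart, filterState]
  rw [← Pi.sub_apply, ← Summable.tsum_sub (summable_impulse_feedback A hB y 0)
    (summable_impulse_feedback A hB y' 0)]
  refine (norm_le_pi_norm _ 0).trans
    (tsum_of_norm_bounded (hsum.mul_right (s ^ l)).hasSum fun n => ?_)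
  rw [← map_sub]
  refine (norm_impulse_le B hKr n _).trans ?_
  rcases le_or_gt (n + p) l with hn | hn
  · have : feedback A y (0 - n) = feedback A y' (0 - n) := by
      simp only [feedback]
      refine Finset.sum_congr rfl fun k _ => ?_
      have hk := k.isLt
      rw [hl _ (by omega) (by omega)]
    rw [this, sub_self, norm_zero, mul_zero]
    positivity
  · have h1 : ‖feedback A y (0 - n) - feedback A y' (0 - n)‖ ≤ 2 * a := by
      refine (norm_sub_le _ _).trans ?_
      linarith [hay y (0 - n), hay y' (0 - n)]
    have h2 : s ^ n * s ^ p ≤ s ^ l := by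
      rw [← pow_add]; exact pow_le_pow_of_le_one hs0.le hs1.le hn.le
    have h3 : s ^ n ≤ (s ^ p)⁻¹ * s ^ l := by
      rw [inv_mul_eq_div, le_div_iff₀ (by positivity)]; exact h2
    calc K * r ^ n * ‖feedback A y (0 - n) - feedback A y' (0 - n)‖
        ≤ K * r ^ n * (2 * a) := mul_le_mul_of_nonneg_left h1 (by positivity)
      _ = K * s ^ n * (2 * a) * s ^ n := by rw [← hss, mul_pow]; ring
      _ ≤ K * s ^ n * (2 * a) * ((s ^ p)⁻¹ * s ^ l) :=
          mul_le_mul_of_nonneg_left h3 (by positivity)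
      _ = _ := by ring

end Filtering

/-! ### Convergence of the covariate series under a logarithmic moment -/

section LogMoment

variable {d : ℕ} {lam : Measure (ℤ → Fin d → ℝ)} [IsProbabilityMeasure lam]

/-- By stationarity and the logarithmic moment, the probabilities of log₊|X_{t-n}| > cn are
summable, so |X_{t-n}| ≤ exp(cn) eventually. With c = -(log r)/2 one has r = exp(-2c), and the terms
are at most exp(-cn). -/
lemma ae_summable_pow_mul_norm (hlam : MeasurePreserving shift lam lam)
    (hlog : Integrable (fun x : ℤ → Fin d → ℝ => Real.posLog ‖x 0‖) lam) {r : ℝ} (hr0 : 0 < r)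
    (hr1 : r < 1) : ∀ᵐ x ∂lam, ∀ t : ℤ, Summable fun n : ℕ => r ^ n * ‖x (t - n)‖ := by
  refine ae_all_iff.2 fun t => ?_
  set c := -Real.log r / 2 with hc
  have hlogr : Real.log r < 0 := Real.log_neg hr0 hr1
  have hc0 : 0 < c := by linarith
  set f : (ℤ → Fin d → ℝ) → ℝ := fun x => Real.posLog ‖x 0‖ / c with hf
  have hfm : Measurable f := by
    refine Measurable.div_const (Measurable.max measurable_const ?_) _
    exact Real.measurable_log.comp (measurable_norm.comp (measurable_pi_apply 0))
  have hsum : ∑' n : ℕ, lam {x | f (shiftBy (t - n) x) ∈ Set.Ioi (n : ℝ)} ≠ ∞ := by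
    have h1 : ∀ n : ℕ, lam {x | f (shiftBy (t - n) x) ∈ Set.Ioi (n : ℝ)}
        = lam {x | f x ∈ Set.Ioi (n : ℝ)} := fun n =>
      (measurePreserving_shiftBy hlam (t - n)).measure_preimage
        (hfm measurableSet_Ioi).nullMeasurableSet
    simp only [h1]
    let _ : MeasureSpace (ℤ → Fin d → ℝ) := ⟨lam⟩
    exact (tsum_prob_mem_Ioi_lt_top (X := f) (hlog.div_const c)
      fun x => div_nonneg Real.posLog_nonneg hc0.le).ne
  filter_upwards [ae_eventually_notMem hsum] with x hx
  have hgeo : Summable fun n : ℕ => Real.exp (-c) ^ n :=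
    summable_geometric_of_lt_one (Real.exp_pos _).le (by rw [Real.exp_lt_one_iff]; linarith)
  refine summable_of_isBigO_nat hgeo (Asymptotics.IsBigO.of_bound 1 ?_)
  filter_upwards [hx] with n hn
  simp only [Set.mem_Ioi, not_lt, hf, shiftBy_apply, zero_add] at hn
  rw [div_le_iff₀ hc0] at hn
  have h1 : ‖x (t - n)‖ ≤ Real.exp (n * c) := by
    rcases eq_or_lt_of_le (norm_nonneg (x (t - n))) with h0 | h0
    · rw [← h0]; positivity
    · rw [← Real.log_le_iff_le_exp h0]
      exact (le_max_right _ _).trans hn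
  rw [one_mul, Real.norm_of_nonneg (by positivity), Real.norm_of_nonneg (by positivity)]
  have h2 : r = Real.exp (-c) * Real.exp (-c) := by
    rw [← Real.exp_add, hc, show -(-Real.log r / 2) + -(-Real.log r / 2) = Real.log r by ring,
      Real.exp_log hr0]
  calc r ^ n * ‖x (t - n)‖ ≤ r ^ n * Real.exp (n * c) := by gcongr
    _ = Real.exp (-c) ^ n * (Real.exp (-c) ^ n * Real.exp (n * c)) := by
        conv_lhs => rw [h2, mul_pow]
        ring
    _ = Real.exp (-c) ^ n := by
        rw [← Real.exp_nat_mul, ← Real.exp_add]; simp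

lemma ae_summable_impulse {N q : ℕ} {B : Fin q → Matrix (Fin N) (Fin N) ℝ}
    (hB : RootsOutsideUnitDisc B) (Γ : Matrix (Fin N) (Fin d) ℝ)
    (hlam : MeasurePreserving shift lam lam)
    (hlog : Integrable (fun x : ℤ → Fin d → ℝ => Real.posLog ‖x 0‖) lam) :
    ∀ᵐ x ∂lam, ∀ t : ℤ, Summable fun n : ℕ => impulse B n (Γ.mulVec (x (t - n))) := by
  obtain ⟨K, r, hK, hr0, hr1, hKr⟩ := exists_norm_companion_pow_le hB
  filter_upwards [ae_summable_pow_mul_norm hlam hlog hr0 hr1] with x hx t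
  set G := (Matrix.toLin' Γ).toContinuousLinearMap
  refine Summable.of_norm_bounded ((hx t).mul_left (K * ‖G‖)) fun n => ?_
  refine (norm_impulse_le B hKr n _).trans ?_
  have h1 : ‖Γ.mulVec (x (t - n))‖ ≤ ‖G‖ * ‖x (t - n)‖ := G.le_opNorm _
  calc K * r ^ n * ‖Γ.mulVec (x (t - n))‖ ≤ K * r ^ n * (‖G‖ * ‖x (t - n)‖) := by gcongr
    _ = _ := by ring

end LogMoment

end DiscreteChoice

namespace DiscreteChoice

open Filter Topology ENNReal

/-! ### The discrete choice response map is contractive -/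

section Choice

variable {N : ℕ}

/-- The responses determined by the latent vector `c` and the noise `e`. -/
noncomputable def choose (c e : Fin N → ℝ) : Fin N → Bool := fun i => decide (0 < c i + e i)

lemma measurable_choose : Measurable fun p : (Fin N → ℝ) × (Fin N → ℝ) => choose p.1 p.2 := by
  refine measurable_pi_lambda _ fun i => ?_
  refine measurable_to_bool ?_
  have h1 : Measurable fun p : (Fin N → ℝ) × (Fin N → ℝ) => p.1 i + p.2 i := by fun_prop
  have : (fun p : (Fin N → ℝ) × (Fin N → ℝ) => choose p.1 p.2 i) ⁻¹' {true}
      = {p | 0 < p.1 i + p.2 i} := by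
    ext p; simp [choose]
  rw [this]
  exact measurableSet_lt measurable_const h1

lemma choose_eq_iff (c e : Fin N → ℝ) (b : Fin N → Bool) :
    choose c e = b ↔ e ∈ cell {i | b i = true} c := by
  simp only [cell, Set.mem_ofPred_eq, funext_iff, choose]
  constructor
  · intro h
    refine ⟨fun i hi => ?_, fun i hi => ?_⟩
    · have := (h i).trans hi
      rw [decide_eq_true_eq] at this
      linarith
    · have h1 := h i
      rw [Bool.not_eq_true] at hi
      rw [hi, decide_eq_false_iff_not] at h1
      linarith
  · rintro ⟨h1, h2⟩ i
    by_cases hi : b i = true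
    · rw [hi, decide_eq_true_eq]; linarith [h1 i hi]
    · have := h2 i hi
      rw [Bool.not_eq_true] at hi
      rw [hi, decide_eq_false_iff_not]; linarith

variable {ν : Measure (Fin N → ℝ)} [IsProbabilityMeasure ν]

/-- With the other coordinates capped at M, the strip is a difference of two orthants whose corners
differ by s' - s in one coordinate. The Lipschitz bound is uniform in M, and M tends to infinity. -/
lemma measure_strip_le {K : NNReal} (hK : LipschitzWith K (jointCdf ν)) (i : Fin N) {s s' : ℝ}
    (hss : s ≤ s') : ν.real {e | s < e i ∧ e i ≤ s'} ≤ K * (s' - s) := by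
  set D : ℕ → Set (Fin N → ℝ) := fun M => {e | (s < e i ∧ e i ≤ s') ∧ ∀ j, j ≠ i → e j ≤ M} with hD
  have hmono : Monotone D := fun M M' hM e he =>
    ⟨he.1, fun j hj => (he.2 j hj).trans (by exact_mod_cast hM)⟩
  have hunion : (⋃ M, D M) = {e | s < e i ∧ e i ≤ s'} := by
    ext e
    simp only [hD, Set.mem_iUnion, Set.mem_ofPred_eq]
    refine ⟨fun ⟨M, h⟩ => h.1, fun h => ?_⟩
    obtain ⟨M, hM⟩ := exists_nat_ge ‖e‖
    exact ⟨M, h, fun j _ => (le_abs_self _).trans ((norm_le_pi_norm e j).trans hM)⟩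
  have hle : ∀ M, ν.real (D M) ≤ K * (s' - s) := fun M => by
    have h1 : D M = Set.Iic (Function.update (fun _ => (M : ℝ)) i s')
        \ Set.Iic (Function.update (fun _ => (M : ℝ)) i s) := by
      ext e
      simp only [hD, Set.mem_ofPred_eq, Set.mem_sdiff, Set.mem_Iic, Pi.le_def]
      constructor
      · rintro ⟨⟨h1, h2⟩, h3⟩
        refine ⟨fun j => ?_, fun h => ?_⟩
        · by_cases hj : j = i
          · subst hj; simpa using h2
          · simpa [hj] using h3 j hj
        · have := h i; simp at this; linarith
      · rintro ⟨h1, h2⟩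
        have h3 : ∀ j, j ≠ i → e j ≤ M := fun j hj => by simpa [hj] using h1 j
        refine ⟨⟨?_, by simpa using h1 i⟩, h3⟩
        by_contra hcon
        refine h2 fun j => ?_
        by_cases hj : j = i
        · subst hj; simpa using not_lt.1 hcon
        · simpa [hj] using h3 j hj
    have hsub : Set.Iic (Function.update (fun _ => (M : ℝ)) i s)
        ⊆ Set.Iic (Function.update (fun _ => (M : ℝ)) i s') :=
      Set.Iic_subset_Iic.2 (update_le_update_iff.2 ⟨hss, fun _ _ => le_rfl⟩)
    rw [h1, measureReal_sdiff hsub measurableSet_Iic]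
    have h2 := hK.dist_le_mul (Function.update (fun _ => (M : ℝ)) i s')
      (Function.update (fun _ => (M : ℝ)) i s)
    have h3 : dist (Function.update (fun _ => (M : ℝ)) i s')
        (Function.update (fun _ => (M : ℝ)) i s) ≤ s' - s := by
      refine (dist_pi_le_iff (by linarith)).2 fun j => ?_
      by_cases hj : j = i
      · subst hj; simp [Real.dist_eq, abs_of_nonneg (sub_nonneg.2 hss)]
      · simp [hj, hss]
    exact (le_abs_self _).trans (h2.trans (mul_le_mul_of_nonneg_left h3 K.2))
  have h0 : 0 ≤ K * (s' - s) := mul_nonneg K.2 (by linarith)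
  rw [measureReal_def, ← hunion, hmono.measure_iUnion]
  refine ENNReal.toReal_le_of_le_ofReal h0 (iSup_le fun M => ?_)
  exact (ENNReal.le_ofReal_iff_toReal_le (measure_ne_top _ _) h0).2 (hle M)

/-- Choices can differ in coordinate i only if e_i lies between -c_i and -c'_i: a union of N strips.
-/
lemma measure_choose_ne_le {K : NNReal} (hK : LipschitzWith K (jointCdf ν)) (c c' : Fin N → ℝ) :
    ν.real {e | choose c e ≠ choose c' e} ≤ N * K * ‖c - c'‖ := by
  have hsub : {e | choose c e ≠ choose c' e} ⊆ ⋃ i ∈ (Finset.univ : Finset (Fin N)),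
      {e | min (-c i) (-c' i) < e i ∧ e i ≤ max (-c i) (-c' i)} := by
    intro e he
    obtain ⟨i, hi⟩ := Function.ne_iff.1 he
    refine Set.mem_iUnion₂.2 ⟨i, Finset.mem_univ i, ?_⟩
    simp only [choose, ne_eq, decide_eq_decide, Set.mem_ofPred_eq, min_lt_iff, le_max_iff] at hi ⊢
    by_cases h1 : 0 < c i + e i
    · have h2 : ¬ 0 < c' i + e i := fun h => hi ⟨fun _ => h, fun _ => h1⟩
      exact ⟨Or.inl (by linarith), Or.inr (by linarith)⟩
    · have h2 : 0 < c' i + e i := by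
        by_contra h; exact hi ⟨fun h' => absurd h' h1, fun h' => absurd h' h⟩
      exact ⟨Or.inr (by linarith), Or.inl (by linarith)⟩
  refine (measureReal_mono hsub (measure_ne_top _ _)).trans
    ((measureReal_biUnion_finset_le _ _).trans ?_)
  calc _ ≤ ∑ _i : Fin N, (K * ‖c - c'‖ : ℝ) := by
        refine Finset.sum_le_sum fun i _ => (measure_strip_le hK i min_le_max).trans ?_
        refine mul_le_mul_of_nonneg_left ?_ K.2
        rw [max_sub_min_eq_abs, show -c' i - -c i = (c - c') i by simp; ring]
        exact norm_le_pi_norm (c - c') i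
    _ = N * K * ‖c - c'‖ := by simp; ring

lemma measure_orthant_pos (hν : ν.support = Set.univ) (b : Fin N → ℝ) :
    0 < ν.real {e | ∀ i, b i < e i} := by
  have hopen : IsOpen {e : Fin N → ℝ | ∀ i, b i < e i} := by
    have : {e : Fin N → ℝ | ∀ i, b i < e i} = ⋂ i, {e | b i < e i} := by ext; simp
    rw [this]
    exact isOpen_iInter_of_finite fun i => isOpen_lt continuous_const (continuous_apply i)
  have hmem : (fun i => b i + 1) ∈ ν.support := hν ▸ Set.mem_univ _
  have := (Measure.mem_support_iff_forall _).1 hmem _ (hopen.mem_nhds (fun i => by simp))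
  exact ENNReal.toReal_pos this.ne' (measure_ne_top _ _)

variable {d p q : ℕ} (B : Fin q → Matrix (Fin N) (Fin N) ℝ)
  (A : Fin p → Matrix (Fin N) (Fin N) ℝ) (Γ : Matrix (Fin N) (Fin d) ℝ)

/-- The latent vector at time `0`. -/
noncomputable def latent (x : ℤ → Fin d → ℝ) (y : ℤ → Fin N → Bool) : Fin N → ℝ :=
  covariatePart B Γ x + responsePart B A y

/-- The response map of the discrete choice model. -/
noncomputable def choiceResponse (x : ℤ → Fin d → ℝ) (y : ℤ → Fin N → Bool) (e : Fin N → ℝ) :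
    Fin N → Bool := choose (latent B A Γ x y) e

variable {B}

lemma measurable_latent (hB : RootsOutsideUnitDisc B) :
    Measurable fun p : (ℤ → Fin d → ℝ) × (ℤ → Fin N → Bool) => latent B A Γ p.1 p.2 :=
  ((measurable_covariatePart B Γ).comp measurable_fst).add
    ((measurable_responsePart A hB).comp measurable_snd)

theorem exists_isContractive_choiceResponse (hB : RootsOutsideUnitDisc B)
    (hν : ν.support = Set.univ) (hL : ∃ K : NNReal, LipschitzWith K (jointCdf ν)) :
    ∃ β η, IsContractive ν (choiceResponse B A Γ) β η := by
  obtain ⟨K, hK⟩ := hL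
  obtain ⟨D, r, hD, hr0, hr1, hDr⟩ := exists_norm_responsePart_sub_le A hB
  obtain ⟨R, hR⟩ := exists_norm_responsePart_le A hB
  -- β combines the strip estimate with the geometric continuity of `responsePart`. η is the mass of
  -- the noises so large that, `responsePart` being bounded by `R`, every response is 1 whatever the
  -- past.
  refine ⟨fun l => N * K * (D * r ^ l), fun x => ν.real {e | ∀ i, R - covariatePart B Γ x i < e i},
    ?_, ?_, ?_, ?_, ?_, ?_, ?_⟩
  · exact measurable_choose.comp (((measurable_latent A Γ hB).comp
      (measurable_fst.prodMk (measurable_fst.comp measurable_snd))).prodMk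
      (measurable_snd.comp measurable_snd))
  · intro x y y' e h
    simp only [choiceResponse, latent, responsePart_congr A h]
  · intro x y y' l h
    refine (measure_choose_ne_le hK _ _).trans ?_
    simp only [latent, add_sub_add_left_eq_sub]
    exact mul_le_mul_of_nonneg_left (hDr y y' l h) (by positivity)
  · intro x y y'
    have hm : MeasurableSet {e : Fin N → ℝ | ∀ i, R - covariatePart B Γ x i < e i} := by
      have : {e : Fin N → ℝ | ∀ i, R - covariatePart B Γ x i < e i}
          = ⋂ i, {e | R - covariatePart B Γ x i < e i} := by ext; simp
      rw [this]
      exact MeasurableSet.iInter fun i => measurableSet_lt measurable_const (measurable_pi_apply i)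
    rw [← probReal_compl_eq_one_sub hm]
    refine measureReal_mono fun e he hcon => he ?_
    have hall : ∀ y, choiceResponse B A Γ x y e = fun _ => true := fun y => by
      funext i
      have h1 := hcon i
      have h2 : |responsePart B A y i| ≤ R := (norm_le_pi_norm _ i).trans (hR y)
      have h3 := (abs_le.1 h2).1
      refine decide_eq_true ?_
      simp only [latent, Pi.add_apply]
      linarith
    rw [hall y, hall y']
  · exact ((summable_geometric_of_lt_one hr0.le hr1).mul_left D).mul_left _
  · have hm : MeasurableSet {p : (ℤ → Fin d → ℝ) × (Fin N → ℝ) |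
        ∀ i, R - covariatePart B Γ p.1 i < p.2 i} := by
      have : {p : (ℤ → Fin d → ℝ) × (Fin N → ℝ) | ∀ i, R - covariatePart B Γ p.1 i < p.2 i}
          = ⋂ i, {p | R - covariatePart B Γ p.1 i < p.2 i} := by ext; simp
      rw [this]
      have hz : ∀ i, Measurable fun x => covariatePart B Γ x i := fun i =>
        (measurable_pi_apply i).comp (measurable_covariatePart B Γ)
      exact MeasurableSet.iInter fun i => measurableSet_lt
        (measurable_const.sub ((hz i).comp measurable_fst))
        ((measurable_pi_apply i).comp measurable_snd)
    exact (measurable_measure_prodMk_left hm).ennreal_toReal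
  · exact fun x => measure_orthant_pos hν _

end Choice

end DiscreteChoice

namespace DiscreteChoice

open Filter Topology ENNReal

/-! ### Binary vectors, conditional laws and the total input -/

section Sign

variable {N : ℕ}

/-- The signs of the coordinates of a vector. -/
noncomputable def signVec (v : Fin N → ℝ) : Fin N → Bool := fun i => decide (0 < v i)

lemma measurable_signVec : Measurable (signVec : (Fin N → ℝ) → Fin N → Bool) := by
  refine measurable_pi_lambda _ fun i => measurable_to_bool ?_
  have : (fun v : Fin N → ℝ => signVec v i) ⁻¹' {true} = {v | 0 < v i} := by
    ext v; simp [signVec]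
  rw [this]
  exact measurableSet_lt measurable_const (measurable_pi_apply i)

lemma signVec_boolVec (c : Fin N → Bool) : signVec (boolVec c) = c := by
  funext i
  cases h : c i <;> simp [signVec, boolVec, h]

lemma boolVec_injective : Function.Injective (boolVec : (Fin N → Bool) → Fin N → ℝ) :=
  Function.LeftInverse.injective signVec_boolVec

lemma sum_measure_cell (ν : Measure (Fin N → ℝ)) [IsProbabilityMeasure ν] (c : Fin N → ℝ) :
    ∑ b : Fin N → Bool, ν.real (cell {i | b i = true} c) = 1 := by
  have hm : ∀ b : Fin N → Bool, MeasurableSet {e | choose c e = b} := fun b =>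
    (measurable_choose.comp (measurable_const.prodMk measurable_id)) (measurableSet_singleton b)
  have h1 : ∀ b : Fin N → Bool, cell {i | b i = true} c = {e | choose c e = b} := fun b => by
    ext e; exact (choose_eq_iff c e b).symm
  simp only [h1]
  rw [← measureReal_biUnion_finset (fun b _ b' _ hbb => Set.disjoint_left.2 fun e he he' =>
    hbb (he.symm.trans he')) (fun b _ => hm b)]
  have : (⋃ b ∈ (Finset.univ : Finset (Fin N → Bool)), {e | choose c e = b}) = Set.univ := by
    ext e; simp
  rw [this]; simp

end Sign

section ExtCountable

variable {S C : Type*} [MeasurableSpace S] [MeasurableSpace C] [Countable C]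
  [DiscreteMeasurableSpace C]

lemma measure_ext_prod_singleton {κ ρ : Measure (S × C)} [IsFiniteMeasure κ]
    (h : ∀ D : Set S, MeasurableSet D → ∀ c : C, κ (D ×ˢ {c}) = ρ (D ×ˢ {c})) : κ = ρ := by
  refine Measure.ext_prod fun {D B} hD hB => ?_
  have h1 : D ×ˢ B = ⋃ c ∈ B, D ×ˢ ({c} : Set C) := by
    ext p; simp
  have h2 : B.PairwiseDisjoint fun c => D ×ˢ ({c} : Set C) := fun c _ c' _ hcc =>
    Set.disjoint_left.2 fun p hp hp' => hcc (hp.2.symm.trans hp'.2)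
  rw [h1, measure_biUnion B.to_countable h2 fun c _ => hD.prod (measurableSet_singleton c),
    measure_biUnion B.to_countable h2 fun c _ => hD.prod (measurableSet_singleton c)]
  exact tsum_congr fun c => h D hD c

end ExtCountable

section Input

variable {N d p q : ℕ} {B : Fin q → Matrix (Fin N) (Fin N) ℝ}
  (A : Fin p → Matrix (Fin N) (Fin N) ℝ) {Γ : Matrix (Fin N) (Fin d) ℝ}
  {x : ℤ → Fin d → ℝ} {y : ℤ → Fin N → Bool} {t : ℤ}

variable (Γ) in
/-- The total input of the latent recursion. -/
noncomputable def input (x : ℤ → Fin d → ℝ) (y : ℤ → Fin N → Bool) (t : ℤ) : Fin N → ℝ :=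
  feedback A y t + Γ.mulVec (x t)

lemma summable_impulse_input (hB : RootsOutsideUnitDisc B)
    (hx : Summable fun n : ℕ => impulse B n (Γ.mulVec (x (t - n)))) :
    Summable fun n : ℕ => impulse B n (input A Γ x y (t - n)) := by
  simp only [input, map_add]
  exact (summable_impulse_feedback A hB y t).add hx

lemma latent_shiftBy (hB : RootsOutsideUnitDisc B)
    (hx : Summable fun n : ℕ => impulse B n (Γ.mulVec (x (t - n)))) :
    latent B A Γ (shiftBy t x) (shiftBy t y) = filterState B (input A Γ x y) t 0 := by
  have h : filterState B (input A Γ x y) t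
      = filterState B (feedback A y) t + filterState B (fun s => Γ.mulVec (x s)) t := by
    simp only [filterState, input, map_add]
    exact (summable_impulse_feedback A hB y t).tsum_add hx
  rw [latent, covariatePart_shiftBy hx, responsePart_shiftBy, h, Pi.add_apply, add_comm]

/-- Unrolling the recursion n times writes the state as the homogeneous term plus a partial sum of
the filter, so convergence of the sums forces that of the homogeneous term. -/
lemma tendsto_companion_pow {m w : ℤ → Fin N → ℝ}
    (hm : ∀ t, m t = ∑ j : Fin q, (B j).mulVec (m (t - ((j : ℕ) + 1))) + w t)
    (hw : Summable fun n : ℕ => impulse B n (w (t - n))) :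
    Tendsto (fun n : ℕ => (companion B ^ n) (fun j : Fin (q + 1) => m (t - n - (j : ℕ)))) atTop
      (𝓝 ((fun j : Fin (q + 1) => m (t - (j : ℕ))) - filterState B w t)) := by
  have h1 : ∀ n : ℕ, (companion B ^ n) (fun j : Fin (q + 1) => m (t - n - (j : ℕ)))
      = (fun j : Fin (q + 1) => m (t - (j : ℕ)))
        - ∑ k ∈ Finset.range n, impulse B k (w (t - k)) := fun n =>
    eq_sub_of_add_eq (state_unroll (s := fun t (j : Fin (q + 1)) => m (t - (j : ℕ)))
      (state_of_recursion hm) t n).symm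
  simp only [h1]
  exact tendsto_const_nhds.sub hw.hasSum.tendsto_sum_nat

end Input

section Section

variable {Ω S C E : Type*} [MeasurableSpace Ω] [MeasurableSpace S] [MeasurableSpace E]
  [MeasurableSpace C] [Countable C] [DiscreteMeasurableSpace C] {P : Measure Ω}
  [IsProbabilityMeasure P] {ν : Measure E} [IsProbabilityMeasure ν]

/-- As `C` is countable, the integrated conditional probabilities of singletons determine the joint
law. -/
lemma map_prodMk_eq_of_section {g : Ω → S} {Z : Ω → C} {ψ : S × E → C} (hg : Measurable g)
    (hZ : Measurable Z) (hψ : Measurable ψ)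
    (h : ∀ D, MeasurableSet D → ∀ c, P.real (g ⁻¹' D ∩ Z ⁻¹' {c})
      = ∫ ω in g ⁻¹' D, ν.real {e | ψ (g ω, e) = c} ∂P) :
    P.map (fun ω => (g ω, Z ω)) = (P.prod ν).map fun z => (g z.1, ψ (g z.1, z.2)) := by
  have hg3 : Measurable fun z : Ω × E => (g z.1, ψ (g z.1, z.2)) :=
    (hg.comp measurable_fst).prodMk (hψ.comp ((hg.comp measurable_fst).prodMk measurable_snd))
  have : IsProbabilityMeasure (P.map fun ω => (g ω, Z ω)) :=
    Measure.isProbabilityMeasure_map (hg.prodMk hZ).aemeasurable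
  refine measure_ext_prod_singleton fun D hD b => ?_
  have hDb : MeasurableSet (D ×ˢ ({b} : Set C)) := hD.prod (measurableSet_singleton b)
  rw [Measure.map_apply (hg.prodMk hZ) hDb, Measure.map_apply hg3 hDb, Measure.prod_apply (hg3 hDb)]
  have h1 : (fun ω => (g ω, Z ω)) ⁻¹' (D ×ˢ {b}) = g ⁻¹' D ∩ Z ⁻¹' {b} := rfl
  have hsec : Measurable fun ω => ν {e | ψ (g ω, e) = b} :=
    (measurable_measure_prodMk_left (hψ (measurableSet_singleton b))).comp hg
  rw [h1, ← ENNReal.ofReal_toReal (measure_ne_top P (g ⁻¹' D ∩ Z ⁻¹' {b}))]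
  change ENNReal.ofReal (P.real _) = _
  rw [h D hD b]
  simp only [measureReal_def]
  rw [integral_toReal hsec.aemeasurable (.of_forall fun _ => measure_lt_top _ _),
    ENNReal.ofReal_toReal, ← lintegral_indicator (hg hD)]
  · refine lintegral_congr fun ω => ?_
    by_cases hω : g ω ∈ D
    · rw [Set.indicator_of_mem (show ω ∈ g ⁻¹' D from hω)]
      congr 1
      ext e
      simp [hω]
    · rw [Set.indicator_of_notMem (show ω ∉ g ⁻¹' D from hω)]
      symm
      convert measure_empty (μ := ν)
      ext e
      simp [hω]
  · refine ne_top_of_le_ne_top one_ne_top ((lintegral_mono fun ω => prob_le_one).trans ?_)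
    rw [lintegral_one, Measure.restrict_apply_univ]
    exact prob_le_one

end Section

section Past

variable {Ω α β : Type*} [mα : MeasurableSpace α] [mβ : MeasurableSpace β]
  {Y : ℤ → Ω → α} {X : ℤ → Ω → β} {t : ℤ}

lemma measurable_past_response {s : ℤ} (hs : s < t) :
    Measurable[pastAndCovariates Y X t] (Y s) :=
  (comap_measurable (Y s)).mono
    ((le_iSup (fun s : Set.Iio t => mα.comap (Y s)) ⟨s, hs⟩).trans le_sup_left) le_rfl

lemma measurable_past_covariate (s : ℤ) : Measurable[pastAndCovariates Y X t] (X s) :=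
  (comap_measurable (X s)).mono
    ((le_iSup (fun s : ℤ => mβ.comap (X s)) s).trans le_sup_right) le_rfl

lemma pastAndCovariates_le [mΩ : MeasurableSpace Ω] (hY : ∀ s, Measurable (Y s))
    (hX : ∀ s, Measurable (X s)) : pastAndCovariates Y X t ≤ mΩ :=
  sup_le (iSup_le fun s => (hY s).comap_le) (iSup_le fun s => (hX s).comap_le)

lemma measurable_prodMk_mask [MeasurableSpace Ω] {C : Type*} [MeasurableSpace C] [Inhabited C]
    {S : ℤ → Ω → C} (hX : ∀ s, Measurable (X s)) (hS : ∀ s < t, Measurable (S s)) :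
    Measurable fun ω => ((fun s => X s ω), mask t fun s => S s ω) := by
  refine (measurable_pi_lambda _ hX).prodMk (measurable_pi_lambda _ fun s => ?_)
  simp only [mask]
  split_ifs with hs
  · exact hS s hs
  · exact measurable_const

lemma measurable_past_prodMk_mask {C : Type*} [MeasurableSpace C] [Inhabited C] {f : α → C}
    (hf : Measurable f) : Measurable[pastAndCovariates Y X t]
      fun ω => ((fun s => X s ω), mask t fun s => f (Y s ω)) :=
  @measurable_prodMk_mask _ _ _ X t (pastAndCovariates Y X t) _ _ _ _
    (fun s => measurable_past_covariate s) fun _ hs => hf.comp (measurable_past_response hs)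

end Past

/-! ### Structure of an arbitrary stationary solution -/

namespace IsStationarySolution

variable {N d p q : ℕ} {Ω : Type*} [MeasurableSpace Ω] {ν : Measure (Fin N → ℝ)}
  [IsProbabilityMeasure ν]
  {B : Fin q → Matrix (Fin N) (Fin N) ℝ} {A : Fin p → Matrix (Fin N) (Fin N) ℝ}
  {Γ : Matrix (Fin N) (Fin d) ℝ} {P : Measure Ω} [IsProbabilityMeasure P]
  {X : ℤ → Ω → (Fin d → ℝ)} {Y μ : ℤ → Ω → (Fin N → ℝ)}

omit [IsProbabilityMeasure ν] in
lemma measure_inter_eq (h : IsStationarySolution ν B A Γ P X Y μ) (t : ℤ) (b : Fin N → Bool)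
    {D : Set Ω} (hD : MeasurableSet[pastAndCovariates Y X t] D) :
    P.real (D ∩ Y t ⁻¹' {boolVec b}) = ∫ ω in D, ν.real (cell {i | b i = true} (μ t ω)) ∂P := by
  have hle := pastAndCovariates_le (t := t) h.measurable_Y h.measurable_X
  have hs : MeasurableSet (Y t ⁻¹' {boolVec b}) := h.measurable_Y t (measurableSet_singleton _)
  have h1 := h.condLaw t {i | b i = true}
  rw [← boolVec_eq_indicatorVec] at h1
  have h2 := setIntegral_condExp hle (f := (Y t ⁻¹' {boolVec b}).indicator fun _ => (1 : ℝ))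
    ((integrable_const (1 : ℝ)).indicator hs : Integrable _ P) hD
  rw [setIntegral_congr_ae (hle D hD) (h1.mono fun ω hω _ => hω)] at h2
  rw [h2, integral_indicator hs, integral_const, smul_eq_mul, mul_one, measureReal_restrict_apply_univ,
    measureReal_restrict_apply hs, Set.inter_comm]

/-- The cells partition the noise space, so the prescribed conditional probabilities add up to 1 and
leave no mass for values other than binary vectors. -/
lemma ae_eq_boolVec (h : IsStationarySolution ν B A Γ P X Y μ) (t : ℤ) :
    ∀ᵐ ω ∂P, Y t ω = boolVec (signVec (Y t ω)) := by
  have hs : ∀ b : Fin N → Bool, MeasurableSet (Y t ⁻¹' {boolVec b}) := fun b =>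
    h.measurable_Y t (measurableSet_singleton _)
  have hμm : ∀ b : Fin N → Bool, Measurable fun ω => ν.real (cell {i | b i = true} (μ t ω)) := by
    intro b
    have h1 : MeasurableSet {p : (Fin N → ℝ) × (Fin N → ℝ) | choose p.1 p.2 = b} :=
      measurable_choose (measurableSet_singleton b)
    have h2 : (fun ω => ν.real (cell {i | b i = true} (μ t ω)))
        = fun ω => (ν (Prod.mk (μ t ω) ⁻¹' {p | choose p.1 p.2 = b})).toReal := by
      funext ω
      congr 2
      ext e
      exact (choose_eq_iff _ e b).symm
    rw [h2]
    exact ((measurable_measure_prodMk_left h1).comp (h.measurable_μ t)).ennreal_toReal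
  have hsum : P.real (⋃ b ∈ (Finset.univ : Finset (Fin N → Bool)), Y t ⁻¹' {boolVec b}) = 1 := by
    have hdisj : Set.PairwiseDisjoint (↑(Finset.univ : Finset (Fin N → Bool)))
        fun b => Y t ⁻¹' {boolVec b} := fun b _ b' _ hbb => Set.disjoint_left.2 fun ω hω hω' =>
      hbb (boolVec_injective (Eq.trans (Eq.symm hω) hω'))
    rw [measureReal_biUnion_finset hdisj fun b _ => hs b]
    have h1 : ∀ b, P.real (Y t ⁻¹' {boolVec b}) = ∫ ω, ν.real (cell {i | b i = true} (μ t ω)) ∂P :=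
      fun b => by
        have := h.measure_inter_eq t b (D := Set.univ) (@MeasurableSet.univ _ _)
        rwa [Set.univ_inter, setIntegral_univ] at this
    simp only [h1]
    rw [← integral_finsetSum]
    · simp only [sum_measure_cell]; simp
    · intro b _
      refine Integrable.of_bound (hμm b).aestronglyMeasurable 1 (.of_forall fun ω => ?_)
      rw [Real.norm_of_nonneg measureReal_nonneg]; exact measureReal_le_one
  have hms : MeasurableSet (⋃ b ∈ (Finset.univ : Finset (Fin N → Bool)), Y t ⁻¹' {boolVec b}) :=
    Finset.measurableSet_biUnion _ fun b _ => hs b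
  have hae : P (⋃ b ∈ (Finset.univ : Finset (Fin N → Bool)), Y t ⁻¹' {boolVec b})ᶜ = 0 := by
    have := probReal_compl_eq_one_sub (μ := P) hms
    rw [hsum, sub_self] at this
    exact (measureReal_eq_zero_iff (measure_ne_top _ _)).1 this
  filter_upwards [compl_mem_ae_iff.2 hae] with ω hω
  simp only [compl_compl, Set.mem_iUnion, Finset.mem_univ, Set.mem_preimage,
    Set.mem_singleton_iff, exists_const] at hω
  obtain ⟨b, hb⟩ := hω
  rw [hb, signVec_boolVec]

omit [IsProbabilityMeasure ν] in
-- By stationarity the law of the state at time t - n does not depend on n, so its norm times K rⁿ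
-- tends to 0 in probability; no moment of μ is needed.
lemma tendstoInMeasure_companion (h : IsStationarySolution ν B A Γ P X Y μ)
    (hB : RootsOutsideUnitDisc B) (t : ℤ) :
    TendstoInMeasure P (fun (n : ℕ) ω =>
      (companion B ^ n) (fun j : Fin (q + 1) => μ (t - n - (j : ℕ)) ω)) atTop (fun _ => 0) := by
  obtain ⟨K, r, hK, hr0, hr1, hKr⟩ := exists_norm_companion_pow_le hB
  have hstat := measurePreserving_shiftBy h.stationary
  set S : (ℤ → (Fin N → ℝ) × (Fin N → ℝ)) → Fin (q + 1) → Fin N → ℝ :=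
    fun z j => (z (-(j : ℕ))).2 with hS
  have hSm : Measurable S := measurable_pi_lambda _ fun j =>
    measurable_snd.comp (measurable_pi_apply _)
  have hpath : Measurable fun ω t => (Y t ω, μ t ω) := measurable_pi_lambda _ fun t =>
    (h.measurable_Y t).prodMk (h.measurable_μ t)
  have hzero : TendstoInMeasure P (fun (n : ℕ) ω => K * r ^ n * ‖S fun t => (Y t ω, μ t ω)‖)
      atTop (fun _ => 0) := by
    refine tendstoInMeasure_of_tendsto_ae (fun n => ?_) (.of_forall fun ω => ?_)
    · exact ((measurable_norm.comp (hSm.comp hpath)).const_mul _).aestronglyMeasurable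
    · have := ((tendsto_pow_atTop_nhds_zero_of_lt_one hr0.le hr1).const_mul K).mul_const
        ‖S fun t => (Y t ω, μ t ω)‖
      simpa using this
  rw [tendstoInMeasure_iff_norm] at hzero ⊢
  intro ε hε
  refine tendsto_of_tendsto_of_tendsto_of_le_of_le tendsto_const_nhds (hzero ε hε)
    (fun _ => zero_le) fun n => ?_
  have hD : MeasurableSet {z | ε ≤ K * r ^ n * ‖S z‖} :=
    measurableSet_le measurable_const ((measurable_norm.comp hSm).const_mul _)
  have hshift := (hstat (t - n)).measure_preimage hD.nullMeasurableSet
  simp only [processLaw] at hshift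
  rw [Measure.map_apply hpath (measurable_shiftBy _ hD), Measure.map_apply hpath hD] at hshift
  calc _ ≤ P ((fun ω t => (Y t ω, μ t ω)) ⁻¹' (shiftBy (t - n) ⁻¹' {z | ε ≤ K * r ^ n * ‖S z‖})) := by
        refine measure_mono fun ω hω => ?_
        simp only [sub_zero, Set.mem_ofPred_eq] at hω
        have h1 := hω.trans (hKr n _)
        have h2 : S (shiftBy (t - n) fun t => (Y t ω, μ t ω))
            = fun j : Fin (q + 1) => μ (t - n - (j : ℕ)) ω := by
          funext j
          simp only [hS, shiftBy_apply]
          congr 1; ring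
        change ε ≤ K * r ^ n * ‖S (shiftBy (t - n) fun t => (Y t ω, μ t ω))‖
        rwa [h2]
    _ = _ := hshift
    _ ≤ _ := by
        refine measure_mono fun ω hω => ?_
        have h1 : ε ≤ K * r ^ n * ‖S fun t => (Y t ω, μ t ω)‖ := hω
        simp only [sub_zero, Set.mem_ofPred_eq]
        exact h1.trans (le_abs_self _)

omit [IsProbabilityMeasure ν] [IsProbabilityMeasure P] in
lemma ae_summable (h : IsStationarySolution ν B A Γ P X Y μ) (hB : RootsOutsideUnitDisc B)
    {lam : Measure (ℤ → Fin d → ℝ)} [IsProbabilityMeasure lam] (hX : processLaw P X = lam)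
    (hlam : MeasurePreserving shift lam lam)
    (hlog : Integrable (fun x : ℤ → Fin d → ℝ => Real.posLog ‖x 0‖) lam) :
    ∀ᵐ ω ∂P, ∀ t : ℤ, Summable fun n : ℕ => impulse B n (Γ.mulVec (X (t - n) ω)) := by
  have hXm : Measurable fun ω t => X t ω := measurable_pi_lambda _ h.measurable_X
  have := ae_summable_impulse hB Γ hlam hlog
  rw [← hX, processLaw] at this
  exact ae_of_ae_map hXm.aemeasurable this

/-- The homogeneous term converges almost surely to the difference between the state and the filter,
and in probability to 0; the two limits coincide. -/
lemma ae_eq_latent (h : IsStationarySolution ν B A Γ P X Y μ) (hB : RootsOutsideUnitDisc B)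
    {lam : Measure (ℤ → Fin d → ℝ)} [IsProbabilityMeasure lam] (hX : processLaw P X = lam)
    (hlam : MeasurePreserving shift lam lam)
    (hlog : Integrable (fun x : ℤ → Fin d → ℝ => Real.posLog ‖x 0‖) lam) (t : ℤ) :
    ∀ᵐ ω ∂P, μ t ω = latent B A Γ (shiftBy t fun s => X s ω)
      (shiftBy t fun s => signVec (Y s ω)) := by
  have hsum := h.ae_summable hB hX hlam hlog
  have hlim : ∀ᵐ ω ∂P, Tendsto (fun n : ℕ =>
      (companion B ^ n) (fun j : Fin (q + 1) => μ (t - n - (j : ℕ)) ω)) atTop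
      (𝓝 ((fun j : Fin (q + 1) => μ (t - (j : ℕ)) ω)
        - filterState B (input A Γ (fun s => X s ω) fun s => signVec (Y s ω)) t)) := by
    filter_upwards [ae_all_iff.2 h.recursion, ae_all_iff.2 h.ae_eq_boolVec, hsum] with ω h1 h2 h3
    refine tendsto_companion_pow (m := fun s => μ s ω) (fun t => ?_)
      (summable_impulse_input (x := fun s => X s ω) A hB (h3 t))
    rw [h1 t, add_assoc]
    simp only [input, feedback, ← h2]
  have hmeas : ∀ n : ℕ, AEStronglyMeasurable (fun ω =>
      (companion B ^ n) (fun j : Fin (q + 1) => μ (t - n - (j : ℕ)) ω)) P := fun n =>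
    ((companion B ^ n).toContinuousLinearMap.continuous.measurable.comp
      (measurable_pi_lambda _ fun j => h.measurable_μ _)).aestronglyMeasurable
  have hzero := tendstoInMeasure_ae_unique (tendstoInMeasure_of_tendsto_ae hmeas hlim)
    (h.tendstoInMeasure_companion hB t)
  filter_upwards [hzero, hsum] with ω h1 h2
  rw [latent_shiftBy (x := fun s => X s ω) A hB (h2 t)]
  have h3 := congrFun h1 0
  simpa [sub_eq_zero] using h3

lemma mask_succ {C : Type*} [Inhabited C] (t : ℤ) (y : ℤ → C) :
    mask (t + 1) y = Function.update (mask t y) t (y t) := by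
  ext s
  by_cases hs : s = t
  · subst hs; simp [mask]
  · rw [Function.update_of_ne hs]
    simp only [mask]
    exact if_congr (by omega) rfl rfl

end IsStationarySolution

end DiscreteChoice

namespace DiscreteChoice

open Filter Topology ENNReal

namespace IsStationarySolution

variable {N d p q : ℕ} {Ω : Type*} [MeasurableSpace Ω] {ν : Measure (Fin N → ℝ)}
  [IsProbabilityMeasure ν]
  {B : Fin q → Matrix (Fin N) (Fin N) ℝ} {A : Fin p → Matrix (Fin N) (Fin N) ℝ}
  {Γ : Matrix (Fin N) (Fin d) ℝ} {P : Measure Ω} [IsProbabilityMeasure P]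
  {X : ℤ → Ω → (Fin d → ℝ)} {Y μ : ℤ → Ω → (Fin N → ℝ)}

/-- By `ae_eq_latent`, μ_t is a function of the covariates and of the past responses, so the
conditional law given these is exactly one step of `choiceResponse` with fresh noise. -/
theorem hasResponseLaw (h : IsStationarySolution ν B A Γ P X Y μ) (hB : RootsOutsideUnitDisc B)
    {lam : Measure (ℤ → Fin d → ℝ)} [IsProbabilityMeasure lam] (hX : processLaw P X = lam)
    (hlam : MeasurePreserving shift lam lam)
    (hlog : Integrable (fun x : ℤ → Fin d → ℝ => Real.posLog ‖x 0‖) lam) :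
    HasResponseLaw ν (choiceResponse B A Γ)
      (P.map fun ω => ((fun s => X s ω), fun s => signVec (Y s ω))) := by
  intro t
  have hXm : Measurable fun ω t => X t ω := measurable_pi_lambda _ h.measurable_X
  have hSm : Measurable fun ω s => signVec (Y s ω) := measurable_pi_lambda _ fun s =>
    measurable_signVec.comp (h.measurable_Y s)
  have hRm := hXm.prodMk hSm
  have hmask : ∀ t : ℤ, Measurable fun p : (ℤ → Fin d → ℝ) × (ℤ → Fin N → Bool) =>
      (p.1, mask t p.2) := fun t =>
    measurable_fst.prodMk ((IsContractive.measurable_mask t).comp measurable_snd)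
  have hΦ : Measurable fun z : ((ℤ → Fin d → ℝ) × (ℤ → Fin N → Bool)) × (Fin N → ℝ) =>
      choose (latent B A Γ (shiftBy t z.1.1) (shiftBy t z.1.2)) z.2 :=
    measurable_choose.comp (((measurable_latent A Γ hB).comp
      (by fun_prop : Measurable fun z : ((ℤ → Fin d → ℝ) × (ℤ → Fin N → Bool)) × (Fin N → ℝ) =>
        (shiftBy t z.1.1, shiftBy t z.1.2))).prodMk measurable_snd)
  set g : Ω → (ℤ → Fin d → ℝ) × (ℤ → Fin N → Bool) := fun ω =>
    ((fun s => X s ω), mask t fun s => signVec (Y s ω)) with hg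
  have hgm : Measurable g := (hmask t).comp hRm
  have hgpast : Measurable[pastAndCovariates Y X t] g :=
    measurable_past_prodMk_mask (Y := Y) (X := X) (t := t) (f := signVec) measurable_signVec
  have hg2 : Measurable fun ω => (g ω, signVec (Y t ω)) :=
    hgm.prodMk (measurable_signVec.comp (h.measurable_Y t))
  have hg3 : Measurable fun z : Ω × (Fin N → ℝ) => (g z.1,
      choose (latent B A Γ (shiftBy t (g z.1).1) (shiftBy t (g z.1).2)) z.2) := by
    have h1 : Measurable fun z : Ω × (Fin N → ℝ) => (g z.1, z.2) :=
      (hgm.comp measurable_fst).prodMk measurable_snd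
    have h2 := hΦ.comp h1
    exact (hgm.comp measurable_fst).prodMk h2
  have hcore : P.map (fun ω => (g ω, signVec (Y t ω))) = (P.prod ν).map (fun z => (g z.1,
      choose (latent B A Γ (shiftBy t (g z.1).1) (shiftBy t (g z.1).2)) z.2)) := by
    refine map_prodMk_eq_of_section (ψ := fun z : ((ℤ → Fin d → ℝ) × (ℤ → Fin N → Bool)) ×
        (Fin N → ℝ) => choose (latent B A Γ (shiftBy t z.1.1) (shiftBy t z.1.2)) z.2)
      hgm (measurable_signVec.comp (h.measurable_Y t)) hΦ fun D hD b => ?_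
    have h1 : P.real (g ⁻¹' D ∩ (fun ω => signVec (Y t ω)) ⁻¹' {b})
        = P.real (g ⁻¹' D ∩ Y t ⁻¹' {boolVec b}) := by
      refine measureReal_congr ?_
      filter_upwards [h.ae_eq_boolVec t] with ω hω
      refine propext (and_congr_right fun _ => ?_)
      change signVec (Y t ω) = b ↔ Y t ω = boolVec b
      exact ⟨fun hh => by rw [hω, hh], fun hh => by rw [hh, signVec_boolVec]⟩
    change P.real (g ⁻¹' D ∩ (fun ω => signVec (Y t ω)) ⁻¹' {b}) = _
    rw [h1, h.measure_inter_eq t b (hgpast hD)]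
    refine setIntegral_congr_ae (hgm hD) ?_
    filter_upwards [h.ae_eq_latent hB hX hlam hlog t] with ω hω _
    -- The latent vector uses only responses strictly before t, which the mask keeps.
    have h4 : latent B A Γ (shiftBy t (g ω).1) (shiftBy t (g ω).2) = μ t ω := by
      rw [hω, latent, latent]
      refine congrArg _ (responsePart_congr A fun s hs => ?_)
      simp only [hg, shiftBy_apply, mask]
      rw [if_pos (by omega)]
    simp only [h4, choose_eq_iff, Set.ofPred_mem_eq]
  set J : ((ℤ → Fin d → ℝ) × (ℤ → Fin N → Bool)) × (Fin N → Bool) →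
      (ℤ → Fin d → ℝ) × (ℤ → Fin N → Bool) := fun z => (z.1.1, Function.update z.1.2 t z.2) with hJ
  have hJm : Measurable J := (measurable_fst.comp measurable_fst).prodMk
    (IsContractive.measurable_update (measurable_snd.comp measurable_fst) t measurable_snd)
  have hL : (P.map fun ω => ((fun s => X s ω), fun s => signVec (Y s ω))).map
      (fun p => (p.1, mask (t + 1) p.2)) = (P.map fun ω => (g ω, signVec (Y t ω))).map J := by
    rw [Measure.map_map (hmask _) hRm, Measure.map_map hJm hg2]
    congr 1
    funext ω
    simp only [Function.comp, hJ, hg, mask_succ]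
  have hν : (P.map fun ω => ((fun s => X s ω), fun s => signVec (Y s ω))).prod ν
      = (P.prod ν).map (Prod.map (fun ω => ((fun s => X s ω), fun s => signVec (Y s ω))) id) := by
    rw [← Measure.map_prod_map _ _ hRm measurable_id, Measure.map_id]
  have hstep : Measurable fun z : ((ℤ → Fin d → ℝ) × (ℤ → Fin N → Bool)) × (Fin N → ℝ) =>
      (z.1.1, Function.update (mask t z.1.2) t
        (choiceResponse B A Γ (shiftBy t z.1.1) (shiftBy t (mask t z.1.2)) z.2)) := by
    have h1 := hΦ.comp (((hmask t).comp measurable_fst).prodMk measurable_snd)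
    exact (measurable_fst.comp measurable_fst).prodMk
      (IsContractive.measurable_update ((IsContractive.measurable_mask t).comp
        (measurable_snd.comp measurable_fst)) t h1)
  rw [hL, hcore, hν, Measure.map_map hJm hg3, Measure.map_map hstep (hRm.prodMap measurable_id)]
  rfl

end IsStationarySolution

end DiscreteChoice

namespace DiscreteChoice

open Filter Topology ENNReal

/-! ### Solutions as factors of the covariates and the noise -/

section Factor

variable {Z α : Type*} [MeasurableSpace Z] [MeasurableSpace α] {Q : Measure Z} {T : Z → Z}

lemma ergodic_shift_map (hT : Ergodic T Q) {G : Z → ℤ → α} (hG : Measurable G)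
    (hc : ∀ ω, G (T ω) = shift (G ω)) : Ergodic shift (Q.map G) :=
  (hG.measurePreserving Q).ergodic_of_ergodic_semiconj hT (measurable_shiftBy 1) hc

end Factor

section SolutionPath

variable {N d p q : ℕ} (B : Fin q → Matrix (Fin N) (Fin N) ℝ)
  (A : Fin p → Matrix (Fin N) (Fin N) ℝ) (Γ : Matrix (Fin N) (Fin d) ℝ)

/-- The path of `(Y, μ, X)` determined by the covariates and the binary responses. -/
noncomputable def solutionPath (z : (ℤ → Fin d → ℝ) × (ℤ → Fin N → Bool)) :
    ℤ → (Fin N → ℝ) × (Fin N → ℝ) × (Fin d → ℝ) :=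
  fun t => (boolVec (z.2 t), latent B A Γ (shiftBy t z.1) (shiftBy t z.2), z.1 t)

variable {B}

lemma measurable_latent_shiftBy (hB : RootsOutsideUnitDisc B) (t : ℤ) :
    Measurable fun z : (ℤ → Fin d → ℝ) × (ℤ → Fin N → Bool) =>
      latent B A Γ (shiftBy t z.1) (shiftBy t z.2) := by
  have h : Measurable fun z : (ℤ → Fin d → ℝ) × (ℤ → Fin N → Bool) =>
      (shiftBy t z.1, shiftBy t z.2) := by fun_prop
  have h' := (measurable_latent A Γ hB).comp h
  exact h'

lemma measurable_solutionPath (hB : RootsOutsideUnitDisc B) :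
    Measurable (solutionPath B A Γ) :=
  measurable_pi_lambda _ fun t =>
    (measurable_boolVec.comp ((measurable_pi_apply t).comp measurable_snd)).prodMk
      ((measurable_latent_shiftBy A Γ hB t).prodMk ((measurable_pi_apply t).comp measurable_fst))

variable (B) in
lemma solutionPath_shift (F : (ℤ → Fin d → ℝ) × (ℤ → Fin N → ℝ) → Fin N → Bool)
    (ω : (ℤ → Fin d → ℝ) × (ℤ → Fin N → ℝ)) :
    solutionPath B A Γ ((shiftPair 1 ω).1, orbit F (shiftPair 1 ω))
      = shift (solutionPath B A Γ (ω.1, orbit F ω)) := by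
  rw [orbit_shiftPair]
  ext t : 1
  simp only [solutionPath, shift, shiftPair, shiftBy_shiftBy, shiftBy_apply]

variable {ν : Measure (Fin N → ℝ)} [IsProbabilityMeasure ν]
  {lam : Measure (ℤ → Fin d → ℝ)} [IsProbabilityMeasure lam]
  {F : (ℤ → Fin d → ℝ) × (ℤ → Fin N → ℝ) → Fin N → Bool}

lemma ergodic_shift_map_solutionPath (hB : RootsOutsideUnitDisc B) (hlam : Ergodic shift lam)
    (hF : Measurable F) {γ : Type*} [MeasurableSpace γ]
    {f : (Fin N → ℝ) × (Fin N → ℝ) × (Fin d → ℝ) → γ} (hf : Measurable f) :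
    Ergodic shift ((lam.prod (iidLaw ν)).map fun ω t => f (solutionPath B A Γ (ω.1, orbit F ω) t)) := by
  refine ergodic_shift_map (ergodic_shiftPair ν hlam) (measurable_pi_lambda _ fun t =>
    hf.comp ((measurable_pi_apply t).comp ((measurable_solutionPath A Γ hB).comp
      (measurable_fst.prodMk (measurable_orbit hF))))) fun ω => ?_
  simp only [solutionPath_shift]
  rfl

variable {A Γ}

/-- Almost surely Y and μ are functions of the covariates and of the signs of Y, whose joint law is
fixed by `HasResponseLaw.eq_map_orbit`. The right-hand side does not involve the solution, which is
uniqueness. -/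
lemma IsStationarySolution.processLaw_eq {Ω : Type*} [MeasurableSpace Ω] {P : Measure Ω}
    [IsProbabilityMeasure P] {X : ℤ → Ω → (Fin d → ℝ)} {Y μ : ℤ → Ω → (Fin N → ℝ)}
    (h : IsStationarySolution ν B A Γ P X Y μ) (hB : RootsOutsideUnitDisc B)
    (hX : processLaw P X = lam) (hlam : MeasurePreserving shift lam lam)
    (hlog : Integrable (fun x : ℤ → Fin d → ℝ => Real.posLog ‖x 0‖) lam)
    {β : ℕ → ℝ} {η : (ℤ → Fin d → ℝ) → ℝ} (hΦ : IsContractive ν (choiceResponse B A Γ) β η)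
    (hF : IsStationaryResponse ν (choiceResponse B A Γ) lam F) :
    processLaw P (fun t ω => (Y t ω, μ t ω, X t ω))
      = (lam.prod (iidLaw ν)).map fun ω => solutionPath B A Γ (ω.1, orbit F ω) := by
  have hXm : Measurable fun ω t => X t ω := measurable_pi_lambda _ h.measurable_X
  have hRm : Measurable fun ω => ((fun s => X s ω), fun s => signVec (Y s ω)) :=
    hXm.prodMk (measurable_pi_lambda _ fun s => measurable_signVec.comp (h.measurable_Y s))
  have hprob := Measure.isProbabilityMeasure_map (μ := P) hRm.aemeasurable
  have hfst : (P.map fun ω => ((fun s => X s ω), fun s => signVec (Y s ω))).map Prod.fst = lam := by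
    rw [Measure.map_map measurable_fst hRm, ← hX]
    rfl
  have hR := (h.hasResponseLaw hB hX hlam hlog).eq_map_orbit hΦ hlam hF hfst
  have hQ : Measurable fun ω : (ℤ → Fin d → ℝ) × (ℤ → Fin N → ℝ) => (ω.1, orbit F ω) :=
    measurable_fst.prodMk (measurable_orbit hF.measurable)
  have h1 : (fun ω t => (Y t ω, μ t ω, X t ω)) =ᵐ[P]
      solutionPath B A Γ ∘ fun ω => ((fun s => X s ω), fun s => signVec (Y s ω)) := by
    filter_upwards [ae_all_iff.2 (h.ae_eq_latent hB hX hlam hlog), ae_all_iff.2 h.ae_eq_boolVec]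
      with ω h1 h2
    ext t : 1
    exact Prod.ext (h2 t) (Prod.ext (h1 t) rfl)
  have hS := measurable_solutionPath A Γ hB
  rw [processLaw, Measure.map_congr h1, ← Measure.map_map hS hRm, hR, Measure.map_map hS hQ]
  rfl

end SolutionPath

/-! ### The solution on the product of the given space with the noise -/

section Construction

variable {α E C Ω₀ : Type*}

/-- The covariate path together with the noise path. -/
def pathPair (X : ℤ → Ω₀ → α) (ω : Ω₀ × (ℤ → E)) : (ℤ → α) × (ℤ → E) :=
  (fun t => X t ω.1, ω.2)

variable [MeasurableSpace α] [MeasurableSpace E] [MeasurableSpace C] [MeasurableSpace Ω₀]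
  {P₀ : Measure Ω₀} [IsProbabilityMeasure P₀] {X : ℤ → Ω₀ → α}
  {ν : Measure E} [IsProbabilityMeasure ν]

variable (ν) in
lemma measurePreserving_pathPair (hX : ∀ t, Measurable (X t)) :
    MeasurePreserving (pathPair X) (P₀.prod (iidLaw ν)) ((processLaw P₀ X).prod (iidLaw ν)) := by
  have : IsProbabilityMeasure (processLaw P₀ X) :=
    Measure.isProbabilityMeasure_map (measurable_pi_lambda _ hX).aemeasurable
  exact ((measurable_pi_lambda _ hX).measurePreserving P₀).prod (MeasurePreserving.id (iidLaw ν))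

variable [Inhabited C] {Φ : (ℤ → α) → (ℤ → C) → E → C} {lam : Measure (ℤ → α)}
  [IsProbabilityMeasure lam] {F : (ℤ → α) × (ℤ → E) → C}

lemma IsStationaryResponse.ae_orbit_eq (hF : IsStationaryResponse ν Φ lam F)
    (hlam : MeasurePreserving shift lam lam) :
    ∀ᵐ ω ∂(lam.prod (iidLaw ν)), ∀ t,
      orbit F ω t = Φ (shiftBy t ω.1) (shiftBy t (orbit F ω)) (ω.2 t) := by
  refine ae_all_iff.2 fun t => ?_
  filter_upwards [(measurePreserving_shiftPair ν hlam t).quasiMeasurePreserving.ae hF.recursion]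
    with ω hω
  rw [orbit_shiftPair] at hω
  simpa [shiftPair, orbit] using hω

omit [IsProbabilityMeasure ν] [IsProbabilityMeasure lam] in
lemma IsStationaryResponse.orbit_update (hF : IsStationaryResponse ν Φ lam F) {s t : ℤ}
    (hst : s < t) (x : ℤ → α) (e : ℤ → E) (e₀ : E) :
    orbit F (x, Function.update e t e₀) s = orbit F (x, e) s := by
  refine hF.congr_noise _ _ _ fun u hu => ?_
  exact Function.update_of_ne (by omega) _ _

omit [IsProbabilityMeasure lam] in
-- The orbit at times s < t uses no noise after s, so changing the noise at t leaves the past and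
-- the covariates untouched.
lemma IsStationaryResponse.map_past_prodMk_noise (hF : IsStationaryResponse ν Φ lam F)
    (hX : ∀ t, Measurable (X t)) (t : ℤ) :
    (P₀.prod (iidLaw ν)).map
        (fun ω => (((fun s => X s ω.1), mask t fun s => orbit F (pathPair X ω) s), ω.2 t))
      = ((P₀.prod (iidLaw ν)).map
        fun ω => ((fun s => X s ω.1), mask t fun s => orbit F (pathPair X ω) s)).prod ν := by
  have hm : Measurable fun ω : Ω₀ × (ℤ → E) => orbit F (pathPair X ω) :=
    (measurable_orbit hF.measurable).comp (measurePreserving_pathPair (P₀ := P₀) ν hX).measurable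
  refine prod_iidLaw_map_prodMk_eval ν P₀ t (measurable_prodMk_mask
    (X := fun s (ω : Ω₀ × (ℤ → E)) => X s ω.1) (S := fun s ω => orbit F (pathPair X ω) s)
    (fun s => (hX s).comp measurable_fst) fun s _ => (measurable_pi_apply s).comp hm)
    fun ω e e₀ => ?_
  refine Prod.ext rfl ?_
  ext s : 1
  simp only [mask]
  split_ifs with hs
  · exact hF.orbit_update hs _ _ _
  · rfl

end Construction

section SectionIntegral

variable {Ω S E C : Type*} [MeasurableSpace Ω] [MeasurableSpace S] [MeasurableSpace E]
  [MeasurableSpace C] [MeasurableSingletonClass C] {P : Measure Ω}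
  [IsProbabilityMeasure P] {ν : Measure E} [IsProbabilityMeasure ν]

omit [IsProbabilityMeasure P] in
lemma measureReal_inter_eq_setIntegral {g : Ω → S} {e : Ω → E} {ψ : S × E → C}
    (hg : Measurable g) (he : Measurable e) (hψ : Measurable ψ)
    (h : P.map (fun ω => (g ω, e ω)) = (P.map g).prod ν) {D : Set S} (hD : MeasurableSet D)
    (c : C) : P.real (g ⁻¹' D ∩ {ω | ψ (g ω, e ω) = c})
      = ∫ ω in g ⁻¹' D, ν.real {a | ψ (g ω, a) = c} ∂P := by
  have hG : MeasurableSet ((Prod.fst : S × E → S) ⁻¹' D ∩ ψ ⁻¹' {c}) :=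
    (measurable_fst hD).inter (hψ (measurableSet_singleton c))
  have hsec : Measurable fun s => ν {a | ψ (s, a) = c} :=
    measurable_measure_prodMk_left (hψ (measurableSet_singleton c))
  have h1 : P (g ⁻¹' D ∩ {ω | ψ (g ω, e ω) = c})
      = ∫⁻ ω in g ⁻¹' D, ν {a | ψ (g ω, a) = c} ∂P := by
    calc _ = P.map (fun ω => (g ω, e ω)) (Prod.fst ⁻¹' D ∩ ψ ⁻¹' {c}) := by
          rw [Measure.map_apply (hg.prodMk he) hG]; rfl
      _ = ∫⁻ s, D.indicator (fun s => ν {a | ψ (s, a) = c}) s ∂(P.map g) := by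
          rw [h, Measure.prod_apply hG]
          refine lintegral_congr fun s => ?_
          by_cases hs : s ∈ D
          · rw [Set.indicator_of_mem hs]
            congr 1
            ext a
            simp [hs]
          · rw [Set.indicator_of_notMem hs]
            convert measure_empty (μ := ν)
            ext a
            simp [hs]
      _ = _ := by
          rw [lintegral_indicator hD, setLIntegral_map hD hsec hg]
  simp only [measureReal_def]
  rw [h1, integral_toReal (f := fun ω => ν {a | ψ (g ω, a) = c}) (hsec.comp hg).aemeasurable (.of_forall fun _ => measure_lt_top _ _)]

end SectionIntegral

section Past

variable {Ω α β C : Type*} [mα : MeasurableSpace α] [mβ : MeasurableSpace β] [MeasurableSpace C]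
  [Inhabited C]

/-- Every event of the conditioning sigma-algebra is thus an event of a single random variable, to
which independence from the noise at `t` applies. -/
lemma pastAndCovariates_le_comap {S : ℤ → Ω → C} {X : ℤ → Ω → β} {f : C → α} (hf : Measurable f)
    (t : ℤ) : pastAndCovariates (fun s ω => f (S s ω)) X t
      ≤ MeasurableSpace.comap (fun ω => ((fun s => X s ω), mask t fun s => S s ω))
        inferInstance := by
  have hg := comap_measurable (m := inferInstance)
    (fun ω => ((fun s => X s ω), mask t fun s => S s ω))
  refine sup_le (iSup_le fun s => ?_) (iSup_le fun s => ?_)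
  · have h1 : Measurable fun z : (ℤ → β) × (ℤ → C) => f (z.2 s) :=
      hf.comp ((measurable_pi_apply _).comp measurable_snd)
    have h2 : (fun ω => f (S s ω)) = (fun z : (ℤ → β) × (ℤ → C) => f (z.2 s)) ∘
        fun ω => ((fun s => X s ω), mask t fun s => S s ω) := by
      funext ω
      simp [mask, Set.mem_Iio.1 s.2]
    change MeasurableSpace.comap (fun ω => f (S s ω)) mα ≤ _
    rw [h2]
    exact (h1.comp hg).comap_le
  · have h1 : Measurable fun z : (ℤ → β) × (ℤ → C) => z.1 s :=
      (measurable_pi_apply _).comp measurable_fst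
    exact (h1.comp hg).comap_le

end Past

end DiscreteChoice

namespace DiscreteChoice

open Filter Topology ENNReal

/-! ### Verification of the solution properties -/

section Existence

variable {N d p q : ℕ} {B : Fin q → Matrix (Fin N) (Fin N) ℝ}
  {A : Fin p → Matrix (Fin N) (Fin N) ℝ} {Γ : Matrix (Fin N) (Fin d) ℝ}
  {Ω₀ : Type*} [MeasurableSpace Ω₀] {P₀ : Measure Ω₀} [IsProbabilityMeasure P₀]
  {X : ℤ → Ω₀ → Fin d → ℝ} {ν : Measure (Fin N → ℝ)} [IsProbabilityMeasure ν]
  {F : (ℤ → Fin d → ℝ) × (ℤ → Fin N → ℝ) → Fin N → Bool}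

/-- The latent vector at time `t` of the responses generated by `F`. -/
noncomputable def latentOf (B : Fin q → Matrix (Fin N) (Fin N) ℝ)
    (A : Fin p → Matrix (Fin N) (Fin N) ℝ) (Γ : Matrix (Fin N) (Fin d) ℝ) (X : ℤ → Ω₀ → Fin d → ℝ)
    (F : (ℤ → Fin d → ℝ) × (ℤ → Fin N → ℝ) → Fin N → Bool) (t : ℤ)
    (ω : Ω₀ × (ℤ → Fin N → ℝ)) : Fin N → ℝ :=
  latent B A Γ (shiftBy t fun s => X s ω.1) (shiftBy t (orbit F (pathPair X ω)))

omit [MeasurableSpace Ω₀] in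
lemma latentOf_eq_mask (t : ℤ) (ω : Ω₀ × (ℤ → Fin N → ℝ)) :
    latentOf B A Γ X F t ω = latent B A Γ (shiftBy t fun s => X s ω.1)
      (shiftBy t (mask t fun s => orbit F (pathPair X ω) s)) := by
  rw [latentOf, latent, latent]
  refine congrArg _ (responsePart_congr A fun s hs => ?_)
  simp only [shiftBy_apply, mask]
  rw [if_pos (by omega)]

lemma ae_orbit_eq_choose (hX : ∀ t, Measurable (X t))
    (hlam : MeasurePreserving shift (processLaw P₀ X) (processLaw P₀ X))
    (hF : IsStationaryResponse ν (choiceResponse B A Γ) (processLaw P₀ X) F) :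
    ∀ᵐ ω ∂(P₀.prod (iidLaw ν)), ∀ t,
      orbit F (pathPair X ω) t = choose (latentOf B A Γ X F t ω) (ω.2 t) := by
  have : IsProbabilityMeasure (processLaw P₀ X) :=
    Measure.isProbabilityMeasure_map (measurable_pi_lambda _ hX).aemeasurable
  exact (measurePreserving_pathPair ν hX).quasiMeasurePreserving.ae (hF.ae_orbit_eq hlam)

lemma measurable_orbit_pathPair (hX : ∀ t, Measurable (X t)) (hF : Measurable F) :
    Measurable fun ω : Ω₀ × (ℤ → Fin N → ℝ) => orbit F (pathPair X ω) := by
  have h : Measurable fun ω : Ω₀ × (ℤ → Fin N → ℝ) => pathPair X ω :=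
    (measurable_pi_lambda _ fun t => (hX t).comp measurable_fst).prodMk measurable_snd
  exact (measurable_orbit hF).comp h

lemma measurable_latentOf (hX : ∀ t, Measurable (X t)) (hF : Measurable F)
    (hB : RootsOutsideUnitDisc B) (t : ℤ) : Measurable (latentOf B A Γ X F t) := by
  have h : Measurable fun ω : Ω₀ × (ℤ → Fin N → ℝ) =>
      ((fun s => X s ω.1), orbit F (pathPair X ω)) :=
    (measurable_pi_lambda _ fun t => (hX t).comp measurable_fst).prodMk
      (measurable_orbit_pathPair hX hF)
  have h' := (measurable_latent_shiftBy A Γ hB t).comp h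
  exact h'

omit [MeasurableSpace Ω₀] in
lemma measurable_past_latentOf (hB : RootsOutsideUnitDisc B) (t : ℤ) :
    Measurable[pastAndCovariates (fun s ω => boolVec (orbit F (pathPair X ω) s))
      (fun s (ω : Ω₀ × (ℤ → Fin N → ℝ)) => X s ω.1) t] (latentOf B A Γ X F t) := by
  have h := measurable_past_prodMk_mask
    (Y := fun s (ω : Ω₀ × (ℤ → Fin N → ℝ)) => boolVec (orbit F (pathPair X ω) s))
    (X := fun s (ω : Ω₀ × (ℤ → Fin N → ℝ)) => X s ω.1) (t := t) measurable_signVec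
  simp only [signVec_boolVec] at h
  have h' := (measurable_latent_shiftBy A Γ hB t).comp h
  have h2 : latentOf B A Γ X F t = (fun z : (ℤ → Fin d → ℝ) × (ℤ → Fin N → Bool) =>
      latent B A Γ (shiftBy t z.1) (shiftBy t z.2)) ∘
      fun ω => ((fun s => X s ω.1), mask t fun s => orbit F (pathPair X ω) s) :=
    funext fun ω => latentOf_eq_mask t ω
  rw [h2]
  exact h'

lemma measurable_measureReal_choose (b : Fin N → Bool) :
    Measurable fun c : Fin N → ℝ => ν.real {e | choose c e = b} :=
  (measurable_measure_prodMk_left (measurable_choose (measurableSet_singleton b))).ennreal_toReal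

/-- The latent vector is a function of the past, which is independent of the noise at `t`, so the
noise can be integrated out by Fubini. This is the defining property of the conditional probability.
-/
lemma setIntegral_measureReal_choose (hX : ∀ t, Measurable (X t)) (hB : RootsOutsideUnitDisc B)
    (hlam : MeasurePreserving shift (processLaw P₀ X) (processLaw P₀ X))
    (hF : IsStationaryResponse ν (choiceResponse B A Γ) (processLaw P₀ X) F) (t : ℤ)
    (b : Fin N → Bool) {D : Set (Ω₀ × (ℤ → Fin N → ℝ))}
    (hD : MeasurableSet[pastAndCovariates (fun s ω => boolVec (orbit F (pathPair X ω) s))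
      (fun s (ω : Ω₀ × (ℤ → Fin N → ℝ)) => X s ω.1) t] D) :
    ∫ ω in D, ν.real {e | choose (latentOf B A Γ X F t ω) e = b} ∂(P₀.prod (iidLaw ν))
      = (P₀.prod (iidLaw ν)).real (D ∩ {ω | orbit F (pathPair X ω) t = b}) := by
  obtain ⟨D', hD', rfl⟩ := pastAndCovariates_le_comap
    (S := fun s (ω : Ω₀ × (ℤ → Fin N → ℝ)) => orbit F (pathPair X ω) s)
    (X := fun s (ω : Ω₀ × (ℤ → Fin N → ℝ)) => X s ω.1) measurable_boolVec t D hD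
  have hψ : Measurable fun z : ((ℤ → Fin d → ℝ) × (ℤ → Fin N → Bool)) × (Fin N → ℝ) =>
      choose (latent B A Γ (shiftBy t z.1.1) (shiftBy t z.1.2)) z.2 := by
    have h1 : Measurable fun z : ((ℤ → Fin d → ℝ) × (ℤ → Fin N → Bool)) × (Fin N → ℝ) => z.1 :=
      measurable_fst
    have h2 := measurable_choose.comp
      (((measurable_latent_shiftBy A Γ hB t).comp h1).prodMk measurable_snd)
    exact h2
  have hg : Measurable fun ω : Ω₀ × (ℤ → Fin N → ℝ) =>
      ((fun s => X s ω.1), mask t fun s => orbit F (pathPair X ω) s) :=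
    measurable_prodMk_mask (X := fun s (ω : Ω₀ × (ℤ → Fin N → ℝ)) => X s ω.1)
      (S := fun s ω => orbit F (pathPair X ω) s) (fun s => (hX s).comp measurable_fst)
      fun s _ => (measurable_pi_apply s).comp (measurable_orbit_pathPair hX hF.measurable)
  have key := measureReal_inter_eq_setIntegral
    (ψ := fun z : ((ℤ → Fin d → ℝ) × (ℤ → Fin N → Bool)) × (Fin N → ℝ) =>
      choose (latent B A Γ (shiftBy t z.1.1) (shiftBy t z.1.2)) z.2) hg
    ((measurable_pi_apply t).comp measurable_snd) hψ
    (hF.map_past_prodMk_noise (P₀ := P₀) hX t) hD' b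
  simp only [latentOf_eq_mask]
  refine key.symm.trans (measureReal_congr ?_)
  filter_upwards [ae_orbit_eq_choose hX hlam hF] with ω hω
  refine propext (and_congr_right fun _ => ?_)
  change choose (latent B A Γ (shiftBy t fun s => X s ω.1)
    (shiftBy t (mask t fun s => orbit F (pathPair X ω) s))) (ω.2 t) = b
      ↔ orbit F (pathPair X ω) t = b
  rw [hω t, latentOf_eq_mask]

theorem isStationarySolution_latentOf (hX : ∀ t, Measurable (X t)) (hB : RootsOutsideUnitDisc B)
    (hlam : Ergodic shift (processLaw P₀ X))
    (hlog : Integrable (fun x : ℤ → Fin d → ℝ => Real.posLog ‖x 0‖) (processLaw P₀ X))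
    (hF : IsStationaryResponse ν (choiceResponse B A Γ) (processLaw P₀ X) F) :
    IsStationarySolution ν B A Γ (P₀.prod (iidLaw ν)) (fun t ω => X t ω.1)
      (fun t ω => boolVec (orbit F (pathPair X ω) t)) (latentOf B A Γ X F) where
  measurable_X t := (hX t).comp measurable_fst
  measurable_Y t := measurable_boolVec.comp
    ((measurable_pi_apply t).comp (measurable_orbit_pathPair hX hF.measurable))
  measurable_μ := measurable_latentOf hX hF.measurable hB
  recursion t := by
    have : IsProbabilityMeasure (processLaw P₀ X) :=
      Measure.isProbabilityMeasure_map (measurable_pi_lambda _ hX).aemeasurable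
    have hsum := (measurePreserving_fst (μ := processLaw P₀ X) (ν := iidLaw ν)).comp
      (measurePreserving_pathPair ν hX) |>.quasiMeasurePreserving.ae
        (ae_summable_impulse hB Γ hlam.toMeasurePreserving hlog)
    filter_upwards [hsum] with ω hω
    have h1 : ∀ t, latentOf B A Γ X F t ω
        = filterState B (input A Γ (fun s => X s ω.1) (orbit F (pathPair X ω))) t 0 := fun t =>
      latent_shiftBy (x := fun s => X s ω.1) A hB (hω t)
    simp only [h1]
    rw [filterState_recursion fun t =>
      summable_impulse_input (x := fun s => X s ω.1) A hB (hω t), add_assoc]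
    rfl
  condLaw t I := by
    classical
    set b : Fin N → Bool := fun i => decide (i ∈ I) with hb
    have hI : {i | b i = true} = I := by ext i; simp [hb]
    have hYm : MeasurableSet ((fun ω : Ω₀ × (ℤ → Fin N → ℝ) =>
        boolVec (orbit F (pathPair X ω) t)) ⁻¹' {indicatorVec I}) :=
      (measurable_boolVec.comp
        ((measurable_pi_apply t).comp (measurable_orbit_pathPair hX hF.measurable)))
        (measurableSet_singleton _)
    have hY : (fun ω : Ω₀ × (ℤ → Fin N → ℝ) =>
        boolVec (orbit F (pathPair X ω) t)) ⁻¹' {indicatorVec I}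
        = {ω | orbit F (pathPair X ω) t = b} := by
      ext ω
      rw [Set.mem_preimage, Set.mem_singleton_iff, ← hI, ← boolVec_eq_indicatorVec]
      exact boolVec_injective.eq_iff
    have hcell : ∀ ω, ν.real (cell I (latentOf B A Γ X F t ω))
        = ν.real {e | choose (latentOf B A Γ X F t ω) e = b} := fun ω => by
      congr 1
      ext e
      rw [← hI]
      exact (choose_eq_iff _ e b).symm
    simp only [hcell]
    have hle := pastAndCovariates_le (t := t)
      (Y := fun s (ω : Ω₀ × (ℤ → Fin N → ℝ)) => boolVec (orbit F (pathPair X ω) s))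
      (X := fun s (ω : Ω₀ × (ℤ → Fin N → ℝ)) => X s ω.1)
      (fun s => measurable_boolVec.comp
        ((measurable_pi_apply s).comp (measurable_orbit_pathPair hX hF.measurable)))
      fun s => (hX s).comp measurable_fst
    have hpm := (measurable_measureReal_choose (ν := ν) b).comp
      (measurable_past_latentOf (X := X) (F := F) (A := A) (Γ := Γ) hB t)
    refine (ae_eq_condExp_of_forall_setIntegral_eq hle ((integrable_const (1 : ℝ)).indicator hYm)
      (fun s _ _ => Integrable.integrableOn (Integrable.of_bound
        (hpm.mono hle le_rfl).aestronglyMeasurable 1 (.of_forall fun ω => ?_)))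
      (fun D hD _ => ?_) hpm.aestronglyMeasurable).symm
    · change ‖ν.real _‖ ≤ 1
      rw [Real.norm_of_nonneg measureReal_nonneg]
      exact measureReal_le_one
    · rw [integral_indicator hYm, integral_const, smul_eq_mul, mul_one,
        measureReal_restrict_apply_univ, measureReal_restrict_apply hYm, hY, Set.inter_comm]
      exact setIntegral_measureReal_choose hX hB hlam.toMeasurePreserving hF t b hD
  stationary := by
    have : IsProbabilityMeasure (processLaw P₀ X) :=
      Measure.isProbabilityMeasure_map (measurable_pi_lambda _ hX).aemeasurable
    -- The pair (Y, μ) is a shift-equivariant image of the stationary pair of covariates and noise.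
    have h1 := (ergodic_shift_map_solutionPath (ν := ν) A Γ hB hlam hF.measurable
      (f := fun y => (y.1, y.2.1))
      (measurable_fst.prodMk (measurable_fst.comp measurable_snd))).toMeasurePreserving
    have h2 : Measurable fun (ω : (ℤ → Fin d → ℝ) × (ℤ → Fin N → ℝ)) (t : ℤ) =>
        ((solutionPath B A Γ (ω.1, orbit F ω) t).1, (solutionPath B A Γ (ω.1, orbit F ω) t).2.1) := by
      have h3 := (measurable_solutionPath A Γ hB).comp
        (measurable_fst.prodMk (measurable_orbit hF.measurable))
      refine measurable_pi_lambda _ fun t => ?_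
      have h4 := (measurable_pi_apply t).comp h3
      exact h4.fst.prodMk h4.snd.fst
    rw [← (measurePreserving_pathPair (P₀ := P₀) ν hX).map_eq, Measure.map_map h2
      (measurePreserving_pathPair (P₀ := P₀) ν hX).measurable] at h1
    exact h1

theorem isGeneratedByNoise_latentOf (hX : ∀ t, Measurable (X t))
    (hlam : MeasurePreserving shift (processLaw P₀ X) (processLaw P₀ X))
    (hF : IsStationaryResponse ν (choiceResponse B A Γ) (processLaw P₀ X) F) :
    IsGeneratedByNoise ν (P₀.prod (iidLaw ν)) (fun t ω => X t ω.1)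
      (fun t ω => boolVec (orbit F (pathPair X ω) t)) (latentOf B A Γ X F) (fun t ω => ω.2 t) where
  measurable_ε t := (measurable_pi_apply t).comp measurable_snd
  law_ε t := ((measurePreserving_eval_infinitePi (fun _ : ℤ => ν) t).comp
    measurePreserving_snd).map_eq
  iIndep_ε := by
    have hm : ∀ t, Measurable fun ω : Ω₀ × (ℤ → Fin N → ℝ) => ω.2 t := fun t =>
      (measurable_pi_apply t).comp measurable_snd
    rw [iIndepFun_iff_map_fun_eq_infinitePi_map hm]
    have h : ∀ t, (P₀.prod (iidLaw ν)).map (fun ω => ω.2 t) = ν := fun t =>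
      ((measurePreserving_eval_infinitePi (fun _ : ℤ => ν) t).comp measurePreserving_snd).map_eq
    simp only [h]
    exact (measurePreserving_snd (μ := P₀) (ν := iidLaw ν)).map_eq
  indep_X := (indepFun_prod (X := fun ω t => X t ω) (Y := id) (measurable_pi_lambda _ hX)
    measurable_id).symm
  choice t := by
    filter_upwards [ae_orbit_eq_choose hX hlam hF] with ω hω
    rw [hω t, boolVec_eq_indicatorVec]
    congr 1
    ext i
    simp [choose]

end Existence

end DiscreteChoice

theorem proposition5 {N d p q : ℕ}
    (B : Fin q → Matrix (Fin N) (Fin N) ℝ) (A : Fin p → Matrix (Fin N) (Fin N) ℝ)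
    (Γ : Matrix (Fin N) (Fin d) ℝ)
    -- the stationary ergodic covariate process, with a logarithmic moment
    {Ω₀ : Type u} [MeasurableSpace Ω₀] (P₀ : Measure Ω₀) [IsProbabilityMeasure P₀]
    (X : ℤ → Ω₀ → (Fin d → ℝ)) (hX : ∀ t, Measurable (X t))
    (hXstat : DiscreteChoice.IsStationary P₀ X) (hXerg : DiscreteChoice.IsErgodic P₀ X)
    (hXlog : Integrable (fun ω => Real.posLog ‖X 0 ω‖) P₀)
    -- the distribution of the noise: full support and Lipschitz c.d.f.
    (ν : Measure (Fin N → ℝ)) [IsProbabilityMeasure ν]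
    (hνsupp : ν.support = Set.univ)
    (hνLip : ∃ K : NNReal, LipschitzWith K (DiscreteChoice.jointCdf ν))
    -- the stability condition
    (hB : DiscreteChoice.RootsOutsideUnitDisc B) :
    -- existence of a stationary solution, on an enlargement of the probability space of `X`
    (∃ (Ω : Type u) (_ : MeasurableSpace Ω) (P : Measure Ω) (π : Ω → Ω₀)
        (Y μ ε : ℤ → Ω → (Fin N → ℝ)),
      IsProbabilityMeasure P ∧ MeasurePreserving π P P₀ ∧
      DiscreteChoice.IsStationarySolution ν B A Γ P (fun t ω => X t (π ω)) Y μ ∧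
      DiscreteChoice.IsGeneratedByNoise ν P (fun t ω => X t (π ω)) Y μ ε) ∧
    -- uniqueness (in law)
    (∀ {Ω₁ : Type v} {Ω₂ : Type w} [MeasurableSpace Ω₁] [MeasurableSpace Ω₂]
        (P₁ : Measure Ω₁) (P₂ : Measure Ω₂) [IsProbabilityMeasure P₁] [IsProbabilityMeasure P₂]
        (X₁ : ℤ → Ω₁ → (Fin d → ℝ)) (Y₁ μ₁ : ℤ → Ω₁ → (Fin N → ℝ))
        (X₂ : ℤ → Ω₂ → (Fin d → ℝ)) (Y₂ μ₂ : ℤ → Ω₂ → (Fin N → ℝ)),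
      DiscreteChoice.processLaw P₁ X₁ = DiscreteChoice.processLaw P₀ X →
      DiscreteChoice.processLaw P₂ X₂ = DiscreteChoice.processLaw P₀ X →
      DiscreteChoice.IsStationarySolution ν B A Γ P₁ X₁ Y₁ μ₁ →
      DiscreteChoice.IsStationarySolution ν B A Γ P₂ X₂ Y₂ μ₂ →
      DiscreteChoice.processLaw P₁ (fun t ω => (Y₁ t ω, μ₁ t ω, X₁ t ω)) =
        DiscreteChoice.processLaw P₂ (fun t ω => (Y₂ t ω, μ₂ t ω, X₂ t ω))) ∧
    -- stationarity and ergodicity of `(Y_t, X_t)` for the stationary solution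
    (∀ {Ω : Type r} [MeasurableSpace Ω] (P : Measure Ω) [IsProbabilityMeasure P]
        (X' : ℤ → Ω → (Fin d → ℝ)) (Y μ : ℤ → Ω → (Fin N → ℝ)),
      DiscreteChoice.processLaw P X' = DiscreteChoice.processLaw P₀ X →
      DiscreteChoice.IsStationarySolution ν B A Γ P X' Y μ →
      DiscreteChoice.IsStationary P (fun t ω => (Y t ω, X' t ω)) ∧
        DiscreteChoice.IsErgodic P (fun t ω => (Y t ω, X' t ω))) := by
  have hXm : Measurable fun ω t => X t ω := measurable_pi_lambda _ hX
  have hprob : IsProbabilityMeasure (DiscreteChoice.processLaw P₀ X) :=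
    Measure.isProbabilityMeasure_map hXm.aemeasurable
  have hlog : Integrable (fun x : ℤ → Fin d → ℝ => Real.posLog ‖x 0‖)
      (DiscreteChoice.processLaw P₀ X) := by
    refine (integrable_map_measure ?_ hXm.aemeasurable).2 hXlog
    exact (Real.continuous_posLog.measurable.comp
      (measurable_norm.comp (measurable_pi_apply 0))).aestronglyMeasurable
  obtain ⟨β, η, hΦ⟩ :=
    DiscreteChoice.exists_isContractive_choiceResponse (B := B) A Γ hB hνsupp hνLip
  obtain ⟨F, hF⟩ := hΦ.exists_isStationaryResponse hXstat
  -- The enlargement adjoins the noise paths as an independent second factor.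
  refine ⟨⟨Ω₀ × (ℤ → Fin N → ℝ), inferInstance, P₀.prod (DiscreteChoice.iidLaw ν), Prod.fst, _, _, _,
    inferInstance, measurePreserving_fst,
    DiscreteChoice.isStationarySolution_latentOf hX hB hXerg hlog hF,
    DiscreteChoice.isGeneratedByNoise_latentOf hX hXstat hF⟩, ?_, ?_⟩
  · intro Ω₁ Ω₂ _ _ P₁ P₂ _ _ X₁ Y₁ μ₁ X₂ Y₂ μ₂ hX₁ hX₂ h₁ h₂
    rw [h₁.processLaw_eq hB hX₁ hXstat hlog hΦ hF, h₂.processLaw_eq hB hX₂ hXstat hlog hΦ hF]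
  · intro Ω _ P _ X' Y μ hX' h
    have hm : Measurable fun (z : ℤ → (Fin N → ℝ) × (Fin N → ℝ) × (Fin d → ℝ)) (t : ℤ) =>
        ((z t).1, (z t).2.2) := by fun_prop
    have hz : Measurable fun ω t => (Y t ω, μ t ω, X' t ω) := measurable_pi_lambda _ fun t =>
      (h.measurable_Y t).prodMk ((h.measurable_μ t).prodMk (h.measurable_X t))
    have hQ : Measurable fun ω : (ℤ → Fin d → ℝ) × (ℤ → Fin N → ℝ) =>
        DiscreteChoice.solutionPath B A Γ (ω.1, DiscreteChoice.orbit F ω) :=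
      (DiscreteChoice.measurable_solutionPath A Γ hB).comp
        (measurable_fst.prodMk (DiscreteChoice.measurable_orbit hF.measurable))
    -- Dropping μ from the common law of all solutions leaves a factor of the ergodic pair of
    -- covariates and noise.
    have h1 := congrArg (Measure.map fun z t => ((z t).1, (z t).2.2))
      (h.processLaw_eq hB hX' hXstat hlog hΦ hF)
    rw [DiscreteChoice.processLaw, Measure.map_map hm hz, Measure.map_map hm hQ] at h1
    have h2 := DiscreteChoice.ergodic_shift_map_solutionPath (ν := ν) A Γ hB hXerg hF.measurable
      (f := fun y => (y.1, y.2.2)) (measurable_fst.prodMk (measurable_snd.comp measurable_snd))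
    have h3 : DiscreteChoice.IsErgodic P (fun t ω => (Y t ω, X' t ω)) := by
      rw [DiscreteChoice.IsErgodic, DiscreteChoice.processLaw]
      change Ergodic DiscreteChoice.shift
        (P.map ((fun z t => ((z t).1, (z t).2.2)) ∘ fun ω t => (Y t ω, μ t ω, X' t ω)))
      rw [h1]
      exact h2
    exact ⟨h3.toMeasurePreserving, h3⟩
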